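/- Let $m\ge 1$ fixed targets $x_1,\dots,x_m\in\mathbb R^2$ have minimum enclosing circle with center $c$ and radius $r_t$. Let $k,\alpha>0$ and $0<h<r_s<d$, put $r=r_t+d$, let $n\ge 3$, $M\in\mathbb R$, and let $f:(0,+\infty]\to(0,1]$ be continuous and strictly increasing. Let $u$ be the unit step function, $u(s)=1$ for $s\ge 0$ and $u(s)=0$ for $s<0$, and let $\bar v$ denote $v$ rotated clockwise by $\pi/2$. The state of the system consists of the positions $y_i\in\mathbb R^2$ of the agents $i=1,\dots,n$ and of the estimates $\hat\rho_{ij}\in\mathbb R$ by agent $i$ of its distance $\rho_{ij}=\|x_j-y_i\|$ to target $j$. Put $\varphi_{ij}=(x_j-y_i)/\rho_{ij}$ and $\hat x_{ij}=y_i+\hat\rho_{ij}\varphi_{ij}$. Let $\hat c_i$ and $\hat r_{i,t}$ be the center and radius of the minimum enclosing circle of $\{\hat x_{ij}\}_{j=1}^m$, and put $\hat\rho_i=\|\hat c_i-y_i\|$, $\hat\varphi_i=(\hat c_i-y_i)/\hat\rho_i$, and $\theta_i$ the angle of $\hat\varphi_i$. Let $\mathcal N_i=\{j\ne i:\|y_j-y_i\|\le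 M\}$ and, for $j\in\mathcal N_i$, let $\beta_{ij}\in[-\pi,\pi)$ be $\theta_i$ minus the angle of $y_j-y_i$, modulo $2\pi$. Let $i^+$ and $i^-$ be elements of $\mathcal N_i$ with the largest and the smallest $\beta_{ij}$, respectively. Put $\sigma_i^+=\arccos(\hat\varphi_{i^+}^{\mathrm T}\hat\varphi_i)$ if $\beta_{ij}\in(0,\pi)$ for some $j\in\mathcal N_i$, and $\sigma_i^+=\pi$ otherwise; put $\sigma_i^-=\arccos(\hat\varphi_{i^-}^{\mathrm T}\hat\varphi_i)$ if $\beta_{ij}\in(-\pi,0)$ for some $j\in\mathcal N_i$, and $\sigma_i^-=\pi$ otherwise. The closed-loop system is $$\dot y_i=k\,[\hat\rho_i-\hat r_{i,t}-d]\,\hat\varphi_i+f(\sigma_i^+/\sigma_i^-)\,\alpha\,u(\hat\rho_i-\hat r_{i,t}-r_s)\,\bar{\hat\varphi}_i,$$ $$\dot{\hat\rho}_{ij}=-\varphi_{ij}^{\mathrm T}\dot y_i\,u(\hat\rho_{ij}-h)+\operatorname{sgn}(\bar\varphi_{ij}^{\mathrm T}\dot y_i)\,\bigl(\bar\varphi_{ij}^{\mathrm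 T}\dot y_i+\hat\rho_{ij}\,\bar\varphi_{ij}^{\mathrm T}\dot\varphi_{ij}\bigr),\qquad \dot\varphi_{ij}=-\bar\varphi_{ij}\bar\varphi_{ij}^{\mathrm T}\dot y_i/\rho_{ij}.$$ As its right-hand side $F$ is discontinuous, solutions are understood in the sense of Krasovskii: absolutely continuous curves $z$ with $\dot z(t)\in\bigcap_{\delta>0}\overline{\operatorname{conv}}\,F(B(z(t),\delta))$ for almost every $t$. (These include all classical and all Carathéodory solutions.) Let $\phi_i\in[0,2\pi)$ be the angle of $-\hat\varphi_i$ and, labelling the agents so that $\phi_1\le\dots\le\phi_n$, put $\delta\phi_i=\phi_{i+1}-\phi_i$ for $i<n$ and $\delta\phi_n=\phi_1+2\pi-\phi_n$. Consider the equilibrium given by $\hat\rho_i=r$, $\hat c_i=c$, $\delta\phi_i=2\pi/n$ and $\hat\rho_{ij}=\rho_{ij}$ for all $i,j$; a state is within $\varepsilon$ of it if $|\hat\rho_i-r|$, $\|\hat c_i-c\|$, $|\delta\phi_i-2\pi/n|$ and $|\hat\rho_{ij}-\rho_{ij}|$ are less than $\varepsilon$ for all $i,j$. Call a state admissible if $\operatorname{dist}(y_i,\operatorname{conv}\{x_1,\dots,x_m\})\ge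 r_s$ and $h\le\hat\rho_{ij}\le\rho_{ij}$ for all $i,j$. If $M\ge 2r\sin(\pi/n)$, then this equilibrium is asymptotically stable with respect to admissible initial states: (1) there is $\delta>0$ such that from every admissible state within $\delta$ of the equilibrium there starts a solution on $[0,\infty)$; (2) for every $\varepsilon>0$ there is $\delta>0$ such that every solution on any interval $[0,T]$ that starts at an admissible state within $\delta$ of the equilibrium stays within $\varepsilon$ of it on $[0,T]$; (3) there is $\delta>0$ such that every solution on $[0,\infty)$ that starts at an admissible state within $\delta$ of the equilibrium converges to it, that is, for every $\varepsilon>0$ it is within $\varepsilon$ of the equilibrium for all sufficiently large $t$. -/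

import Mathlib

open scoped ENNReal

noncomputable section

namespace Circumnav

/-! ### Minimum enclosing circle of a finite family of points of the plane `ℂ = ℝ²` -/

/-- The smallest radius of a disc centred at `c` that contains all points `X j`. -/
def enclosingRadius {ι : Type} (X : ι → ℂ) (c : ℂ) : ℝ := ⨆ j, dist (X j) c

/-- `c` is the centre of a minimum circle of the family `X`. -/
def IsMinCenter {ι : Type} (X : ι → ℂ) (c : ℂ) : Prop :=
  ∀ c', enclosingRadius X c ≤ enclosingRadius X c'

theorem dist_le_enclosingRadius {ι : Type} [Finite ι] (X : ι → ℂ) (c : ℂ) (j : ι) :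
    dist (X j) c ≤ enclosingRadius X c :=
  le_ciSup (f := fun j => dist (X j) c) (Set.finite_range _).bddAbove j

/-- The minimum circle of a nonempty finite family exists and is unique. -/
theorem existsUnique_isMinCenter {ι : Type} [Finite ι] [Nonempty ι] (X : ι → ℂ) :
    ∃! c, IsMinCenter X c := by
  have hlip : LipschitzWith 1 (enclosingRadius X) := by
    refine LipschitzWith.of_le_add fun a b => ?_
    refine ciSup_le fun j => ?_
    have h1 := dist_le_enclosingRadius X b j
    have h2 := dist_triangle (X j) b a
    rw [dist_comm b a] at h2
    linarith
  obtain ⟨j0⟩ := ‹Nonempty ι›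
  have htend : Filter.Tendsto (enclosingRadius X) (Filter.cocompact ℂ) Filter.atTop := by
    refine Filter.tendsto_atTop_mono (fun c => ?_) (tendsto_dist_left_cocompact_atTop (X j0))
    exact dist_le_enclosingRadius X c j0
  obtain ⟨c, hc⟩ := hlip.continuous.exists_forall_le htend
  refine ⟨c, hc, fun c' hc' => ?_⟩
  by_contra hne
  have hpos : 0 < dist c' c := dist_pos.mpr hne
  have heq : enclosingRadius X c' = enclosingRadius X c := le_antisymm (hc' c) (hc c')
  have : Nonempty ι := ⟨j0⟩
  obtain ⟨j, hj⟩ := exists_eq_ciSup_of_finite (f := fun j => dist (X j) ((c' + c) / 2))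
  have hm := hc ((c' + c) / 2)
  have hm' : enclosingRadius X c ≤ dist (X j) ((c' + c) / 2) := by
    rw [hj]; exact hm
  have h1 := dist_le_enclosingRadius X c j
  have h2 := dist_le_enclosingRadius X c' j
  rw [heq] at h2
  have hpar := parallelogram_law_with_norm ℝ (X j - c') (X j - c)
  rw [dist_eq_norm] at hm' h1 h2 hpos
  have e1 : X j - c' + (X j - c) = 2 * (X j - (c' + c) / 2) := by ring
  have e2 : X j - c' - (X j - c) = -(c' - c) := by ring
  rw [e1, e2, norm_neg, norm_mul] at hpar
  have h3 : ‖(2 : ℂ)‖ = 2 := by simp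
  rw [h3] at hpar
  have n1 := norm_nonneg (X j - c)
  have n2 := norm_nonneg (X j - c')
  have n3 : 0 ≤ enclosingRadius X c := n1.trans h1
  nlinarith [mul_self_le_mul_self n1 h1, mul_self_le_mul_self n2 h2, mul_self_le_mul_self n3 hm',
    mul_pos hpos hpos]

/-- The centre of the minimum circle of `X`. -/
def minCenter {ι : Type} (X : ι → ℂ) : ℂ := Classical.epsilon (IsMinCenter X)

/-- The radius of the minimum circle of `X`. -/
def minRadius {ι : Type} (X : ι → ℂ) : ℝ := enclosingRadius X (minCenter X)

theorem isMinCenter_minCenter {ι : Type} [Finite ι] [Nonempty ι] (X : ι → ℂ) :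
    IsMinCenter X (minCenter X) :=
  Classical.epsilon_spec (existsUnique_isMinCenter X).exists

/-! ### Generalized solutions of `x' = F x` with a discontinuous right-hand side -/

section ODE

variable {E : Type} [NormedAddCommGroup E] [NormedSpace ℝ E]

/-- The Krasovskii regularization of the vector field `F`; it reduces to `{F x}` at points where
`F` is continuous. -/
def krasovskii (F : E → E) (x : E) : Set E :=
  ⋂ (δ : ℝ) (_ : 0 < δ), closure (convexHull ℝ (F '' Metric.ball x δ))

theorem mem_krasovskii (F : E → E) (x : E) : F x ∈ krasovskii F x := by
  simp only [krasovskii, Set.mem_iInter]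
  intro δ hδ
  exact subset_closure (subset_convexHull ℝ _ ⟨x, Metric.mem_ball_self hδ, rfl⟩)

/-- `x` is a Krasovskii solution of `x' = F x` on `[0, T]`: it is absolutely continuous, being the
integral of some integrable `v`, and its velocity `v t` lies in `krasovskii F (x t)` for almost
every `t`. By `mem_krasovskii`, every classical or Carathéodory solution is such a solution. -/
def IsSolutionOn (F : E → E) (x : ℝ → E) (T : ℝ) : Prop :=
  ∃ v : ℝ → E, IntervalIntegrable v MeasureTheory.volume 0 T ∧
    (∀ t ∈ Set.Icc 0 T, x t = x 0 + ∫ s in (0 : ℝ)..t, v s) ∧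
    ∀ᵐ t : ℝ, t ∈ Set.Icc 0 T → v t ∈ krasovskii F (x t)

/-- A solution on `[0, ∞)`. -/
def IsGlobalSolution (F : E → E) (x : ℝ → E) : Prop := ∀ T, 0 ≤ T → IsSolutionOn F x T

/-- Asymptotic stability under `x' = F x`, for initial states in `A`, of the equilibrium whose
`ε`-neighbourhoods are `{z | near ε z}`: nearby initial states have solutions on `[0, ∞)`,
all solutions that start close enough stay close as long as they are defined, and all solutions
on `[0, ∞)` that start close enough converge. -/
def IsAsymptoticallyStable (F : E → E) (A : Set E) (near : ℝ → E → Prop) : Prop :=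
  (∃ δ > 0, ∀ z ∈ A, near δ z → ∃ x : ℝ → E, x 0 = z ∧ IsGlobalSolution F x) ∧
  (∀ ε > 0, ∃ δ > 0, ∀ (x : ℝ → E) (T : ℝ), 0 ≤ T → IsSolutionOn F x T → x 0 ∈ A →
    near δ (x 0) → ∀ t ∈ Set.Icc 0 T, near ε (x t)) ∧
  (∃ δ > 0, ∀ x : ℝ → E, IsGlobalSolution F x → x 0 ∈ A → near δ (x 0) →
    ∀ ε > 0, ∀ᶠ t in Filter.atTop, near ε (x t))

end ODE

/-! ### The closed-loop system of `n` agents and `m` targets -/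

/-- The data of the problem. -/
structure Params (m : ℕ) where
  /-- positions of the targets -/
  X : Fin m → ℂ
  /-- radial gain -/
  k : ℝ
  /-- desired tangential speed -/
  α : ℝ
  /-- desired distance to the minimum circle -/
  d : ℝ
  /-- safety distance -/
  rs : ℝ
  /-- threshold in the dynamic compensators -/
  h : ℝ
  /-- detection range of the agents -/
  M : ℝ
  /-- the function that scales the tangential speed -/
  f : ℝ≥0∞ → ℝ

/-- A state: the positions `y i` of the agents, and the estimate `ρ̂ i j` by agent `i` of its
distance to target `j`. -/
abbrev State (n m : ℕ) : Type := (Fin n → ℂ) × (Fin n → Fin m → ℝ)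

/-- The unit vector pointing from `a` to `b`. -/
def unitVec (a b : ℂ) : ℂ := (b - a) / (‖b - a‖ : ℂ)

/-- Clockwise rotation by `π / 2`. -/
def cw (v : ℂ) : ℂ := -Complex.I * v

/-- The unit step function. -/
def step (x : ℝ) : ℝ := if 0 ≤ x then 1 else 0

section System

variable {n m : ℕ} (p : Params m) (z : State n m)

/-- The centre `c` of the minimum circle of the targets. -/
def center : ℂ := minCenter p.X

/-- The radius `r = r_t + d` of the desired orbit. -/
def orbitRadius : ℝ := minRadius p.X + p.d

/-- The distance `ρ` from agent `i` to target `j`. -/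
def rho (i : Fin n) (j : Fin m) : ℝ := ‖p.X j - z.1 i‖

/-- The bearing `φ` of target `j` from agent `i`. -/
def bearing (i : Fin n) (j : Fin m) : ℂ := unitVec (z.1 i) (p.X j)

/-- The position `x̂` of target `j` estimated by agent `i`. -/
def estTarget (i : Fin n) (j : Fin m) : ℂ := z.1 i + (z.2 i j : ℂ) * bearing p z i j

/-- The minimum circle centre `ĉ i` estimated by agent `i`. -/
def estCenter (i : Fin n) : ℂ := minCenter (estTarget p z i)

/-- The minimum circle radius estimated by agent `i`. -/
def estRadius (i : Fin n) : ℝ := minRadius (estTarget p z i)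

/-- The distance from agent `i` to its estimated centre. -/
def estDist (i : Fin n) : ℝ := ‖estCenter p z i - z.1 i‖

/-- The unit vector from agent `i` to its estimated centre. -/
def estDir (i : Fin n) : ℂ := unitVec (z.1 i) (estCenter p z i)

/-- The angle `θ i` of `estDir i`. -/
def theta (i : Fin n) : ℝ := (estDir p z i).arg

/-- The neighbours of agent `i`. -/
def nbrs (i : Fin n) : Finset (Fin n) :=
  open Classical in Finset.univ.filter fun j => j ≠ i ∧ ‖z.1 j - z.1 i‖ ≤ p.M

/-- `θ i` minus the angle of `y j - y i`, wrapped to `[-π, π)`. -/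
def relAngle (i j : Fin n) : ℝ :=
  toIcoMod Real.two_pi_pos (-Real.pi) (theta p z i - (z.1 j - z.1 i).arg)

/-- `i⁺`, a neighbour of `i` with the largest relative angle (`i` itself if there is none). -/
def nextAgent (i : Fin n) : Fin n :=
  open Classical in
  if hne : (nbrs p z i).Nonempty then
    (Finset.exists_max_image (nbrs p z i) (relAngle p z i) hne).choose
  else i

/-- `i⁻`, a neighbour of `i` with the smallest relative angle (`i` itself if there is none). -/
def prevAgent (i : Fin n) : Fin n :=
  open Classical in
  if hne : (nbrs p z i).Nonempty then
    (Finset.exists_min_image (nbrs p z i) (relAngle p z i) hne).choose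
  else i

/-- `σ⁺`. -/
def sigmaPlus (i : Fin n) : ℝ :=
  open Classical in
  if ∃ j ∈ nbrs p z i, relAngle p z i j ∈ Set.Ioo 0 Real.pi then
    Real.arccos (inner ℝ (estDir p z (nextAgent p z i)) (estDir p z i))
  else Real.pi

/-- `σ⁻`. -/
def sigmaMinus (i : Fin n) : ℝ :=
  open Classical in
  if ∃ j ∈ nbrs p z i, relAngle p z i j ∈ Set.Ioo (-Real.pi) 0 then
    Real.arccos (inner ℝ (estDir p z (prevAgent p z i)) (estDir p z i))
  else Real.pi

/-- The control protocol: the velocity of agent `i`. -/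
def velocity (i : Fin n) : ℂ :=
  ((p.k * (estDist p z i - (estRadius p z i + p.d)) : ℝ) : ℂ) * estDir p z i +
  ((p.f (ENNReal.ofReal (sigmaPlus p z i) / ENNReal.ofReal (sigmaMinus p z i)) * p.α *
      step (estDist p z i - estRadius p z i - p.rs) : ℝ) : ℂ) * cw (estDir p z i)

/-- The time derivative of the bearing of target `j` from agent `i`. -/
def bearingDeriv (i : Fin n) (j : Fin m) : ℂ :=
  -((inner ℝ (cw (bearing p z i j)) (velocity p z i) / rho p z i j : ℝ) : ℂ) *
    cw (bearing p z i j)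

/-- The dynamic compensator: the time derivative of the estimate `ρ̂ i j`. -/
def compensator (i : Fin n) (j : Fin m) : ℝ :=
  -(inner ℝ (bearing p z i j) (velocity p z i)) * step (z.2 i j - p.h) +
  Real.sign (inner ℝ (cw (bearing p z i j)) (velocity p z i)) *
    (inner ℝ (cw (bearing p z i j)) (velocity p z i) +
      z.2 i j * inner ℝ (cw (bearing p z i j)) (bearingDeriv p z i j))

/-- The closed-loop vector field. -/
def vectorField (z : State n m) : State n m := (velocity p z, compensator p z)

/-- The angle `φ i = θ i + π` of `-estDir i`, taken in `[0, 2π)`. -/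
def phi (i : Fin n) : ℝ := toIcoMod Real.two_pi_pos 0 (theta p z i + Real.pi)

/-- The angles `φ` in increasing order. -/
def sortedPhi : Fin n → ℝ := phi p z ∘ Tuple.sort (phi p z)

/-- The gaps `δφ i` between consecutive agents, labelled in counterclockwise order. -/
def gap (i : Fin n) : ℝ :=
  if hi : i.val + 1 < n then sortedPhi p z ⟨i.val + 1, hi⟩ - sortedPhi p z i
  else sortedPhi p z ⟨0, i.pos⟩ + 2 * Real.pi - sortedPhi p z i

/-- The initial states allowed: `r_s ≤ D i` and `h ≤ ρ̂ i j ≤ ρ i j`. -/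
def admissible (n : ℕ) : Set (State n m) :=
  {z | (∀ i, p.rs ≤ Metric.infDist (z.1 i) (convexHull ℝ (Set.range p.X))) ∧
    ∀ i j, p.h ≤ z.2 i j ∧ z.2 i j ≤ rho p z i j}

/-- `z` is within `ε` of the equilibrium: every agent is at distance `r` from its estimated
centre, this centre is `c`, all gaps are `2π / n`, and the compensators are at rest, that is, the
estimates `ρ̂ i j` equal the distances `ρ i j`. -/
def NearEquilibrium (ε : ℝ) (z : State n m) : Prop :=
  ∀ i, |estDist p z i - orbitRadius p| < ε ∧ ‖estCenter p z i - center p‖ < ε ∧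
    |gap p z i - 2 * Real.pi / n| < ε ∧ ∀ j, |z.2 i j - rho p z i j| < ε

end System

end Circumnav

end

noncomputable section

namespace Circumnav

/-! ### Differential inequalities along Krasovskii solutions -/

section ODETheory

open Set Filter Topology MeasureTheory

variable {E : Type} [NormedAddCommGroup E] [NormedSpace ℝ E]

/-! Close to the equilibrium the closed loop is a cascade: estimation errors drive the radial
errors, and both perturb the angular dynamics. Each stage has a squared-error Lyapunov function. The
work takes place in a `tube` of states, where agents are numbered counterclockwise by a permutation
`τ` and gaps are measured from the true centre.

In the tube the step functions equal 1, and every agent crosses every line of sight in the same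
sense (`exists_le_inner_velocity`), so the sign in the compensator is also constant. The error of
each distance estimate then decays exponentially (`exists_fderiv_sqError_le`). The estimated radius
depends on these errors in a Lipschitz way, the estimated centre only in a Hölder way of exponent
1/2 (`sq_dist_minCenter_le`). Measuring errors by the square root `estError` makes all bounds linear
without destroying exponential decay. The radial errors decay as well (`exists_fderiv_sqRadial_le`),
hence so does `deviation`.

The remaining discontinuity comes from detection. In the tube, `σ⁺` and `σ⁻` are the angles to the
adjacent agents if these are detected, and `π` otherwise; this is `linkGap`. The speed of an agent
is `f` of the gap ahead divided by the gap behind, so summation by parts turns the derivative of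
`sqGaps` into minus a positive multiple of a sum of products (difference of successive gaps) ×
(speed minus `f 1`), up to `O(deviation)`. Monotonicity of `f` makes each product nonnegative up to
`O(deviation)`, even when links are missing (`exists_le_dissipation`). As the deviation has a small
integral, `sqGaps` stays small: this is stability.

For convergence, if the gaps are not equal then some gap lies below `2π/n` by a definite amount, and
its successor exceeds it by a definite amount. The bound on `M` guarantees that the two agents at
the short gap detect each other, so the product there is bounded below and `sqGaps` falls at a
definite rate (`exists_fderiv_sqGaps_le_neg`).

All estimates bound the derivative of a smooth function along the vector field, pointwise and on a
whole neighbourhood. Such bounds define closed half-spaces, so they pass to Krasovskii velocities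
(`IsSolutionOn.le_barrier`), and no further regularity of the field is needed. Existence follows
from Euler polygons for the field cut off outside the tube. -/

theorem krasovskii_subset_of_ball {F : E → E} {C : Set E} (hC : IsClosed C) (hC' : Convex ℝ C)
    {x₀ x : E} {δ : ℝ} (hF : ∀ z ∈ Metric.ball x₀ δ, F z ∈ C) (hx : x ∈ Metric.ball x₀ δ) :
    krasovskii F x ⊆ C := by
  intro v hv
  have hx' : 0 < δ - dist x x₀ := sub_pos.mpr hx
  have h1 := Set.mem_iInter₂.mp hv (δ - dist x x₀) hx'
  refine closure_minimal (convexHull_min ?_ hC') hC h1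
  rintro _ ⟨z, hz, rfl⟩
  refine hF z ?_
  rw [Metric.mem_ball] at hz ⊢
  linarith [dist_triangle z x x₀]

theorem krasovskii_congr {F G : E → E} {U : Set E} (hU : IsOpen U) (hFG : EqOn F G U) {x : E}
    (hx : x ∈ U) : krasovskii F x ⊆ krasovskii G x := by
  obtain ⟨ε, hε, hball⟩ := Metric.isOpen_iff.mp hU x hx
  intro v hv
  simp only [krasovskii, Set.mem_iInter] at hv ⊢
  intro δ hδ
  have h1 := hv (min δ ε) (lt_min hδ hε)
  refine closure_mono (convexHull_mono ?_) h1
  rintro _ ⟨z, hz, rfl⟩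
  exact ⟨z, Metric.ball_subset_ball (min_le_left _ _) hz,
    (hFG (hball (Metric.ball_subset_ball (min_le_right _ _) hz))).symm⟩

theorem IsSolutionOn.congr {F G : E → E} {U : Set E} (hU : IsOpen U) (hFG : EqOn F G U)
    {x : ℝ → E} {T : ℝ} (hx : IsSolutionOn F x T) (hxU : ∀ t ∈ Icc 0 T, x t ∈ U) :
    IsSolutionOn G x T := by
  obtain ⟨v, hv, hxv, hK⟩ := hx
  refine ⟨v, hv, hxv, ?_⟩
  filter_upwards [hK] with t ht htT
  exact krasovskii_congr hU hFG (hxU t htT) (ht htT)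

theorem IsSolutionOn.mono {F : E → E} {x : ℝ → E} {T T' : ℝ} (hx : IsSolutionOn F x T)
    (h0 : 0 ≤ T') (hT : T' ≤ T) : IsSolutionOn F x T' := by
  obtain ⟨v, hv, hxv, hK⟩ := hx
  refine ⟨v, hv.mono_set ?_, fun t ht => hxv t ⟨ht.1, ht.2.trans hT⟩, ?_⟩
  · rw [uIcc_of_le h0, uIcc_of_le (h0.trans hT)]
    exact Icc_subset_Icc_right hT
  · filter_upwards [hK] with t ht htT
    exact ht ⟨htT.1, htT.2.trans hT⟩

theorem IsSolutionOn.continuousOn {F : E → E} {x : ℝ → E} {T : ℝ} (hx : IsSolutionOn F x T)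
    (hT : 0 ≤ T) : ContinuousOn x (Icc 0 T) := by
  obtain ⟨v, hv, hxv, -⟩ := hx
  have h1 : ContinuousOn (fun t => x 0 + ∫ s in (0 : ℝ)..t, v s) (Icc 0 T) := by
    have := intervalIntegral.continuousOn_primitive_interval' hv left_mem_uIcc
    rw [uIcc_of_le hT] at this
    exact continuousOn_const.add this
  exact h1.congr hxv

/-- The only access to the Krasovskii condition used below: a closed convex constraint that `F`
satisfies near `x t` is inherited by almost all velocities during a short time after `t`. -/
theorem IsSolutionOn.exists_velocity_mem {F : E → E} {x : ℝ → E} {T : ℝ}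
    (hx : IsSolutionOn F x T) : ∃ v : ℝ → E, IntervalIntegrable v volume 0 T ∧
      (∀ s t, 0 ≤ s → s ≤ t → t ≤ T → x t - x s = ∫ τ in s..t, v τ) ∧
      ∀ t, 0 ≤ t → t < T → ∀ C : Set E, IsClosed C → Convex ℝ C → (∀ᶠ z in 𝓝 (x t), F z ∈ C) →
        ∃ t' > t, t' ≤ T ∧ ∀ᵐ s : ℝ, s ∈ Icc t t' → v s ∈ C := by
  by_cases hT : 0 ≤ T
  swap
  · obtain ⟨v, hv, -, -⟩ := hx
    exact ⟨v, hv, fun s t h1 h2 h3 => absurd (h1.trans (h2.trans h3)) hT,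
      fun t h1 h2 => absurd (h1.trans h2.le) hT⟩
  have hcont := hx.continuousOn hT
  obtain ⟨v, hv, hxv, hK⟩ := hx
  refine ⟨v, hv, fun s t hs hst htT => ?_, fun t ht htT C hC hC' hF => ?_⟩
  · have hi : ∀ u ∈ Icc 0 T, IntervalIntegrable v volume 0 u := fun u hu => hv.mono_set (by
      rw [uIcc_of_le hu.1, uIcc_of_le hT]; exact Icc_subset_Icc_right hu.2)
    rw [hxv t ⟨hs.trans hst, htT⟩, hxv s ⟨hs, hst.trans htT⟩, add_sub_add_left_eq_sub,
      intervalIntegral.integral_interval_sub_left]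
    · exact hi t ⟨hs.trans hst, htT⟩
    · exact hi s ⟨hs, hst.trans htT⟩
  · obtain ⟨δ, hδ, hball⟩ := Metric.eventually_nhds_iff_ball.mp hF
    have h1 : ∀ᶠ s in 𝓝[Icc 0 T] t, x s ∈ Metric.ball (x t) δ :=
      (hcont t ⟨ht, htT.le⟩) (Metric.ball_mem_nhds _ hδ)
    obtain ⟨η, hη, hη'⟩ := Metric.mem_nhdsWithin_iff.mp h1
    refine ⟨min (t + η / 2) T, lt_min (by linarith) htT, min_le_right _ _, ?_⟩
    filter_upwards [hK] with s hs hst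
    have hsT : s ∈ Icc 0 T := ⟨ht.trans hst.1, hst.2.trans (min_le_right _ _)⟩
    refine krasovskii_subset_of_ball hC hC' hball (hη' ⟨?_, hsT⟩) (hs hsT)
    rw [Metric.mem_ball, Real.dist_eq, abs_of_nonneg (by linarith [hst.1])]
    linarith [hst.2, min_le_left (t + η / 2) T]

theorem IsSolutionOn.norm_sub_le {F : E → E} {x : ℝ → E} {T : ℝ}
    (hx : IsSolutionOn F x T) {t : ℝ} (ht : 0 ≤ t) (htT : t < T) {C : ℝ}
    (hF : ∀ᶠ z in 𝓝 (x t), ‖F z‖ ≤ C) : ∀ᶠ s in 𝓝[>] t, ‖x s - x t‖ ≤ C * (s - t) := by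
  obtain ⟨v, -, hxv, hC⟩ := hx.exists_velocity_mem
  obtain ⟨t', htt', ht'T, h⟩ := hC t ht htT (Metric.closedBall 0 C) Metric.isClosed_closedBall
    (convex_closedBall 0 C) (by simpa using hF)
  filter_upwards [Ioc_mem_nhdsGT htt'] with s hs
  rw [hxv t s ht hs.1.le (hs.2.trans ht'T)]
  refine (intervalIntegral.norm_integral_le_of_norm_le_const_ae (C := C) ?_).trans_eq ?_
  · filter_upwards [h] with u hu hu'
    rw [uIoc_of_le hs.1.le] at hu'
    simpa using hu ⟨hu'.1.le, hu'.2.trans hs.2⟩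
  · rw [abs_of_pos (sub_pos.mpr hs.1)]

/-- The case of a half-space, integrated over a short time. -/
theorem IsSolutionOn.apply_sub_le [CompleteSpace E] {F : E → E} {x : ℝ → E} {T : ℝ}
    (hx : IsSolutionOn F x T) {t : ℝ} (ht : 0 ≤ t) (htT : t < T) (L : E →L[ℝ] ℝ) {q : ℝ}
    (hF : ∀ᶠ z in 𝓝 (x t), L (F z) ≤ q) : ∀ᶠ s in 𝓝[>] t, L (x s - x t) ≤ q * (s - t) := by
  obtain ⟨v, hv, hxv, hC⟩ := hx.exists_velocity_mem
  obtain ⟨t', htt', ht'T, h⟩ := hC t ht htT {w | L w ≤ q} (isClosed_le L.continuous continuous_const)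
    (convex_halfSpace_le L.isLinear q) hF
  filter_upwards [Ioc_mem_nhdsGT htt'] with s hs
  have hi : IntervalIntegrable v volume t s := hv.mono_set (by
    rw [uIcc_of_le hs.1.le, uIcc_of_le (ht.trans htT.le)]
    exact Icc_subset_Icc ht (hs.2.trans ht'T))
  rw [hxv t s ht hs.1.le (hs.2.trans ht'T), ← L.intervalIntegral_comp_comm hi]
  have h2 : (∫ u in t..s, L (v u)) ≤ ∫ _ in t..s, q := by
    refine intervalIntegral.integral_mono_ae_restrict hs.1.le ?_ intervalIntegrable_const ?_
    · exact ⟨L.integrable_comp hi.1, L.integrable_comp hi.2⟩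
    · rw [EventuallyLE, ae_restrict_iff' measurableSet_Icc]
      filter_upwards [h] with u hu hu'
      exact hu ⟨hu'.1, hu'.2.trans hs.2⟩
  refine h2.trans_eq ?_
  simp [mul_comm]

/-- Freezing the derivative of `W` at `x t` reduces this to a linear functional, for which the
half-space bound is available. It bounds the upper right Dini derivative, so no chain rule for
absolutely continuous curves is needed. -/
theorem IsSolutionOn.slope_le [CompleteSpace E] {F : E → E} {x : ℝ → E} {T : ℝ}
    (hx : IsSolutionOn F x T) {t : ℝ} (ht : 0 ≤ t) (htT : t < T) {W : E → ℝ} {W' : E → E →L[ℝ] ℝ}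
    (hW : HasFDerivAt W (W' (x t)) (x t)) (hW' : ContinuousAt W' (x t)) {C q q' : ℝ}
    (hF : ∀ᶠ z in 𝓝 (x t), ‖F z‖ ≤ C) (hq : ∀ᶠ z in 𝓝 (x t), W' z (F z) ≤ q) (hqq : q < q') :
    ∀ᶠ s in 𝓝[>] t, W (x s) - W (x t) ≤ q' * (s - t) := by
  have hC : 0 ≤ C := by
    obtain ⟨z, hz⟩ := hF.exists
    exact (norm_nonneg _).trans hz
  -- Two errors of size `ε * C` must fit between `q` and `q'`: one from freezing `W'`, one from the
  -- remainder of the linearization. The `+ 1` covers `C = 0`.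
  set ε : ℝ := (q' - q) / (2 * (C + 1)) with hε
  have hεpos : 0 < ε := div_pos (by linarith) (by linarith)
  have hεC : 2 * (ε * C) ≤ q' - q := by
    have : ε * (2 * (C + 1)) = q' - q := by rw [hε]; field_simp
    nlinarith
  have h1 : ∀ᶠ z in 𝓝 (x t), W' (x t) (F z) ≤ q + ε * C := by
    filter_upwards [hF, hq, hW' (Metric.ball_mem_nhds _ hεpos)] with z h1 h2 h3
    rw [mem_preimage, Metric.mem_ball, dist_eq_norm] at h3
    have h4 : |(W' z - W' (x t)) (F z)| ≤ ε * C :=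
      ((W' z - W' (x t)).le_opNorm (F z)).trans (by gcongr)
    rw [sub_apply] at h4
    linarith [(abs_le.mp h4).1]
  have hcont : Tendsto x (𝓝[>] t) (𝓝 (x t)) := by
    have h2 := hx.continuousOn (ht.trans htT.le) t ⟨ht, htT.le⟩
    refine h2.mono_left ?_
    rw [← nhdsWithin_Ioc_eq_nhdsGT htT]
    exact nhdsWithin_mono _ fun s hs => ⟨ht.trans hs.1.le, hs.2⟩
  have h5 := hcont.eventually (hW.isLittleO.def hεpos)
  filter_upwards [hx.norm_sub_le ht htT hF, hx.apply_sub_le ht htT (W' (x t)) h1, h5,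
    self_mem_nhdsWithin] with s h6 h7 h8 h9
  have h10 : 0 < s - t := sub_pos.mpr h9
  rw [Real.norm_eq_abs] at h8
  have h11 := (abs_le.mp h8).2
  have h12 : ε * ‖x s - x t‖ ≤ ε * (C * (s - t)) := by gcongr
  nlinarith

/-- A Lyapunov-type comparison principle: `W` stays below the barrier `B` along a solution if,
whenever they meet, the derivative of `W` along the vector field near the solution is smaller
than that of `B`. -/
theorem IsSolutionOn.le_barrier [CompleteSpace E] {F : E → E} {x : ℝ → E} {T : ℝ}
    (hx : IsSolutionOn F x T) {a b : ℝ} (ha : 0 ≤ a) (hbT : b ≤ T)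
    {W : E → ℝ} {W' : E → E →L[ℝ] ℝ} {B B' : ℝ → ℝ}
    (hW : ∀ t ∈ Icc a b, HasFDerivAt W (W' (x t)) (x t))
    (hW' : ∀ t ∈ Icc a b, ContinuousAt W' (x t))
    (hF : ∀ t ∈ Icc a b, ∃ C, ∀ᶠ z in 𝓝 (x t), ‖F z‖ ≤ C)
    (hB : ∀ t, HasDerivAt B (B' t) t) (h0 : W (x a) ≤ B a)
    (h : ∀ t ∈ Icc a b, W (x t) = B t → ∃ q < B' t, ∀ᶠ z in 𝓝 (x t), W' z (F z) ≤ q) :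
    ∀ t ∈ Icc a b, W (x t) ≤ B t := by
  intro t₀ ht₀
  have hab : a ≤ b := ht₀.1.trans ht₀.2
  have hxc : ContinuousOn x (Icc a b) :=
    (hx.continuousOn (ha.trans (hab.trans hbT))).mono (Icc_subset_Icc ha hbT)
  have hWc : ContinuousOn (fun t => W (x t)) (Icc a b) := fun t ht =>
    ((hW t ht).continuousAt.comp_continuousWithinAt (hxc t ht) :)
  have hBc : Continuous B := continuous_iff_continuousAt.mpr fun t => (hB t).continuousAt
  have hcl : IsClosed ({t | W (x t) ≤ B t} ∩ Icc a b) := by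
    have := isClosed_Icc.isClosed_le hWc hBc.continuousOn
    rwa [inter_comm]
  -- Induction along the interval: the set of good times is closed, contains `a`, and can be
  -- extended to the right from each of its points.
  refine hcl.Icc_subset_of_forall_exists_gt h0 ?_ ht₀
  rintro t ⟨ht, htab⟩ y hy
  have htI : t ∈ Icc a b := Ico_subset_Icc_self htab
  have key : ∀ᶠ s in 𝓝[>] t, W (x s) ≤ B s := by
    have ht0 : 0 ≤ t := ha.trans htab.1
    have htT : t < T := htab.2.trans_le hbT
    rcases (show W (x t) ≤ B t from ht).lt_or_eq with hlt | heq
    · have h1 : ∀ᶠ s in 𝓝[Icc a b] t, W (x s) < B s :=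
        (hWc t htI).eventually_lt hBc.continuousWithinAt hlt
      have h2 : 𝓝[>] t ≤ 𝓝[Icc a b] t := by
        rw [← nhdsWithin_Ioc_eq_nhdsGT htab.2]
        exact nhdsWithin_mono _ fun s hs => ⟨htab.1.trans hs.1.le, hs.2⟩
      exact (h1.filter_mono h2).mono fun s hs => hs.le
    · obtain ⟨q, hqB, hq⟩ := h t htI heq
      obtain ⟨C, hC⟩ := hF t htI
      obtain ⟨q', hq1, hq2⟩ := exists_between hqB
      have h1 := hx.slope_le ht0 htT (hW t htI) (hW' t htI) hC hq hq1
      have h2 : ∀ᶠ s in 𝓝[>] t, q' < slope B t s := by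
        have := (hasDerivAt_iff_tendsto_slope.mp (hB t)).eventually (lt_mem_nhds hq2)
        exact this.filter_mono (nhdsWithin_mono _ fun s hs => ne_of_gt hs)
      filter_upwards [h1, h2, self_mem_nhdsWithin] with s h3 h4 h5
      rw [slope_def_field, lt_div_iff₀ (sub_pos.mpr h5)] at h4
      linarith
  have := (key.and (Ioc_mem_nhdsGT hy)).exists
  exact this

/-! ### Existence of Krasovskii solutions for bounded vector fields -/

/-- A Lipschitz curve in finite dimension is differentiable almost everywhere and is the integral of
its derivative, which serves as the velocity. -/
theorem isSolutionOn_of_lipschitz [FiniteDimensional ℝ E] {F : E → E} {x : ℝ → E} {C : NNReal}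
    (hx : LipschitzWith C x)
    (hd : ∀ t, 0 ≤ t → DifferentiableAt ℝ x t → deriv x t ∈ krasovskii F (x t)) {T : ℝ} :
    IsSolutionOn F x T := by
  have := FiniteDimensional.complete ℝ E
  have hae : ∀ᵐ t : ℝ, DifferentiableAt ℝ x t := hx.ae_differentiableAt_real
  have hint : ∀ a b, IntervalIntegrable (deriv x) volume a b := fun a b =>
    (intervalIntegrable_const (c := (C : ℝ))).mono_fun (stronglyMeasurable_deriv x).aestronglyMeasurable
      (Eventually.of_forall fun t => by
        simpa using norm_deriv_le_of_lipschitz hx)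
  refine ⟨deriv x, hint 0 T, fun t _ => ?_, ?_⟩
  -- The fundamental theorem of calculus for absolutely continuous functions is scalar, so it is
  -- applied to each functional `L`.
  · refine (SeparatingDual.eq_iff_forall_dual_eq (R := ℝ)).mpr fun L => ?_
    have hL : LipschitzWith (‖L‖₊ * C) (fun s => L (x s)) := L.lipschitz.comp hx
    have h1 := (hL.lipschitzOnWith (s := uIcc 0 t)).absolutelyContinuousOnInterval.integral_deriv_eq_sub
    have h2 : (∫ s in (0 : ℝ)..t, deriv (fun s => L (x s)) s) = ∫ s in (0 : ℝ)..t, L (deriv x s) := by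
      refine intervalIntegral.integral_congr_ae ?_
      filter_upwards [hae] with s hs _
      exact (L.hasFDerivAt.comp_hasDerivAt s hs.hasDerivAt).deriv
    rw [h2, L.intervalIntegral_comp_comm (hint 0 t)] at h1
    rw [map_add, h1]
    ring
  · filter_upwards [hae] with t ht htT
    exact hd t htT.1 ht

/-- The points of the Euler scheme of step `ε` for `x' = F x`. -/
def euler (F : E → E) (ε : ℝ) (z : E) (j : ℕ) : E := (fun w => w + ε • F w)^[j] z

theorem euler_add_sub (F : E → E) (ε : ℝ) (z : E) (a m : ℕ) :
    euler F ε z (a + m) - euler F ε z a = ∑ i ∈ Finset.range m, ε • F (euler F ε z (a + i)) := by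
  have h := Finset.sum_range_sub (fun i => euler F ε z (a + i)) m
  rw [add_zero] at h
  rw [← h]
  refine Finset.sum_congr rfl fun i _ => ?_
  rw [← add_assoc]
  simp only [euler, Function.iterate_succ_apply', add_sub_cancel_left]

theorem norm_euler_sub_le {F : E → E} {C : ℝ} (hF : ∀ z, ‖F z‖ ≤ C) {ε : ℝ} (hε : 0 ≤ ε) (z : E)
    (a m : ℕ) : ‖euler F ε z (a + m) - euler F ε z a‖ ≤ C * (m * ε) := by
  rw [euler_add_sub]
  refine (norm_sum_le_of_le (n := fun _ => ε * C) _ fun i _ => ?_).trans_eq ?_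
  · rw [norm_smul, Real.norm_of_nonneg hε]
    exact mul_le_mul_of_nonneg_left (hF _) hε
  · simp; ring

theorem tendsto_natFloor_mul {l : Filter ℕ} {ε : ℕ → ℝ} (hε : ∀ N, 0 < ε N)
    (hl : Tendsto ε l (𝓝 0)) {t : ℝ} (ht : 0 ≤ t) :
    Tendsto (fun N => (⌊t / ε N⌋₊ : ℝ) * ε N) l (𝓝 t) := by
  refine tendsto_of_tendsto_of_tendsto_of_le_of_le (g := fun N => t - ε N) (h := fun _ => t)
    (by simpa using tendsto_const_nhds.sub hl) tendsto_const_nhds (fun N => ?_) fun N => ?_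
  · have h1 := Nat.sub_one_lt_floor (t / ε N)
    have h2 : t / ε N * ε N = t := div_mul_cancel₀ _ (hε N).ne'
    simp only
    nlinarith [hε N]
  · have h1 := Nat.floor_le (div_nonneg ht (hε N).le)
    have h2 : t / ε N * ε N = t := div_mul_cancel₀ _ (hε N).ne'
    simp only
    nlinarith [hε N]

/-- Euler polygons converge pointwise along an ultrafilter, which replaces the extraction of a
subsequence. A difference quotient of a polygon is an average of values of `F` at points visited on
the way. Over short times these points lie near `x t`, so limits of the averages lie in the closed
convex hulls that define `krasovskii`. -/
theorem exists_isGlobalSolution [FiniteDimensional ℝ E] {F : E → E} {C : NNReal}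
    (hF : ∀ z, ‖F z‖ ≤ C) (z : E) : ∃ x : ℝ → E, x 0 = z ∧ IsGlobalSolution F x := by
  let 𝒰 : Ultrafilter ℕ := hyperfilter ℕ
  let ε : ℕ → ℝ := fun N => 1 / ((N : ℝ) + 1)
  have hε : ∀ N, 0 < ε N := fun N => Nat.one_div_pos_of_nat
  have hε0 : Tendsto ε 𝒰 (𝓝 0) :=
    tendsto_one_div_add_atTop_nhds_zero_nat.mono_left Nat.hyperfilter_le_atTop
  let X : ℕ → ℝ → E := fun N t => euler F (ε N) z ⌊max t 0 / ε N⌋₊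
  have hfl : ∀ t : ℝ, Tendsto (fun N => (⌊max t 0 / ε N⌋₊ : ℝ) * ε N) 𝒰 (𝓝 (max t 0)) :=
    fun t => tendsto_natFloor_mul hε hε0 (le_max_right _ _)
  have hmono : ∀ N s t, s ≤ t → ⌊max s 0 / ε N⌋₊ ≤ ⌊max t 0 / ε N⌋₊ := fun N s t hst =>
    Nat.floor_mono (div_le_div_of_nonneg_right (max_le_max_right _ hst) (hε N).le)
  have hlim : ∀ t, ∃ w, Tendsto (fun N => X N t) 𝒰 (𝓝 w) := by
    intro t
    have hb : ∀ N, X N t ∈ Metric.closedBall z (C * max t 0) := by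
      intro N
      have h1 := norm_euler_sub_le hF (hε N).le z 0 ⌊max t 0 / ε N⌋₊
      rw [zero_add] at h1
      rw [mem_closedBall_iff_norm]
      refine h1.trans ?_
      have h2 := Nat.floor_le (div_nonneg (le_max_right t 0) (hε N).le)
      rw [le_div_iff₀ (hε N)] at h2
      gcongr
    have := FiniteDimensional.proper ℝ E
    obtain ⟨w, -, hw⟩ := (isCompact_closedBall z (C * max t 0)).ultrafilter_le_nhds
      (𝒰.map fun N => X N t) (by
        rw [le_principal_iff]
        exact Eventually.of_forall (f := (𝒰 : Filter ℕ)) hb)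
    exact ⟨w, hw⟩
  choose x hx using hlim
  have hx0 : x 0 = z := by
    refine tendsto_nhds_unique (hx 0) ?_
    simp [X, euler]
  have hlip' : ∀ s t, s ≤ t → ‖x t - x s‖ ≤ C * (max t 0 - max s 0) := by
    intro s t hst
    refine le_of_tendsto_of_tendsto ((hx t).sub (hx s)).norm
      (((hfl t).sub (hfl s)).const_mul (C : ℝ)) (Eventually.of_forall fun N => ?_)
    obtain ⟨m, hm⟩ := Nat.exists_eq_add_of_le (hmono N s t hst)
    have h1 := norm_euler_sub_le hF (hε N).le z ⌊max s 0 / ε N⌋₊ m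
    rw [← hm] at h1
    refine h1.trans_eq ?_
    simp only [hm]; push_cast; ring
  have hlip : LipschitzWith C x := by
    have h1 : ∀ s t, s ≤ t → ‖x t - x s‖ ≤ C * (t - s) := fun s t hst => by
      refine (hlip' s t hst).trans (mul_le_mul_of_nonneg_left ?_ C.2)
      rcases le_total t 0 with h | h <;> rcases le_total s 0 with h' | h' <;> simp [h, h'] <;> linarith
    refine LipschitzWith.of_dist_le_mul fun s t => ?_
    rcases le_total s t with h | h
    · rw [dist_comm, dist_eq_norm, dist_comm, Real.dist_eq, abs_of_nonneg (sub_nonneg.mpr h)]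
      exact h1 s t h
    · rw [dist_eq_norm, Real.dist_eq, abs_of_nonneg (sub_nonneg.mpr h)]
      exact h1 t s h
  refine ⟨x, hx0, fun T _ => isSolutionOn_of_lipschitz hlip fun t ht hdiff => ?_⟩
  simp only [krasovskii, Set.mem_iInter]
  intro δ hδ
  have hslope : Tendsto (slope x t) (𝓝[>] t) (𝓝 (deriv x t)) :=
    (hasDerivAt_iff_tendsto_slope.mp hdiff.hasDerivAt).mono_left
      (nhdsWithin_mono _ fun s hs => ne_of_gt hs)
  refine isClosed_closure.mem_of_tendsto hslope ?_
  -- In this time a polygon of speed at most `C` moves by less than `δ / 2`; the other half of `δ`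
  -- is left for the distance between `X N t` and its limit.
  have hη : 0 < δ / (2 * (C + 1)) := by positivity
  filter_upwards [Ioo_mem_nhdsGT (show t < t + δ / (2 * (C + 1)) by linarith)] with s hs
  have hst : t < s := hs.1
  have hCs : C * (s - t) < δ / 2 := by
    have h1 : s - t < δ / (2 * (C + 1)) := by linarith [hs.2]
    rw [lt_div_iff₀ (by positivity)] at h1
    nlinarith [C.2, sub_pos.mpr hst]
  have hmax : max t 0 = t := max_eq_left ht
  have hmax' : max s 0 = s := max_eq_left (ht.trans hst.le)
  have hm : Tendsto (fun N => (⌊max s 0 / ε N⌋₊ : ℝ) * ε N - ⌊max t 0 / ε N⌋₊ * ε N) 𝒰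
      (𝓝 (s - t)) := by
    simpa only [hmax, hmax'] using (hfl s).sub (hfl t)
  have hq : Tendsto (fun N => ((⌊max s 0 / ε N⌋₊ : ℝ) * ε N - ⌊max t 0 / ε N⌋₊ * ε N)⁻¹ •
      (X N s - X N t)) 𝒰 (𝓝 (slope x t s)) := by
    rw [slope_def_module]
    exact (hm.inv₀ (sub_pos.mpr hst).ne').smul ((hx s).sub (hx t))
  refine isClosed_closure.mem_of_tendsto hq ?_
  have hCm : ∀ᶠ N in (𝒰 : Filter ℕ),
      C * ((⌊max s 0 / ε N⌋₊ : ℝ) * ε N - ⌊max t 0 / ε N⌋₊ * ε N) < δ / 2 :=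
    (hm.const_mul (C : ℝ)).eventually (gt_mem_nhds hCs)
  filter_upwards [hm.eventually (lt_mem_nhds (sub_pos.mpr hst)), hCm,
    (hx t) (Metric.ball_mem_nhds _ (half_pos hδ))] with N h1 h2 h3
  refine subset_closure ?_
  obtain ⟨m, hm'⟩ := Nat.exists_eq_add_of_le (hmono N t s hst.le)
  have hX : X N s - X N t =
      ∑ i ∈ Finset.range m, ε N • F (euler F (ε N) z (⌊max t 0 / ε N⌋₊ + i)) := by
    rw [← euler_add_sub, ← hm']
  have hmε : (⌊max s 0 / ε N⌋₊ : ℝ) * ε N - ⌊max t 0 / ε N⌋₊ * ε N = m * ε N := by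
    rw [hm']; push_cast; ring
  rw [hmε] at h1 h2 ⊢
  have hmpos : (0 : ℝ) < m := pos_of_mul_pos_left h1 (hε N).le
  rw [hX, Finset.smul_sum]
  simp_rw [smul_smul]
  have hw : (m * ε N)⁻¹ * ε N = (m : ℝ)⁻¹ := by
    have := (hε N).ne'
    field_simp
  rw [hw]
  -- The quotient is the average of `m` values of `F` with equal weights.
  refine (convex_convexHull ℝ _).sum_mem (fun _ _ => by positivity) ?_ fun i hi => ?_
  · rw [Finset.sum_const, Finset.card_range, nsmul_eq_mul, mul_inv_cancel₀ hmpos.ne']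
  · refine subset_convexHull ℝ _ ⟨_, ?_, rfl⟩
    have h4 := norm_euler_sub_le hF (hε N).le z ⌊max t 0 / ε N⌋₊ i
    have h5 : (i : ℝ) ≤ m := by exact_mod_cast (Finset.mem_range.mp hi).le
    have h6 : C * (i * ε N) ≤ C * (m * ε N) :=
      mul_le_mul_of_nonneg_left (mul_le_mul_of_nonneg_right h5 (hε N).le) C.2
    rw [← dist_eq_norm] at h4
    rw [mem_preimage, Metric.mem_ball] at h3
    rw [Metric.mem_ball]
    have h7 := dist_triangle (euler F (ε N) z (⌊max t 0 / ε N⌋₊ + i)) (X N t) (x t)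
    have h8 : dist (euler F (ε N) z (⌊max t 0 / ε N⌋₊ + i)) (X N t) ≤ C * (i * ε N) := h4
    linarith

end ODETheory

/-! ### Perturbation of minimum enclosing circles -/

section MinCircle

variable {ι : Type} [Finite ι] [Nonempty ι]

theorem enclosingRadius_le_add {X X' : ι → ℂ} {e : ℝ} (h : ∀ j, dist (X j) (X' j) ≤ e) (c : ℂ) :
    enclosingRadius X c ≤ enclosingRadius X' c + e := by
  refine ciSup_le fun j => ?_
  linarith [dist_triangle (X j) (X' j) c, dist_le_enclosingRadius X' c j, h j]

theorem enclosingRadius_nonneg (X : ι → ℂ) (c : ℂ) : 0 ≤ enclosingRadius X c := by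
  obtain ⟨j⟩ := ‹Nonempty ι›
  exact dist_nonneg.trans (dist_le_enclosingRadius X c j)

theorem minRadius_nonneg (X : ι → ℂ) : 0 ≤ minRadius X := enclosingRadius_nonneg X _

theorem minRadius_le_add {X X' : ι → ℂ} {e : ℝ} (h : ∀ j, dist (X j) (X' j) ≤ e) :
    minRadius X ≤ minRadius X' + e :=
  (isMinCenter_minCenter X _).trans (enclosingRadius_le_add h _)

theorem abs_minRadius_sub_le {X X' : ι → ℂ} {e : ℝ} (h : ∀ j, dist (X j) (X' j) ≤ e) :
    |minRadius X - minRadius X'| ≤ e := by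
  have h1 := minRadius_le_add h
  have h2 := minRadius_le_add (X := X') (X' := X) (e := e) fun j => by rw [dist_comm]; exact h j
  exact abs_le.mpr ⟨by linarith, by linarith⟩

/-- Quantitative uniqueness of the centre. The parallelogram law is applied to the point of the
family farthest from the midpoint of `c` and `c'`; minimality of `c` bounds that distance below. -/
theorem IsMinCenter.sq_dist_le {X : ι → ℂ} {c : ℂ} (hc : IsMinCenter X c) (c' : ℂ) :
    dist c' c ^ 2 ≤ 2 * (enclosingRadius X c' ^ 2 - enclosingRadius X c ^ 2) := by
  obtain ⟨j, hj⟩ := exists_eq_ciSup_of_finite (f := fun j => dist (X j) ((c' + c) / 2))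
  have hm' : enclosingRadius X c ≤ dist (X j) ((c' + c) / 2) := by
    rw [hj]; exact hc ((c' + c) / 2)
  have h1 := dist_le_enclosingRadius X c j
  have h2 := dist_le_enclosingRadius X c' j
  have hpar := parallelogram_law_with_norm ℝ (X j - c') (X j - c)
  rw [dist_eq_norm] at hm' h1 h2 ⊢
  have e1 : X j - c' + (X j - c) = 2 * (X j - (c' + c) / 2) := by ring
  have e2 : X j - c' - (X j - c) = -(c' - c) := by ring
  rw [e1, e2, norm_neg, norm_mul] at hpar
  have h3 : ‖(2 : ℂ)‖ = 2 := by simp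
  rw [h3] at hpar
  have n1 := norm_nonneg (X j - c)
  have n2 := norm_nonneg (X j - c')
  have n3 : 0 ≤ enclosingRadius X c := n1.trans h1
  nlinarith [mul_self_le_mul_self n1 h1, mul_self_le_mul_self n2 h2, mul_self_le_mul_self n3 hm']

/-- The centre of the minimum circle is Hölder continuous of exponent `1 / 2`. -/
theorem sq_dist_minCenter_le {X X' : ι → ℂ} {e : ℝ} (h : ∀ j, dist (X j) (X' j) ≤ e) :
    dist (minCenter X) (minCenter X') ^ 2 ≤ 8 * e * (minRadius X' + e) := by
  have h1 := (isMinCenter_minCenter X').sq_dist_le (minCenter X)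
  have h2 := enclosingRadius_le_add (X := X') (X' := X) (e := e)
    (fun j => by rw [dist_comm]; exact h j) (minCenter X)
  have h3 := minRadius_le_add h
  have h4 : 0 ≤ enclosingRadius X' (minCenter X) := enclosingRadius_nonneg _ _
  have h5 := minRadius_nonneg X'
  change _ ≤ 2 * (_ - minRadius X' ^ 2) at h1
  change _ ≤ minRadius X + e at h2
  have h6 : enclosingRadius X' (minCenter X) ≤ minRadius X' + 2 * e := by linarith
  nlinarith [mul_self_le_mul_self h4 h6]

end MinCircle

/-! ### Elementary facts about unit vectors -/

theorem norm_cw (v : ℂ) : ‖cw v‖ = ‖v‖ := by simp [cw]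

theorem inner_cw_cw (v w : ℂ) : inner ℝ (cw v) (cw w) = inner ℝ v w := by
  simp [cw, Complex.inner]

theorem inner_cw_self (v : ℂ) : inner ℝ v (cw v) = 0 := by
  simp [cw, Complex.inner, mul_comm]

theorem norm_unitVec {a b : ℂ} (h : a ≠ b) : ‖unitVec a b‖ = 1 := by
  have : ‖b - a‖ ≠ 0 := norm_ne_zero_iff.mpr (sub_ne_zero.mpr h.symm)
  simp [unitVec, this]

theorem norm_mul_unitVec (a b : ℂ) : (‖b - a‖ : ℂ) * unitVec a b = b - a := by
  rcases eq_or_ne a b with rfl | h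
  · simp
  · have : (‖b - a‖ : ℂ) ≠ 0 := by
      exact_mod_cast norm_ne_zero_iff.mpr (sub_ne_zero.mpr h.symm)
    rw [unitVec, mul_div_cancel₀ _ this]

theorem norm_unitVec_le (a b : ℂ) : ‖unitVec a b‖ ≤ 1 := by
  rcases eq_or_ne a b with rfl | h
  · simp [unitVec]
  · exact (norm_unitVec h).le

/-- Normalization is Lipschitz away from the origin. -/
theorem norm_unitVec_sub_le {y a b : ℂ} (ha : y ≠ a) :
    ‖unitVec y a - unitVec y b‖ ≤ 2 * ‖a - b‖ / ‖a - y‖ := by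
  have hpos : 0 < ‖a - y‖ := norm_pos_iff.mpr (sub_ne_zero.mpr ha.symm)
  rw [le_div_iff₀ hpos]
  have e : ((‖a - y‖ : ℝ) : ℂ) * (unitVec y a - unitVec y b) =
      (a - b) + ((‖b - y‖ - ‖a - y‖ : ℝ) : ℂ) * unitVec y b := by
    rw [mul_sub, norm_mul_unitVec]
    have := norm_mul_unitVec y b
    push_cast
    linear_combination -this
  have h1 : ‖a - y‖ * ‖unitVec y a - unitVec y b‖ ≤ ‖a - b‖ + ‖a - b‖ * 1 := by
    calc ‖a - y‖ * ‖unitVec y a - unitVec y b‖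
        = ‖((‖a - y‖ : ℝ) : ℂ) * (unitVec y a - unitVec y b)‖ := by
          rw [norm_mul, Complex.norm_real, norm_norm]
      _ ≤ ‖a - b‖ + ‖a - b‖ * 1 := by
          rw [e]
          refine norm_add_le_of_le le_rfl ?_
          rw [norm_mul, Complex.norm_real]
          refine mul_le_mul ?_ (norm_unitVec_le _ _) (norm_nonneg _) (norm_nonneg _)
          have := abs_norm_sub_norm_le (b - y) (a - y)
          rwa [sub_sub_sub_cancel_right, norm_sub_rev b a] at this
  linarith

/-! ### A neighbourhood of the equilibrium and the estimates of the agents in it -/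

section Tube

open Filter Topology

variable {n m : ℕ}

/-- The standing assumptions on the data. -/
structure Params.IsRegular (p : Params m) : Prop where
  k_pos : 0 < p.k
  α_pos : 0 < p.α
  h_pos : 0 < p.h
  h_lt : p.h < p.rs
  rs_lt : p.rs < p.d
  strictMono : StrictMonoOn p.f (Set.Ioi 0)
  maps : Set.MapsTo p.f (Set.Ioi 0) (Set.Ioc 0 1)

/-- The counterclockwise angle from agent `τ k` to agent `τ (k + 1)`, seen from the true centre. -/
def trueGap [NeZero n] (p : Params m) (τ : Equiv.Perm (Fin n)) (k : Fin n) (z : State n m) : ℝ :=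
  ((z.1 (τ (k + 1)) - center p) / (z.1 (τ k) - center p)).arg

/-- The angle between the estimated directions of the agents `τ k` and `τ (k + 1)`. -/
def estGap [NeZero n] (p : Params m) (τ : Equiv.Perm (Fin n)) (k : Fin n) (z : State n m) : ℝ :=
  (estDir p z (τ (k + 1)) / estDir p z (τ k)).arg

/-- The states for which, up to errors `δ`, the estimates are correct and the agents
`τ 0, τ 1, …` are spread evenly, in counterclockwise order, on the desired orbit. -/
def tube [NeZero n] (p : Params m) (τ : Equiv.Perm (Fin n)) (δ : ℝ) : Set (State n m) :=
  {z | (∀ i j, |z.2 i j - rho p z i j| < δ) ∧ (∀ i, |‖z.1 i - center p‖ - orbitRadius p| < δ) ∧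
    ∀ k, |trueGap p τ k z - 2 * Real.pi / n| < δ}

/-- The square root of the total error of the distance estimates. It controls the errors
of the estimated centres. -/
def estError (p : Params m) (z : State n m) : ℝ := √(∑ i, ∑ j, |z.2 i j - rho p z i j|)

/-- The deviation from the invariant manifold on which all estimates are correct and all agents
are on the desired orbit. -/
def deviation (p : Params m) (z : State n m) : ℝ :=
  estError p z + ∑ i, |‖z.1 i - center p‖ - orbitRadius p|

variable {p : Params m} {τ : Equiv.Perm (Fin n)} {z : State n m}

theorem tube_mono [NeZero n] {δ δ' : ℝ} (h : δ ≤ δ') : tube p τ δ ⊆ tube p τ δ' := fun _ hz =>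
  ⟨fun i j => (hz.1 i j).trans_le h, fun i => (hz.2.1 i).trans_le h,
    fun k => (hz.2.2 k).trans_le h⟩

theorem estError_nonneg : 0 ≤ estError p z := Real.sqrt_nonneg _

theorem estError_le_deviation : estError p z ≤ deviation p z :=
  le_add_of_nonneg_right (Finset.sum_nonneg fun _ _ => abs_nonneg _)

theorem deviation_nonneg : 0 ≤ deviation p z := estError_nonneg.trans estError_le_deviation

theorem abs_radius_sub_le_deviation (i : Fin n) :
    |‖z.1 i - center p‖ - orbitRadius p| ≤ deviation p z :=
  (Finset.single_le_sum (f := fun i => |‖z.1 i - center p‖ - orbitRadius p|)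
    (fun _ _ => abs_nonneg _) (Finset.mem_univ i)).trans (le_add_of_nonneg_left estError_nonneg)

theorem abs_sub_rho_le (i : Fin n) (j : Fin m) :
    |z.2 i j - rho p z i j| ≤ estError p z ^ 2 := by
  rw [estError, Real.sq_sqrt (by positivity)]
  refine (Finset.single_le_sum (f := fun j => |z.2 i j - rho p z i j|)
    (fun _ _ => abs_nonneg _) (Finset.mem_univ j)).trans ?_
  exact Finset.single_le_sum (f := fun i => ∑ j, |z.2 i j - rho p z i j|)
    (fun _ _ => Finset.sum_nonneg fun _ _ => abs_nonneg _) (Finset.mem_univ i)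

theorem estError_le {e : ℝ} (h : ∀ i j, |z.2 i j - rho p z i j| ≤ e) :
    estError p z ≤ √(n * (m * e)) := by
  refine Real.sqrt_le_sqrt ?_
  refine (Finset.sum_le_sum fun i _ => Finset.sum_le_sum fun j _ => h i j).trans_eq ?_
  simp

variable (n p) in
theorem eventually_deviation_le [NeZero n] {ε : ℝ} (hε : 0 < ε) :
    ∀ᶠ δ in 𝓝[>] (0 : ℝ), ∀ (τ : Equiv.Perm (Fin n)), ∀ z ∈ tube p τ δ, deviation p z ≤ ε := by
  have hc : Continuous fun δ : ℝ => √(n * (m * δ)) + n * δ := by fun_prop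
  have h1 : ∀ᶠ δ in 𝓝 (0 : ℝ), √(n * (m * δ)) + n * δ < ε :=
    hc.continuousAt.eventually (gt_mem_nhds (by simpa using hε))
  filter_upwards [nhdsWithin_le_nhds h1] with δ hδ τ z hz
  refine le_trans (add_le_add (estError_le fun i j => (hz.1 i j).le) ?_) hδ.le
  refine (Finset.sum_le_sum fun i _ => (hz.2.1 i).le).trans_eq ?_
  simp

theorem dist_estTarget_le (i : Fin n) (j : Fin m) :
    dist (estTarget p z i j) (p.X j) ≤ |z.2 i j - rho p z i j| := by
  have e : estTarget p z i j - p.X j = ((z.2 i j - rho p z i j : ℝ) : ℂ) * bearing p z i j := by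
    have h := norm_mul_unitVec (z.1 i) (p.X j)
    simp only [estTarget, bearing, rho]
    push_cast
    linear_combination h
  rw [dist_eq_norm, e, norm_mul, Complex.norm_real, Real.norm_eq_abs]
  exact mul_le_of_le_one_right (abs_nonneg _) (norm_unitVec_le _ _)

theorem abs_estRadius_sub_le [NeZero m] (i : Fin n) :
    |estRadius p z i - minRadius p.X| ≤ estError p z ^ 2 :=
  abs_minRadius_sub_le fun j => (dist_estTarget_le i j).trans (abs_sub_rho_le i j)

theorem norm_estCenter_sub_sq_le [NeZero m] (i : Fin n) :
    ‖estCenter p z i - center p‖ ^ 2 ≤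
      8 * estError p z ^ 2 * (minRadius p.X + estError p z ^ 2) := by
  rw [← dist_eq_norm]
  exact sq_dist_minCenter_le fun j => (dist_estTarget_le i j).trans (abs_sub_rho_le i j)

theorem abs_estDist_sub_le (i : Fin n) :
    |estDist p z i - ‖z.1 i - center p‖| ≤ ‖estCenter p z i - center p‖ := by
  rw [estDist, norm_sub_rev (z.1 i)]
  refine (abs_norm_sub_norm_le _ _).trans_eq ?_
  rw [sub_sub_sub_cancel_right]

/-- The estimated circles depend on the estimation error in a Lipschitz way. -/
theorem exists_estimate_bound [NeZero m] (p : Params m) : ∃ K : ℝ, 1 ≤ K ∧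
    ∀ {n : ℕ} (z : State n m), estError p z ≤ 1 → ∀ i,
      ‖estCenter p z i - center p‖ ≤ K * estError p z ∧
      |estRadius p z i - minRadius p.X| ≤ K * estError p z ∧
      |estDist p z i - ‖z.1 i - center p‖| ≤ K * estError p z ∧
      |estDist p z i - orbitRadius p| ≤ K * deviation p z := by
  have hr := minRadius_nonneg p.X
  refine ⟨8 * (minRadius p.X + 1), by linarith, fun {n} z hz i => ?_⟩
  have h0 : 0 ≤ estError p z := estError_nonneg
  have h1 : ‖estCenter p z i - center p‖ ≤ 8 * (minRadius p.X + 1) * estError p z := by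
    refine abs_le_of_sq_le_sq' ?_ (by positivity) |>.2
    refine (norm_estCenter_sub_sq_le i).trans ?_
    have h2 : estError p z ^ 2 ≤ 1 := pow_le_one₀ h0 hz
    calc 8 * estError p z ^ 2 * (minRadius p.X + estError p z ^ 2)
        ≤ 8 * estError p z ^ 2 * (minRadius p.X + 1) := by gcongr
      _ ≤ (8 * (minRadius p.X + 1) * estError p z) ^ 2 := by
        nlinarith [mul_nonneg (sq_nonneg (estError p z)) hr, mul_nonneg (mul_nonneg (sq_nonneg (estError p z)) hr) hr, sq_nonneg (estError p z)]
  refine ⟨h1, ?_, (abs_estDist_sub_le i).trans h1, ?_⟩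
  · refine (abs_estRadius_sub_le i).trans ?_
    nlinarith
  · have h3 := (abs_estDist_sub_le i).trans h1
    have h4 := abs_add_le (estDist p z i - ‖z.1 i - center p‖)
      (‖z.1 i - center p‖ - orbitRadius p)
    rw [sub_add_sub_cancel] at h4
    have h5 : |‖z.1 i - center p‖ - orbitRadius p| ≤
        ∑ i, |‖z.1 i - center p‖ - orbitRadius p| :=
      Finset.single_le_sum (f := fun i => |‖z.1 i - center p‖ - orbitRadius p|)
        (fun _ _ => abs_nonneg _) (Finset.mem_univ i)
    have h6 : 0 ≤ |‖z.1 i - center p‖ - orbitRadius p| := abs_nonneg _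
    rw [deviation]
    nlinarith

end Tube

/-! ### Uniform estimates in the tube and comparison with the regular polygon -/

section Tube

open Filter Topology
open scoped Fin.CommRing

variable {n m : ℕ} {p : Params m} {τ : Equiv.Perm (Fin n)} {z : State n m}

theorem Params.IsRegular.orbitRadius_pos [NeZero m] (hp : p.IsRegular) : 0 < orbitRadius p := by
  have h1 := minRadius_nonneg p.X
  have h2 := hp.h_pos
  have h3 := hp.h_lt
  have h4 := hp.rs_lt
  rw [orbitRadius]
  linarith

/-- The quantitative information on a state of the tube that is used below. -/
structure Estimates (p : Params m) (K ε : ℝ) (z : State n m) : Prop where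
  small : K * deviation p z ≤ ε
  norm_center : ∀ i, ‖estCenter p z i - center p‖ ≤ K * estError p z
  abs_radius : ∀ i, |estRadius p z i - minRadius p.X| ≤ K * estError p z
  abs_dist : ∀ i, |estDist p z i - ‖z.1 i - center p‖| ≤ K * estError p z
  abs_dist_orbit : ∀ i, |estDist p z i - orbitRadius p| ≤ K * deviation p z
  le_norm : ∀ i, orbitRadius p / 2 ≤ ‖z.1 i - center p‖
  norm_le : ∀ i, ‖z.1 i - center p‖ ≤ 2 * orbitRadius p
  le_dist : ∀ i, orbitRadius p / 2 ≤ estDist p z i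
  dist_le : ∀ i, estDist p z i ≤ 2 * orbitRadius p
  rs_le : ∀ i, p.rs ≤ ‖z.1 i - center p‖ - minRadius p.X
  h_le : ∀ i j, p.h ≤ z.2 i j
  abs_sub_rho : ∀ i j, |z.2 i j - rho p z i j| ≤ ε
  step_arg : ∀ i, 0 ≤ estDist p z i - estRadius p z i - p.rs

theorem rs_le_rho [NeZero m] {i : Fin n} (h : p.rs ≤ ‖z.1 i - center p‖ - minRadius p.X)
    (j : Fin m) : p.rs ≤ rho p z i j := by
  have h1 := dist_le_enclosingRadius p.X (center p) j
  have h2 : enclosingRadius p.X (center p) = minRadius p.X := rfl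
  rw [dist_eq_norm] at h1
  have h3 := norm_sub_norm_le (z.1 i - center p) (p.X j - center p)
  rw [sub_sub_sub_cancel_right, norm_sub_rev (z.1 i) (p.X j)] at h3
  rw [rho]
  linarith

/-- `K` is fixed before `ε`, so that later proofs may choose `ε` in terms of `K`. -/
theorem exists_estimates [NeZero m] (hp : p.IsRegular) : ∃ K : ℝ, 1 ≤ K ∧ ∀ (n : ℕ) [NeZero n],
    ∀ ε > 0, ∀ᶠ δ in 𝓝[>] (0 : ℝ), ∀ (τ : Equiv.Perm (Fin n)), ∀ z ∈ tube p τ δ,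
      Estimates p K ε z := by
  obtain ⟨K, hK1, hK⟩ := exists_estimate_bound p
  refine ⟨K, hK1, fun n _ ε hε => ?_⟩
  have hr := hp.orbitRadius_pos
  have hr0 := minRadius_nonneg p.X
  have e1 := hp.h_pos
  have e2 := hp.h_lt
  have e3 := hp.rs_lt
  set r := orbitRadius p with hrdef
  have hrd : r = minRadius p.X + p.d := rfl
  -- The margins: `r / 4` keeps all radii between `r / 2` and `2 * r`; half of `d - r_s` absorbs the
  -- errors of both distance and radius in the argument of the step function; `r_s - h` keeps the
  -- estimates above the threshold `h`.
  obtain ⟨ε', hε', hle⟩ : ∃ ε' > 0, ε' ≤ ε ∧ ε' ≤ 1 ∧ ε' ≤ r / 4 ∧ 2 * ε' ≤ p.d - p.rs ∧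
      ε' ≤ p.rs - p.h := by
    refine ⟨min (min ε 1) (min (r / 4) (min ((p.d - p.rs) / 2) (p.rs - p.h))), ?_, ?_, ?_, ?_, ?_, ?_⟩
    · refine lt_min (lt_min hε one_pos) (lt_min (by linarith) (lt_min (by linarith) (by linarith)))
    · exact (min_le_left _ _).trans (min_le_left _ _)
    · exact (min_le_left _ _).trans (min_le_right _ _)
    · exact (min_le_right _ _).trans (min_le_left _ _)
    · have := (min_le_right (min ε 1) (min (r / 4) (min ((p.d - p.rs) / 2) (p.rs - p.h)))).trans
        ((min_le_right _ _).trans (min_le_left _ _))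
      linarith
    · exact (min_le_right _ _).trans ((min_le_right _ _).trans (min_le_right _ _))
  obtain ⟨l1, l2, l3, l4, l5⟩ := hle
  have hK0 : 0 < K := by linarith
  filter_upwards [eventually_deviation_le n p (div_pos hε' hK0),
    nhdsWithin_le_nhds (gt_mem_nhds hε')] with δ hδ hδ' τ z hz
  have hdev := hδ τ z hz
  rw [le_div_iff₀ hK0, mul_comm] at hdev
  have hd0 : 0 ≤ deviation p z := deviation_nonneg
  have hed := estError_le_deviation (p := p) (z := z)
  have hdK : deviation p z ≤ K * deviation p z := le_mul_of_one_le_left hd0 hK1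
  have heK : K * estError p z ≤ K * deviation p z := by gcongr
  have hb := hK z (by linarith)
  have hR : ∀ i, |‖z.1 i - center p‖ - r| ≤ ε' := fun i =>
    (abs_radius_sub_le_deviation i).trans (hdK.trans hdev)
  have hrs : ∀ i, p.rs ≤ ‖z.1 i - center p‖ - minRadius p.X := fun i => by
    have := abs_le.mp (hR i)
    linarith [this.1]
  refine ⟨hdev.trans l1, fun i => (hb i).1, fun i => (hb i).2.1, fun i => (hb i).2.2.1,
    fun i => (hb i).2.2.2, fun i => ?_, fun i => ?_, fun i => ?_, fun i => ?_, hrs, fun i j => ?_,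
    fun i j => (hz.1 i j).le.trans (hδ'.le.trans l1), fun i => ?_⟩
  · have := abs_le.mp (hR i)
    linarith [this.1]
  · have := abs_le.mp (hR i)
    linarith [this.2]
  · have := abs_le.mp (hb i).2.2.2
    linarith [this.1]
  · have := abs_le.mp (hb i).2.2.2
    linarith [this.2]
  · have h1 := rs_le_rho (hrs i) j
    have h2 := abs_lt.mp (hz.1 i j)
    change δ < ε' at hδ'
    linarith [h2.1]
  · have h1 := abs_le.mp (hb i).2.2.2
    have h2 := abs_le.mp (hb i).2.1
    linarith [h1.1, h2.2]

/-- The gap is defined by outward vectors and `unitVec` points inward; the two signs cancel in the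
quotient. -/
theorem exp_trueGap_of_ne [NeZero n] {k : Fin n} (h : z.1 (τ k) ≠ center p)
    (h' : z.1 (τ (k + 1)) ≠ center p) : Complex.exp (trueGap p τ k z * Complex.I) =
      unitVec (z.1 (τ (k + 1))) (center p) / unitVec (z.1 (τ k)) (center p) := by
  have h1 := sub_ne_zero.mpr h'
  have h2 := sub_ne_zero.mpr h
  set w := (z.1 (τ (k + 1)) - center p) / (z.1 (τ k) - center p) with hw
  have h3 : (‖w‖ : ℂ) ≠ 0 := by
    exact_mod_cast norm_ne_zero_iff.mpr (div_ne_zero h1 h2)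
  have h4 : Complex.exp (trueGap p τ k z * Complex.I) = w / ‖w‖ := by
    rw [eq_div_iff h3, mul_comm]
    exact Complex.norm_mul_exp_arg_mul_I w
  rw [h4, hw, unitVec, unitVec, norm_div, norm_sub_rev (center p), norm_sub_rev (center p)]
  have h5 : (‖z.1 (τ (k + 1)) - center p‖ : ℂ) ≠ 0 := by exact_mod_cast norm_ne_zero_iff.mpr h1
  have h6 : (‖z.1 (τ k) - center p‖ : ℂ) ≠ 0 := by exact_mod_cast norm_ne_zero_iff.mpr h2
  have h7 : center p - z.1 (τ k) ≠ 0 := sub_ne_zero.mpr h.symm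
  push_cast
  field_simp
  ring

namespace Estimates

variable {K ε : ℝ}

theorem ne_center [NeZero m] (hp : p.IsRegular) (h : Estimates p K ε z) (i : Fin n) :
    z.1 i ≠ center p := by
  have h1 := h.le_norm i
  have h2 := hp.orbitRadius_pos
  rw [← sub_ne_zero, ← norm_pos_iff]
  linarith

theorem ne_estCenter [NeZero m] (hp : p.IsRegular) (h : Estimates p K ε z) (i : Fin n) :
    z.1 i ≠ estCenter p z i := by
  have h1 := h.le_dist i
  have h2 := hp.orbitRadius_pos
  rw [ne_comm, ← sub_ne_zero, ← norm_pos_iff]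
  rw [estDist] at h1
  linarith

theorem norm_estDir [NeZero m] (hp : p.IsRegular) (h : Estimates p K ε z) (i : Fin n) :
    ‖estDir p z i‖ = 1 := norm_unitVec (h.ne_estCenter hp i)

theorem norm_unitVec_center [NeZero m] (hp : p.IsRegular) (h : Estimates p K ε z) (i : Fin n) :
    ‖unitVec (z.1 i) (center p)‖ = 1 := norm_unitVec (h.ne_center hp i)

theorem norm_estDir_sub_le [NeZero m] (hp : p.IsRegular) (h : Estimates p K ε z) (i : Fin n) :
    ‖estDir p z i - unitVec (z.1 i) (center p)‖ ≤ 4 / orbitRadius p * (K * estError p z) := by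
  have h0 := hp.orbitRadius_pos
  refine (norm_unitVec_sub_le (h.ne_estCenter hp i)).trans ?_
  have h1 := h.le_dist i
  have h2 := h.norm_center i
  rw [estDist] at h1
  rw [div_le_iff₀ (by linarith)]
  have h3 : 0 ≤ K * estError p z := (norm_nonneg _).trans h2
  calc 2 * ‖estCenter p z i - center p‖ ≤ 2 * (K * estError p z) := by gcongr
    _ = 4 / orbitRadius p * (K * estError p z) * (orbitRadius p / 2) := by field_simp; ring
    _ ≤ _ := by gcongr

theorem exp_trueGap [NeZero m] [NeZero n] (hp : p.IsRegular) (h : Estimates p K ε z) (k : Fin n) :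
    Complex.exp (trueGap p τ k z * Complex.I) =
      unitVec (z.1 (τ (k + 1))) (center p) / unitVec (z.1 (τ k)) (center p) :=
  exp_trueGap_of_ne (h.ne_center hp _) (h.ne_center hp _)

end Estimates

theorem norm_exp_sub_exp_le (a b : ℝ) :
    ‖Complex.exp (a * Complex.I) - Complex.exp (b * Complex.I)‖ ≤ |a - b| := by
  have e : Complex.exp (a * Complex.I) - Complex.exp (b * Complex.I) =
      Complex.exp (b * Complex.I) * (Complex.exp (Complex.I * ((a - b : ℝ) : ℂ)) - 1) := by
    rw [mul_sub, ← Complex.exp_add, mul_one]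
    congr 2
    push_cast; ring
  rw [e, norm_mul, Complex.norm_exp_ofReal_mul_I, one_mul]
  exact Real.norm_exp_I_mul_ofReal_sub_one_le

theorem norm_div_sub_div_le {a b a' b' : ℂ} (hb : ‖b‖ = 1) (ha' : ‖a'‖ = 1) (hb' : ‖b'‖ = 1) :
    ‖a / b - a' / b'‖ ≤ ‖a - a'‖ + ‖b - b'‖ := by
  have hb0 : b ≠ 0 := norm_ne_zero_iff.mp (by rw [hb]; exact one_ne_zero)
  have hb0' : b' ≠ 0 := norm_ne_zero_iff.mp (by rw [hb']; exact one_ne_zero)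
  have e : a / b - a' / b' = (a - a') / b + a' * (b' - b) / (b * b') := by
    field_simp
    ring
  rw [e]
  refine (norm_add_le _ _).trans_eq ?_
  simp [hb, ha', hb', norm_sub_rev b]

/-- The rotation by the angle `2 π / n`. -/
def rot (n : ℕ) : ℂ := Complex.exp ((2 * Real.pi / n : ℝ) * Complex.I)

theorem norm_rot (n : ℕ) : ‖rot n‖ = 1 := Complex.norm_exp_ofReal_mul_I _

/-- Passing to the next agent rotates the direction by an angle within `δ` of `2π/n`, and rotations
do not amplify the accumulated error. -/
theorem norm_unitVec_sub_rot_pow_le [NeZero m] [NeZero n] (hp : p.IsRegular) {K ε δ : ℝ}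
    (hz : z ∈ tube p τ δ) (h : Estimates p K ε z) (k : Fin n) (l : ℕ) :
    ‖unitVec (z.1 (τ (k + l))) (center p) - rot n ^ l * unitVec (z.1 (τ k)) (center p)‖
      ≤ l * δ := by
  induction l with
  | zero => simp
  | succ l ih =>
    have h1 := h.exp_trueGap (τ := τ) hp (k + l)
    have h2 := h.norm_unitVec_center hp (τ (k + l))
    set u := unitVec (z.1 (τ (k + l))) (center p) with hu
    set u₀ := unitVec (z.1 (τ k)) (center p) with hu₀
    have hu0 : u ≠ 0 := norm_ne_zero_iff.mp (by rw [h2]; exact one_ne_zero)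
    rw [eq_div_iff hu0] at h1
    rw [Nat.cast_succ, ← add_assoc, ← h1]
    have e : Complex.exp (trueGap p τ (k + l) z * Complex.I) * u - rot n ^ (l + 1) * u₀ =
        (Complex.exp (trueGap p τ (k + l) z * Complex.I) - rot n) * u +
          rot n * (u - rot n ^ l * u₀) := by ring
    rw [e]
    push_cast
    refine (norm_add_le _ _).trans ?_
    rw [norm_mul, norm_mul, h2, norm_rot, mul_one, one_mul, add_mul, one_mul, add_comm]
    refine add_le_add ih ?_
    exact (norm_exp_sub_exp_le _ _).trans (hz.2.2 _).le

/-- In the tube, the positions relative to an agent, in the frame given by its estimated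
direction, are close to those of a regular polygon. -/
theorem eventually_norm_relative_sub_le [NeZero m] (n : ℕ) [NeZero n] (hp : p.IsRegular) {ε : ℝ}
    (hε : 0 < ε) : ∀ᶠ δ in 𝓝[>] (0 : ℝ), ∀ (τ : Equiv.Perm (Fin n)), ∀ z ∈ tube p τ δ,
      ∀ (k : Fin n) (l : ℕ), l < n →
        ‖(z.1 (τ (k + l)) - z.1 (τ k)) / estDir p z (τ k) - orbitRadius p * (1 - rot n ^ l)‖ < ε := by
  obtain ⟨K, hK1, hK⟩ := exists_estimates hp
  set r := orbitRadius p with hr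
  have hr0 : 0 < r := hp.orbitRadius_pos
  have hc : ∀ᶠ δ in 𝓝 (0 : ℝ), 2 * δ + r * (n * δ) < ε / 2 := by
    have : Continuous fun δ : ℝ => 2 * δ + r * (n * δ) := by fun_prop
    exact this.continuousAt.eventually (gt_mem_nhds (by simpa using half_pos hε))
  filter_upwards [hK n (ε / 16) (by positivity), nhdsWithin_le_nhds hc, self_mem_nhdsWithin]
    with δ h1 h2 hδ0 τ z hz k l hl
  have hE := h1 τ z hz
  set u := unitVec (z.1 (τ k)) (center p) with hu
  set u' := unitVec (z.1 (τ (k + l))) (center p) with hu'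
  set φ := estDir p z (τ k) with hφ
  have hφ1 : ‖φ‖ = 1 := hE.norm_estDir hp _
  have hφ0 : φ ≠ 0 := norm_ne_zero_iff.mp (by rw [hφ1]; exact one_ne_zero)
  have a1 : ‖u' - rot n ^ l * u‖ ≤ l * δ := norm_unitVec_sub_rot_pow_le hp hz hE k l
  have a2 : ‖φ - u‖ ≤ 4 / r * (K * estError p z) := hE.norm_estDir_sub_le hp _
  have a3 : r * ‖φ - u‖ ≤ ε / 4 := by
    calc r * ‖φ - u‖ ≤ r * (4 / r * (K * estError p z)) := by gcongr
      _ = 4 * (K * estError p z) := by field_simp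
      _ ≤ 4 * (K * deviation p z) := by gcongr; exact estError_le_deviation
      _ ≤ _ := by linarith [hE.small]
  have b1 := norm_mul_unitVec (z.1 (τ k)) (center p)
  have b2 := norm_mul_unitVec (z.1 (τ (k + l))) (center p)
  rw [norm_sub_rev] at b1 b2
  have hu1 : ‖u‖ = 1 := hE.norm_unitVec_center hp _
  have hu1' : ‖u'‖ = 1 := hE.norm_unitVec_center hp _
  -- The error splits into two radial errors, the angular error over `l` steps, and two copies of
  -- the error of the direction `φ`.
  have e : (z.1 (τ (k + l)) - z.1 (τ k)) / φ - r * (1 - rot n ^ l) =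
      (((‖z.1 (τ k) - center p‖ - r : ℝ) : ℂ) * u -
        ((‖z.1 (τ (k + l)) - center p‖ - r : ℝ) : ℂ) * u' - r * (u' - rot n ^ l * u)
        - r * (φ - u) + r * rot n ^ l * (φ - u)) / φ := by
    rw [eq_div_iff hφ0, sub_mul, div_mul_cancel₀ _ hφ0]
    push_cast
    linear_combination b2 - b1
  rw [e, norm_div, hφ1, div_one]
  have c1 : ‖((‖z.1 (τ k) - center p‖ - r : ℝ) : ℂ) * u‖ ≤ δ := by
    rw [norm_mul, hu1, mul_one, Complex.norm_real]
    exact (hz.2.1 _).le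
  have c2 : ‖((‖z.1 (τ (k + l)) - center p‖ - r : ℝ) : ℂ) * u'‖ ≤ δ := by
    rw [norm_mul, hu1', mul_one, Complex.norm_real]
    exact (hz.2.1 _).le
  have c3 : ‖(r : ℂ) * (u' - rot n ^ l * u)‖ ≤ r * (n * δ) := by
    rw [norm_mul, Complex.norm_real, Real.norm_of_nonneg hr0.le]
    have : (l : ℝ) ≤ n := by exact_mod_cast hl.le
    have hδ0' : (0 : ℝ) < δ := hδ0
    refine mul_le_mul_of_nonneg_left (a1.trans ?_) hr0.le
    gcongr
  have c4 : ‖(r : ℂ) * (φ - u)‖ ≤ ε / 4 := by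
    rwa [norm_mul, Complex.norm_real, Real.norm_of_nonneg hr0.le]
  have c5 : ‖(r : ℂ) * rot n ^ l * (φ - u)‖ ≤ ε / 4 := by
    rwa [norm_mul, norm_mul, norm_pow, norm_rot, one_pow, mul_one, Complex.norm_real,
      Real.norm_of_nonneg hr0.le]
  calc _ ≤ δ + δ + r * (n * δ) + ε / 4 + ε / 4 := by
        refine norm_add_le_of_le (norm_sub_le_of_le (norm_sub_le_of_le
          (norm_sub_le_of_le c1 c2) c3) c4) c5
    _ < ε := by linarith

/-- The half-angle form of a chord: with `x = lπ/n`, one has `1 - exp(2ix) = 2 sin x · exp(i(x -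
π/2))`. For `0 < l < n` the modulus gives the chord lengths and the argument the angles at which an
agent sees the others. -/
theorem one_sub_rot_pow (n l : ℕ) : 1 - rot n ^ l =
    ((2 * Real.sin (l * Real.pi / n) : ℝ) : ℂ) *
      Complex.exp ((l * Real.pi / n - Real.pi / 2 : ℝ) * Complex.I) := by
  set x : ℝ := l * Real.pi / n with hx
  have h1 : rot n ^ l = Complex.exp ((2 * x : ℝ) * Complex.I) := by
    rw [rot, ← Complex.exp_nat_mul, hx]
    congr 1
    push_cast; ring
  rw [h1]
  apply Complex.ext
  · rw [Complex.re_ofReal_mul, Complex.sub_re, Complex.exp_ofReal_mul_I_re,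
      Complex.exp_ofReal_mul_I_re, Real.cos_sub_pi_div_two, Real.cos_two_mul, Complex.one_re]
    nlinarith [Real.sin_sq_add_cos_sq x]
  · rw [Complex.im_ofReal_mul, Complex.sub_im, Complex.exp_ofReal_mul_I_im,
      Complex.exp_ofReal_mul_I_im, Real.sin_sub_pi_div_two, Real.sin_two_mul, Complex.one_im]
    ring

theorem sin_mul_pi_div_pos {n l : ℕ} (hl : 0 < l) (hln : l < n) :
    0 < Real.sin (l * Real.pi / n) := by
  have hn : (0 : ℝ) < n := by exact_mod_cast hl.trans hln
  have hl' : (0 : ℝ) < l := by exact_mod_cast hl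
  have hln' : (l : ℝ) < n := by exact_mod_cast hln
  refine Real.sin_pos_of_pos_of_lt_pi (by positivity) ?_
  rw [div_lt_iff₀ hn]
  nlinarith [Real.pi_pos]

theorem arg_mul_one_sub_rot_pow {n l : ℕ} (hl : 0 < l) (hln : l < n) {r : ℝ} (hr : 0 < r) :
    (r * (1 - rot n ^ l)).arg = l * Real.pi / n - Real.pi / 2 := by
  have hn : (0 : ℝ) < n := by exact_mod_cast hl.trans hln
  have hl' : (0 : ℝ) < l := by exact_mod_cast hl
  have hln' : (l : ℝ) < n := by exact_mod_cast hln
  have h1 : 0 < l * Real.pi / n := by positivity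
  have h2 : l * Real.pi / n < Real.pi := by
    rw [div_lt_iff₀ hn]
    nlinarith [Real.pi_pos]
  rw [one_sub_rot_pow, ← mul_assoc, ← Complex.ofReal_mul, Complex.arg_real_mul _
    (mul_pos hr (mul_pos two_pos (sin_mul_pi_div_pos hl hln))), Complex.arg_exp_mul_I,
    toIocMod_eq_self]
  constructor <;> linarith

theorem norm_mul_one_sub_rot_pow {n l : ℕ} (hl : 0 < l) (hln : l < n) {r : ℝ} (hr : 0 < r) :
    ‖r * (1 - rot n ^ l)‖ = 2 * r * Real.sin (l * Real.pi / n) := by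
  have h := sin_mul_pi_div_pos hl hln
  rw [one_sub_rot_pow, norm_mul, norm_mul, Complex.norm_exp_ofReal_mul_I, Complex.norm_real,
    Complex.norm_real, Real.norm_of_nonneg hr.le, Real.norm_of_nonneg (by linarith)]
  ring

end Tube

/-! ### Which agents detect each other, and what they measure -/

section Links

open Filter Topology
open scoped Fin.CommRing

variable {n m : ℕ} {p : Params m} {τ : Equiv.Perm (Fin n)} {z : State n m}

theorem eventually_abs_dist_sub_lt [NeZero m] (n : ℕ) [NeZero n] (hp : p.IsRegular) {ε : ℝ}
    (hε : 0 < ε) : ∀ᶠ δ in 𝓝[>] (0 : ℝ), ∀ (τ : Equiv.Perm (Fin n)), ∀ z ∈ tube p τ δ,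
      ∀ (k : Fin n) (l : ℕ), 0 < l → l < n →
        |‖z.1 (τ (k + l)) - z.1 (τ k)‖ - 2 * orbitRadius p * Real.sin (l * Real.pi / n)| < ε := by
  obtain ⟨K, hK1, hK⟩ := exists_estimates hp
  filter_upwards [eventually_norm_relative_sub_le n hp hε, hK n 1 one_pos] with δ h hE τ z hz k l
    hl0 hl
  have h1 := h τ z hz k l hl
  have h2 := (hE τ z hz).norm_estDir hp (τ k)
  rw [← norm_mul_one_sub_rot_pow hl0 hl hp.orbitRadius_pos]
  refine lt_of_le_of_lt ?_ h1
  have h3 := abs_norm_sub_norm_le ((z.1 (τ (k + l)) - z.1 (τ k)) / estDir p z (τ k))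
    (orbitRadius p * (1 - rot n ^ l))
  rwa [norm_div, h2, div_one] at h3

/-- In the tube, the relative angles are close to those in a regular polygon. -/
theorem eventually_abs_relAngle_sub_lt [NeZero m] (n : ℕ) [NeZero n] (hp : p.IsRegular) :
    ∀ᶠ δ in 𝓝[>] (0 : ℝ), ∀ (τ : Equiv.Perm (Fin n)), ∀ z ∈ tube p τ δ,
      ∀ (k : Fin n) (l : ℕ), 0 < l → l < n →
        |relAngle p z (τ k) (τ (k + l)) - (Real.pi / 2 - l * Real.pi / n)| <
          Real.pi / (4 * n) := by
  obtain ⟨K, hK1, hK⟩ := exists_estimates hp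
  have hr := hp.orbitRadius_pos
  have hn : (0 : ℝ) < n := by exact_mod_cast NeZero.pos n
  have hπ := Real.pi_pos
  have hη : 0 < Real.pi / (4 * n) := by positivity
  have hcont : ∀ᶠ ε in 𝓝[>] (0 : ℝ), ∀ l ∈ Finset.Ioo 0 n, ∀ w : ℂ,
      ‖w - orbitRadius p * (1 - rot n ^ l)‖ < ε →
        w ≠ 0 ∧ |w.arg - (l * Real.pi / n - Real.pi / 2)| < Real.pi / (4 * n) := by
    rw [Finset.eventually_all]
    intro l hl
    rw [Finset.mem_Ioo] at hl
    set w₀ := orbitRadius p * (1 - rot n ^ l) with hw₀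
    have harg : w₀.arg = l * Real.pi / n - Real.pi / 2 := arg_mul_one_sub_rot_pow hl.1 hl.2 hr
    have h0 : w₀ ≠ 0 := by
      rw [← norm_pos_iff, norm_mul_one_sub_rot_pow hl.1 hl.2 hr]
      have := sin_mul_pi_div_pos hl.1 hl.2
      positivity
    have hl' : (l : ℝ) < n := by exact_mod_cast hl.2
    have hslit : w₀ ∈ Complex.slitPlane := by
      rw [Complex.mem_slitPlane_iff_arg]
      refine ⟨?_, h0⟩
      rw [harg]
      have : l * Real.pi / n < Real.pi := by
        rw [div_lt_iff₀ hn]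
        nlinarith
      intro h
      linarith
    have h1 : ∀ᶠ w in 𝓝 w₀, w ≠ 0 ∧ dist w.arg w₀.arg < Real.pi / (4 * n) :=
      (eventually_ne_nhds h0).and
        ((Complex.continuousAt_arg hslit).eventually (Metric.ball_mem_nhds _ hη))
    obtain ⟨ε, hε, h2⟩ := Metric.eventually_nhds_iff.mp h1
    filter_upwards [Ioo_mem_nhdsGT hε] with ε' hε' w hw
    have h3 := h2 (y := w) (by rw [dist_eq_norm]; exact hw.trans hε'.2)
    rwa [Real.dist_eq, harg] at h3
  obtain ⟨ε, hε, hε0⟩ := (hcont.and self_mem_nhdsWithin).exists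
  filter_upwards [eventually_norm_relative_sub_le n hp hε0, hK n 1 one_pos] with δ h hE τ z hz k l
    hl0 hl
  obtain ⟨hQ0, hQ⟩ := hε l (Finset.mem_Ioo.mpr ⟨hl0, hl⟩) _ (h τ z hz k l hl)
  set Q := (z.1 (τ (k + l)) - z.1 (τ k)) / estDir p z (τ k) with hQdef
  have hd : z.1 (τ (k + l)) - z.1 (τ k) ≠ 0 := fun h0 => hQ0 (by rw [hQdef, h0, zero_div])
  have hu : estDir p z (τ k) ≠ 0 := fun h0 => hQ0 (by rw [hQdef, h0, div_zero])
  have h4 := Complex.arg_div_coe_angle hd hu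
  rw [← hQdef] at h4
  -- Relative angles are measured clockwise from the estimated direction, hence the minus sign.
  have h5 : ((theta p z (τ k) - (z.1 (τ (k + l)) - z.1 (τ k)).arg : ℝ) : Real.Angle) =
      ((-Q.arg : ℝ) : Real.Angle) := by
    rw [Real.Angle.coe_neg, h4, Real.Angle.coe_sub, theta, neg_sub]
  obtain ⟨c, hc⟩ := Real.Angle.angle_eq_iff_two_pi_dvd_sub.mp h5
  have hl0' : (0 : ℝ) < l := by exact_mod_cast hl0
  have hl' : (l : ℝ) + 1 ≤ n := by exact_mod_cast hl
  have hb1 : l * Real.pi / n ≤ Real.pi - Real.pi / n := by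
    rw [div_le_iff₀ hn, sub_mul, div_mul_cancel₀ _ hn.ne']
    nlinarith
  have hb2 : 0 < l * Real.pi / n := by positivity
  have hb3 : Real.pi / (4 * n) = Real.pi / n / 4 := by field_simp
  have hb4 : Real.pi / n ≤ Real.pi := div_le_self hπ.le (by linarith [hl0'] : (1 : ℝ) ≤ n)
  have hb5 : 0 < Real.pi / n := by positivity
  obtain ⟨hQ1, hQ2⟩ := abs_lt.mp hQ
  -- The limiting values `π/2 - lπ/n` lie strictly between `-π/2` and `π/2`, so `-Q.arg` is already
  -- the representative in `[-π, π)`.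
  have h6 : relAngle p z (τ k) (τ (k + l)) = -Q.arg := by
    rw [relAngle, toIcoMod_eq_iff]
    refine ⟨⟨?_, ?_⟩, c, ?_⟩
    · linarith
    · linarith
    · rw [zsmul_eq_mul]
      linarith
  rw [h6, abs_lt]
  constructor <;> linarith

/-- What agent `τ (k + 1)` and agent `τ k` measure of the gap between them: the angle between
their estimated directions if they detect each other, and `π` otherwise. -/
def linkGap [NeZero n] (p : Params m) (τ : Equiv.Perm (Fin n)) (k : Fin n) (z : State n m) : ℝ :=
  open Classical in
  if ‖z.1 (τ (k + 1)) - z.1 (τ k)‖ ≤ p.M then estGap p τ k z else Real.pi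

theorem exists_eq_add_natCast [NeZero n] (τ : Equiv.Perm (Fin n)) {k i : Fin n} (h : i ≠ τ k) :
    ∃ l : ℕ, 0 < l ∧ l < n ∧ i = τ (k + l) := by
  refine ⟨(τ.symm i - k).val, ?_, (τ.symm i - k).isLt, ?_⟩
  · rw [Nat.pos_iff_ne_zero]
    intro h0
    have h1 : τ.symm i - k = 0 := Fin.ext h0
    rw [sub_eq_zero, Equiv.symm_apply_eq] at h1
    exact h h1
  · rw [Fin.cast_val_eq_self, add_sub_cancel, Equiv.apply_symm_apply]

/-- The inner product of unit vectors is the cosine of the argument of their quotient, and `arccos`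
recovers that argument when it is nonnegative. -/
theorem arccos_inner_eq_estGap [NeZero m] [NeZero n] (hp : p.IsRegular) {K ε : ℝ}
    (hE : Estimates p K ε z) {k : Fin n} (h : 0 ≤ estGap p τ k z) :
    Real.arccos (inner ℝ (estDir p z (τ (k + 1))) (estDir p z (τ k))) = estGap p τ k z := by
  have h1 := hE.norm_estDir hp (τ k)
  have h2 := hE.norm_estDir hp (τ (k + 1))
  set a := estDir p z (τ (k + 1))
  set b := estDir p z (τ k)
  have hb : b ≠ 0 := norm_ne_zero_iff.mp (by rw [h1]; exact one_ne_zero)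
  have e : inner ℝ a b = Real.cos (a / b).arg := by
    have h3 : a = (a / b) * b := (div_mul_cancel₀ _ hb).symm
    have h4 : a / b ≠ 0 := norm_ne_zero_iff.mp (by rw [norm_div, h1, h2]; norm_num)
    rw [Complex.cos_arg h4, norm_div, h1, h2, div_one, div_one]
    rw [real_inner_comm, Complex.inner, div_eq_mul_inv, Complex.inv_eq_conj h1, mul_comm]
  rw [e]
  exact Real.arccos_cos h (Complex.arg_le_pi _)

theorem fin_add_one_ne {n : ℕ} [NeZero n] (hn : 2 ≤ n) (k : Fin n) : k + 1 ≠ k := by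
  intro h
  rw [add_eq_left, Fin.ext_iff, Fin.coe_ofNat_eq_mod, Fin.coe_ofNat_eq_mod,
    Nat.mod_eq_of_lt (by omega), Nat.zero_mod] at h
  exact one_ne_zero h

theorem two_pi_div_lt_pi {n : ℕ} (hn : 3 ≤ n) : 2 * Real.pi / n < Real.pi := by
  have hn' : (3 : ℝ) ≤ n := by exact_mod_cast hn
  rw [div_lt_iff₀ (by linarith)]
  nlinarith [Real.pi_pos]

theorem arg_rot {n : ℕ} (hn : 3 ≤ n) : (rot n).arg = 2 * Real.pi / n := by
  have h0 : 0 < 2 * Real.pi / n := by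
    have : (0 : ℝ) < n := by exact_mod_cast (show 0 < n by omega)
    have := Real.pi_pos
    positivity
  rw [rot, Complex.arg_exp_mul_I, toIocMod_eq_self]
  have := two_pi_div_lt_pi hn
  constructor <;> linarith

theorem arg_exp_trueGap [NeZero n] (k : Fin n) :
    (Complex.exp (trueGap p τ k z * Complex.I)).arg = trueGap p τ k z := by
  rw [Complex.arg_exp_mul_I, toIocMod_eq_self]
  have h := Complex.arg_mem_Ioc ((z.1 (τ (k + 1)) - center p) / (z.1 (τ k) - center p))
  refine ⟨h.1, h.2.trans_eq ?_⟩
  ring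

/-- `arg` is the imaginary part of `log`, which is strictly differentiable off the branch cut and
therefore locally Lipschitz. -/
theorem exists_abs_arg_sub_le {w₀ : ℂ} (hw₀ : w₀ ∈ Complex.slitPlane) :
    ∃ C : ℝ, 0 ≤ C ∧ ∃ ε > 0, ∀ w w', ‖w - w₀‖ < ε → ‖w' - w₀‖ < ε →
      |w.arg - w'.arg| ≤ C * ‖w - w'‖ := by
  obtain ⟨C, s, hs, hC⟩ :=
    (Complex.hasStrictDerivAt_log hw₀).hasStrictFDerivAt.exists_lipschitzOnWith
  obtain ⟨ε, hε, hball⟩ := Metric.mem_nhds_iff.mp hs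
  refine ⟨C, C.2, ε, hε, fun w w' hw hw' => ?_⟩
  have h1 := hC.dist_le_mul w (hball (by rwa [Metric.mem_ball, dist_eq_norm])) w'
    (hball (by rwa [Metric.mem_ball, dist_eq_norm]))
  rw [dist_eq_norm, dist_eq_norm] at h1
  refine le_trans ?_ h1
  have h2 := Complex.abs_im_le_norm (Complex.log w - Complex.log w')
  rwa [Complex.sub_im, Complex.log_im, Complex.log_im] at h2

/-- Estimated and true directions differ by `O(estError)`, hence so do the quotients for adjacent
agents. Both quotients are close to `rot n`, where `arg` is Lipschitz; `3 ≤ n` keeps `rot n` away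
from the branch cut. -/
theorem exists_abs_estGap_sub_le [NeZero m] {n : ℕ} [NeZero n] (hn : 3 ≤ n) (hp : p.IsRegular) :
    ∃ C : ℝ, 0 ≤ C ∧ ∀ᶠ δ in 𝓝[>] (0 : ℝ), ∀ (τ : Equiv.Perm (Fin n)), ∀ z ∈ tube p τ δ, ∀ k,
      |estGap p τ k z - trueGap p τ k z| ≤ C * estError p z := by
  obtain ⟨K, hK1, hK⟩ := exists_estimates hp
  have hslit : rot n ∈ Complex.slitPlane := by
    rw [Complex.mem_slitPlane_iff_arg, arg_rot hn]
    exact ⟨(two_pi_div_lt_pi hn).ne, norm_ne_zero_iff.mp (by rw [norm_rot]; exact one_ne_zero)⟩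
  obtain ⟨C, hC, ε, hε, hL⟩ := exists_abs_arg_sub_le hslit
  have hr := hp.orbitRadius_pos
  set r := orbitRadius p
  refine ⟨C * (8 / r * K), by positivity, ?_⟩
  filter_upwards [hK n (r / 8 * (ε / 2)) (by positivity),
    nhdsWithin_le_nhds (gt_mem_nhds (half_pos hε))] with δ hδ hδε τ z hz k
  have hE := hδ τ z hz
  have h1 := hE.exp_trueGap (τ := τ) hp k
  have h2 : ‖estDir p z (τ (k + 1)) / estDir p z (τ k) -
      Complex.exp (trueGap p τ k z * Complex.I)‖ ≤ 8 / r * K * estError p z := by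
    rw [h1]
    refine (norm_div_sub_div_le (hE.norm_estDir hp _) (hE.norm_unitVec_center hp _)
      (hE.norm_unitVec_center hp _)).trans ?_
    refine (add_le_add (hE.norm_estDir_sub_le hp _) (hE.norm_estDir_sub_le hp _)).trans_eq ?_
    ring
  have h3 : ‖Complex.exp (trueGap p τ k z * Complex.I) - rot n‖ < ε / 2 :=
    ((norm_exp_sub_exp_le _ _).trans_lt (hz.2.2 k)).trans hδε
  have h4 : 8 / r * K * estError p z ≤ ε / 2 := by
    have h5 : K * estError p z ≤ r / 8 * (ε / 2) := le_trans
      (mul_le_mul_of_nonneg_left estError_le_deviation (by linarith)) hE.small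
    calc 8 / r * K * estError p z = 8 / r * (K * estError p z) := by ring
      _ ≤ 8 / r * (r / 8 * (ε / 2)) := by gcongr
      _ = ε / 2 := by field_simp
  have h6 := hL (estDir p z (τ (k + 1)) / estDir p z (τ k))
    (Complex.exp (trueGap p τ k z * Complex.I)) (by
      have := norm_add_le_of_le (h2.trans h4) h3.le
      rw [sub_add_sub_cancel] at this
      refine lt_of_le_of_lt (norm_sub_le_norm_sub_add_norm_sub _
        (Complex.exp (trueGap p τ k z * Complex.I)) _) ?_
      linarith [h2.trans h4]) (by linarith)
  rw [arg_exp_trueGap] at h6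
  refine h6.trans ?_
  rw [mul_assoc]
  exact mul_le_mul_of_nonneg_left h2 hC

theorem eventually_abs_estGap_sub_lt [NeZero m] {n : ℕ} [NeZero n] (hn : 3 ≤ n) (hp : p.IsRegular)
    {ε : ℝ} (hε : 0 < ε) : ∀ᶠ δ in 𝓝[>] (0 : ℝ), ∀ (τ : Equiv.Perm (Fin n)), ∀ z ∈ tube p τ δ,
      ∀ k, |estGap p τ k z - 2 * Real.pi / n| < ε := by
  obtain ⟨C, hC, hG⟩ := exists_abs_estGap_sub_le hn hp
  filter_upwards [hG, eventually_deviation_le n p (show 0 < ε / (2 * (C + 1)) by positivity),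
    nhdsWithin_le_nhds (gt_mem_nhds (half_pos hε))] with δ h1 h2 h3 τ z hz k
  have h4 := h1 τ z hz k
  have h5 := h2 τ z hz
  rw [le_div_iff₀ (by positivity)] at h5
  have h6 := hz.2.2 k
  have h7 := estError_le_deviation (p := p) (z := z)
  have h8 := abs_sub_le (estGap p τ k z) (trueGap p τ k z) (2 * Real.pi / n)
  have h9 : 0 ≤ deviation p z := deviation_nonneg
  have h10 : C * estError p z ≤ C * deviation p z := mul_le_mul_of_nonneg_left h7 hC
  change δ < ε / 2 at h3
  nlinarith

theorem eventually_estGap_mem [NeZero m] {n : ℕ} [NeZero n] (hn : 3 ≤ n) (hp : p.IsRegular) :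
    ∀ᶠ δ in 𝓝[>] (0 : ℝ), ∀ (τ : Equiv.Perm (Fin n)), ∀ z ∈ tube p τ δ,
      ∀ k, estGap p τ k z ∈ Set.Ioo (Real.pi / n) Real.pi := by
  have hn' : (3 : ℝ) ≤ n := by exact_mod_cast hn
  have hπ := Real.pi_pos
  filter_upwards [eventually_abs_estGap_sub_lt hn hp (show 0 < Real.pi / n by positivity)]
    with δ h τ z hz k
  have h1 := abs_lt.mp (h τ z hz k)
  have h2 : 3 * (Real.pi / n) ≤ Real.pi := by
    rw [mul_div_assoc', div_le_iff₀ (by linarith)]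
    nlinarith
  have h3 : 2 * Real.pi / n = 2 * (Real.pi / n) := mul_div_assoc _ _ _
  constructor <;> linarith [h1.1, h1.2]

theorem eventually_linkGap_mem [NeZero m] {n : ℕ} [NeZero n] (hn : 3 ≤ n) (hp : p.IsRegular) :
    ∀ᶠ δ in 𝓝[>] (0 : ℝ), ∀ (τ : Equiv.Perm (Fin n)), ∀ z ∈ tube p τ δ,
      ∀ k, linkGap p τ k z ∈ Set.Ioc (Real.pi / n) Real.pi := by
  have hn' : (3 : ℝ) ≤ n := by exact_mod_cast hn
  filter_upwards [eventually_estGap_mem hn hp] with δ h τ z hz k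
  rw [linkGap]
  split_ifs
  · exact Set.Ioo_subset_Ioc_self (h τ z hz k)
  · exact ⟨div_lt_self Real.pi_pos (by linarith), le_rfl⟩

/-- An agent that does not detect an adjacent agent detects no agent further away, either. -/
theorem eventually_dist_lt_dist [NeZero m] {n : ℕ} [NeZero n] (hn : 3 ≤ n) (hp : p.IsRegular) :
    ∀ᶠ δ in 𝓝[>] (0 : ℝ), ∀ (τ : Equiv.Perm (Fin n)), ∀ z ∈ tube p τ δ,
      ∀ (k : Fin n) (l : ℕ), 2 ≤ l → l + 2 ≤ n →
        ‖z.1 (τ (k + 1)) - z.1 (τ k)‖ < ‖z.1 (τ (k + l)) - z.1 (τ k)‖ ∧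
        ‖z.1 (τ (k + (n - 1 : ℕ))) - z.1 (τ k)‖ < ‖z.1 (τ (k + l)) - z.1 (τ k)‖ := by
  have hr := hp.orbitRadius_pos
  have hπ := Real.pi_pos
  have hn0 : (0 : ℝ) < n := by exact_mod_cast (show 0 < n by omega)
  -- On a regular polygon, adjacent vertices are strictly the closest ones. The sine is reflected at
  -- `π/2` when `lπ/n` is beyond it.
  have hsin : ∀ l : ℕ, 2 ≤ l → l + 2 ≤ n →
      Real.sin (Real.pi / n) < Real.sin (l * Real.pi / n) := by
    intro l h2 hl
    have h2' : (2 : ℝ) ≤ l := by exact_mod_cast h2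
    have hl' : (l : ℝ) + 2 ≤ n := by exact_mod_cast hl
    have h1 : 0 < Real.pi / n := by positivity
    have h3 : l * Real.pi / n = l * (Real.pi / n) := mul_div_assoc _ _ _
    have h4 : (l + 2) * (Real.pi / n) ≤ Real.pi := by
      rw [mul_div_assoc', div_le_iff₀ hn0]
      nlinarith
    rcases le_total (l * (Real.pi / n)) (Real.pi / 2) with h | h
    · rw [h3]
      exact Real.sin_lt_sin_of_lt_of_le_pi_div_two (by linarith) h (by nlinarith)
    · rw [h3, ← Real.sin_pi_sub (l * (Real.pi / n))]
      exact Real.sin_lt_sin_of_lt_of_le_pi_div_two (by linarith) (by linarith) (by linarith)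
  obtain ⟨ε, hε, hε'⟩ : ∃ ε > 0, ∀ l ∈ Finset.Icc 2 (n - 2),
      ε ≤ orbitRadius p * (Real.sin (l * Real.pi / n) - Real.sin (Real.pi / n)) := by
    have : ∀ᶠ ε in 𝓝[>] (0 : ℝ), ∀ l ∈ Finset.Icc 2 (n - 2),
        ε ≤ orbitRadius p * (Real.sin (l * Real.pi / n) - Real.sin (Real.pi / n)) := by
      rw [Finset.eventually_all]
      intro l hl
      rw [Finset.mem_Icc] at hl
      have h1 := hsin l hl.1 (by omega)
      filter_upwards [Ioo_mem_nhdsGT (mul_pos hr (sub_pos.mpr h1))] with ε hε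
      exact hε.2.le
    obtain ⟨ε, h1, h2⟩ := (this.and self_mem_nhdsWithin).exists
    exact ⟨ε, h2, h1⟩
  filter_upwards [eventually_abs_dist_sub_lt n hp hε] with δ h τ z hz k l h2 hl
  have h1 := abs_lt.mp (h τ z hz k l (by omega) (by omega))
  have h3 := abs_lt.mp (h τ z hz k 1 (by omega) (by omega))
  have h4 := abs_lt.mp (h τ z hz k (n - 1) (by omega) (by omega))
  have h5 := hε' l (Finset.mem_Icc.mpr ⟨h2, by omega⟩)
  have h6 : Real.sin ((n - 1 : ℕ) * Real.pi / n) = Real.sin (Real.pi / n) := by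
    rw [← Real.sin_pi_sub, Nat.cast_sub (by omega : 1 ≤ n), Nat.cast_one]
    congr 1
    field_simp
    ring
  rw [Nat.cast_one, Nat.cast_one, one_mul] at h3
  rw [h6] at h4
  constructor <;> linarith [h1.1, h3.2, h4.2]

/-- The relative angle of `τ (k + l)` is `π/2 - lπ/n` up to a quarter of the spacing `π/n`, so it
decreases in `l`. If `τ (k + 1)` is detected, it is therefore the maximizer, with a positive angle.
If it is not, nobody with `2 ≤ l ≤ n - 2` is detected either, being farther away, and `l = n - 1`
has a negative angle; then the default `π` applies on both sides. -/
theorem eventually_sigmaPlus_eq [NeZero m] {n : ℕ} [NeZero n] (hn : 3 ≤ n) (hp : p.IsRegular) :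
    ∀ᶠ δ in 𝓝[>] (0 : ℝ), ∀ (τ : Equiv.Perm (Fin n)), ∀ z ∈ tube p τ δ,
      ∀ k, sigmaPlus p z (τ k) = linkGap p τ k z := by
  obtain ⟨K, hK1, hK⟩ := exists_estimates hp
  have hn' : (3 : ℝ) ≤ n := by exact_mod_cast hn
  have hπ := Real.pi_pos
  have hq : 0 < Real.pi / n := by positivity
  have hq3 : 3 * (Real.pi / n) ≤ Real.pi := by
    rw [mul_div_assoc', div_le_iff₀ (by linarith)]
    nlinarith
  filter_upwards [eventually_estGap_mem hn hp, eventually_dist_lt_dist hn hp,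
    eventually_abs_relAngle_sub_lt n hp, hK n 1 one_pos] with δ hG hD hβ hE τ z hz k
  have hb3 : Real.pi / (4 * n) = Real.pi / n / 4 := by field_simp
  have hβ' : ∀ l : ℕ, 0 < l → l < n → |relAngle p z (τ k) (τ (k + l)) -
      (Real.pi / 2 - l * (Real.pi / n))| < Real.pi / n / 4 := fun l h0 hl => by
    have := hβ τ z hz k l h0 hl
    rwa [hb3, mul_div_assoc] at this
  have hβ1 := abs_lt.mp (hβ' 1 (by omega) (by omega))
  rw [Nat.cast_one, Nat.cast_one, one_mul] at hβ1
  have hne : τ (k + 1) ≠ τ k := fun h => by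
    exact fin_add_one_ne (by omega) k (τ.injective h)
  by_cases hM : ‖z.1 (τ (k + 1)) - z.1 (τ k)‖ ≤ p.M
  · have hmem : τ (k + 1) ∈ nbrs p z (τ k) := by
      simp only [nbrs, Finset.mem_filter, Finset.mem_univ, true_and]
      exact ⟨hne, hM⟩
    have hex : ∃ j ∈ nbrs p z (τ k), relAngle p z (τ k) j ∈ Set.Ioo 0 Real.pi :=
      ⟨_, hmem, by linarith, by linarith⟩
    have hnext : nextAgent p z (τ k) = τ (k + 1) := by
      rw [nextAgent, dif_pos ⟨_, hmem⟩]
      have hs := (Finset.exists_max_image (nbrs p z (τ k)) (relAngle p z (τ k)) ⟨_, hmem⟩).choose_spec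
      set j := (Finset.exists_max_image (nbrs p z (τ k)) (relAngle p z (τ k)) ⟨_, hmem⟩).choose
      have hj : j ≠ τ k := by
        have := hs.1
        simp only [nbrs, Finset.mem_filter, Finset.mem_univ, true_and] at this
        exact this.1
      obtain ⟨l, h0, hl, hjl⟩ := exists_eq_add_natCast τ hj
      rcases Nat.lt_or_ge 1 l with h1 | h1
      · exfalso
        have h2 := hs.2 _ hmem
        rw [hjl] at h2
        have h3 := abs_lt.mp (hβ' l h0 hl)
        have h4 : (2 : ℝ) ≤ l := by exact_mod_cast h1
        nlinarith [h3.2, hβ1.1]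
      · rw [hjl, show l = 1 by omega, Nat.cast_one]
    rw [sigmaPlus, if_pos hex, hnext, linkGap, if_pos hM]
    exact arccos_inner_eq_estGap hp (hE τ z hz) (hq.le.trans (hG τ z hz k).1.le)
  · have hex : ¬ ∃ j ∈ nbrs p z (τ k), relAngle p z (τ k) j ∈ Set.Ioo 0 Real.pi := by
      rintro ⟨j, hj, hj0, -⟩
      simp only [nbrs, Finset.mem_filter, Finset.mem_univ, true_and] at hj
      obtain ⟨l, h0, hl, rfl⟩ := exists_eq_add_natCast τ hj.1
      have h3 := abs_lt.mp (hβ' l h0 hl)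
      rcases Nat.lt_or_ge 1 l with h1 | h1
      -- Only `l = n - 1` remains to be excluded, by the sign of its relative angle.
      · have h4 : l + 2 ≤ n := by
          by_contra h5
          have h6 : (n : ℝ) - 1 ≤ l := by
            rw [sub_le_iff_le_add]
            exact_mod_cast (show n ≤ l + 1 by omega)
          have h7 : (n : ℝ) * (Real.pi / n) = Real.pi := by field_simp
          nlinarith [h3.2]
        exact hM ((hD τ z hz k l h1 h4).1.le.trans hj.2)
      · rw [show l = 1 by omega, Nat.cast_one] at hj
        exact hM hj.2
    rw [sigmaPlus, if_neg hex, linkGap, if_neg hM]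

/-- The mirror image of `eventually_sigmaPlus_eq`. It yields the same `linkGap p τ k`, now as seen
from the leading agent of the gap, because detection is mutual. -/
theorem eventually_sigmaMinus_eq [NeZero m] {n : ℕ} [NeZero n] (hn : 3 ≤ n) (hp : p.IsRegular) :
    ∀ᶠ δ in 𝓝[>] (0 : ℝ), ∀ (τ : Equiv.Perm (Fin n)), ∀ z ∈ tube p τ δ,
      ∀ k, sigmaMinus p z (τ (k + 1)) = linkGap p τ k z := by
  obtain ⟨K, hK1, hK⟩ := exists_estimates hp
  have hn' : (3 : ℝ) ≤ n := by exact_mod_cast hn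
  have hπ := Real.pi_pos
  have hq : 0 < Real.pi / n := by positivity
  have hq3 : 3 * (Real.pi / n) ≤ Real.pi := by
    rw [mul_div_assoc', div_le_iff₀ (by linarith)]
    nlinarith
  filter_upwards [eventually_estGap_mem hn hp, eventually_dist_lt_dist hn hp,
    eventually_abs_relAngle_sub_lt n hp, hK n 1 one_pos] with δ hG hD hβ hE τ z hz k₀
  set k := k₀ + 1 with hk
  -- The predecessor is reached by `n - 1` steps forward, so the estimates for forward steps apply
  -- to it.
  have hk₀ : k + (n - 1 : ℕ) = k₀ := by
    rw [hk, add_assoc, ← Nat.cast_one, ← Nat.cast_add, show 1 + (n - 1) = n by omega]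
    simp
  have hb3 : Real.pi / (4 * n) = Real.pi / n / 4 := by field_simp
  have hβ' : ∀ l : ℕ, 0 < l → l < n → |relAngle p z (τ k) (τ (k + l)) -
      (Real.pi / 2 - l * (Real.pi / n))| < Real.pi / n / 4 := fun l h0 hl => by
    have := hβ τ z hz k l h0 hl
    rwa [hb3, mul_div_assoc] at this
  have h7 : (n : ℝ) * (Real.pi / n) = Real.pi := by field_simp
  have hβ1 := abs_lt.mp (hβ' (n - 1) (by omega) (by omega))
  rw [hk₀, Nat.cast_sub (by omega : 1 ≤ n), Nat.cast_one, sub_mul, h7, one_mul] at hβ1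
  have hne : τ k₀ ≠ τ k := fun h => by
    exact fin_add_one_ne (by omega) k₀ (τ.injective h).symm
  have hsymm : ‖z.1 (τ k₀) - z.1 (τ k)‖ = ‖z.1 (τ k) - z.1 (τ k₀)‖ := norm_sub_rev _ _
  by_cases hM : ‖z.1 (τ k) - z.1 (τ k₀)‖ ≤ p.M
  · have hmem : τ k₀ ∈ nbrs p z (τ k) := by
      simp only [nbrs, Finset.mem_filter, Finset.mem_univ, true_and]
      exact ⟨hne, hsymm.trans_le hM⟩
    have hex : ∃ j ∈ nbrs p z (τ k), relAngle p z (τ k) j ∈ Set.Ioo (-Real.pi) 0 :=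
      ⟨_, hmem, by linarith, by linarith⟩
    have hprev : prevAgent p z (τ k) = τ k₀ := by
      rw [prevAgent, dif_pos ⟨_, hmem⟩]
      have hs := (Finset.exists_min_image (nbrs p z (τ k)) (relAngle p z (τ k)) ⟨_, hmem⟩).choose_spec
      set j := (Finset.exists_min_image (nbrs p z (τ k)) (relAngle p z (τ k)) ⟨_, hmem⟩).choose
      have hj : j ≠ τ k := by
        have := hs.1
        simp only [nbrs, Finset.mem_filter, Finset.mem_univ, true_and] at this
        exact this.1
      obtain ⟨l, h0, hl, hjl⟩ := exists_eq_add_natCast τ hj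
      rcases Nat.lt_or_ge l (n - 1) with h1 | h1
      · exfalso
        have h2 := hs.2 _ hmem
        rw [hjl] at h2
        have h3 := abs_lt.mp (hβ' l h0 hl)
        have h4 : (l : ℝ) + 2 ≤ n := by exact_mod_cast (show l + 2 ≤ n by omega)
        nlinarith [h3.1, hβ1.2]
      · rw [hjl, show l = n - 1 by omega, hk₀]
    rw [sigmaMinus, if_pos hex, hprev, linkGap, if_pos hM, real_inner_comm]
    exact arccos_inner_eq_estGap hp (hE τ z hz) (hq.le.trans (hG τ z hz k₀).1.le)
  · have hex : ¬ ∃ j ∈ nbrs p z (τ k), relAngle p z (τ k) j ∈ Set.Ioo (-Real.pi) 0 := by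
      rintro ⟨j, hj, -, hj0⟩
      simp only [nbrs, Finset.mem_filter, Finset.mem_univ, true_and] at hj
      obtain ⟨l, h0, hl, rfl⟩ := exists_eq_add_natCast τ hj.1
      have h3 := abs_lt.mp (hβ' l h0 hl)
      rcases Nat.lt_or_ge l (n - 1) with h1 | h1
      · have h4 : 2 ≤ l := by
          by_contra h5
          rw [show l = 1 by omega, Nat.cast_one, Nat.cast_one] at h3
          rw [show l = 1 by omega, Nat.cast_one] at hj0
          linarith [h3.1]
        have h5 := (hD τ z hz k l h4 (by omega)).2
        rw [hk₀, hsymm] at h5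
        exact hM (h5.le.trans hj.2)
      · rw [show l = n - 1 by omega, hk₀, hsymm] at hj
        exact hM hj.2
    rw [sigmaMinus, if_neg hex, linkGap, if_neg hM]

end Links

/-! ### Velocities of the agents and their distance estimates -/

section Speed

open Filter Topology
open scoped Fin.CommRing

variable {n m : ℕ} {p : Params m} {τ : Equiv.Perm (Fin n)} {z : State n m}

/-- The factor by which agent `i` scales its tangential speed. -/
def speed (p : Params m) (z : State n m) (i : Fin n) : ℝ :=
  p.f (ENNReal.ofReal (sigmaPlus p z i) / ENNReal.ofReal (sigmaMinus p z i))

theorem Params.IsRegular.strictMonoOn_ofReal (hp : p.IsRegular) :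
    StrictMonoOn (fun x => p.f (ENNReal.ofReal x)) (Set.Ioi 0) := fun _ hx _ hy hxy =>
  hp.strictMono (ENNReal.ofReal_pos.mpr hx) (ENNReal.ofReal_pos.mpr hy)
    ((ENNReal.ofReal_lt_ofReal_iff hy).mpr hxy)

theorem Params.IsRegular.f_pos (hp : p.IsRegular) {x : ℝ} (hx : 0 < x) :
    0 < p.f (ENNReal.ofReal x) := (hp.maps (ENNReal.ofReal_pos.mpr hx)).1

theorem Params.IsRegular.f_le_one (hp : p.IsRegular) {x : ℝ} (hx : 0 < x) :
    p.f (ENNReal.ofReal x) ≤ 1 := (hp.maps (ENNReal.ofReal_pos.mpr hx)).2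

/-- An agent compares the gap ahead with the gap behind. The two agents at a gap attach the same
value to it, which makes the summation by parts for `sqGaps` effective. -/
theorem eventually_speed_eq [NeZero m] {n : ℕ} [NeZero n] (hn : 3 ≤ n) (hp : p.IsRegular) :
    ∀ᶠ δ in 𝓝[>] (0 : ℝ), ∀ (τ : Equiv.Perm (Fin n)), ∀ z ∈ tube p τ δ, ∀ k,
      speed p z (τ (k + 1)) = p.f (ENNReal.ofReal (linkGap p τ (k + 1) z / linkGap p τ k z)) := by
  filter_upwards [eventually_sigmaPlus_eq hn hp, eventually_sigmaMinus_eq hn hp,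
    eventually_linkGap_mem hn hp] with δ h1 h2 h3 τ z hz k
  have h4 : 0 < linkGap p τ k z := lt_trans (by have := Real.pi_pos; positivity) (h3 τ z hz k).1
  rw [speed, h1 τ z hz, h2 τ z hz, ENNReal.ofReal_div_of_pos h4]

/-- Measured gaps lie in `(π/n, π]`, so their ratios are at least `1/n`, and `f (1/n)` is a lower
bound. -/
theorem exists_le_speed [NeZero m] {n : ℕ} [NeZero n] (hn : 3 ≤ n) (hp : p.IsRegular) :
    ∃ s₀ > 0, ∀ᶠ δ in 𝓝[>] (0 : ℝ), ∀ (τ : Equiv.Perm (Fin n)), ∀ z ∈ tube p τ δ, ∀ i,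
      s₀ ≤ speed p z i ∧ speed p z i ≤ 1 := by
  have hn0 : (0 : ℝ) < n := by exact_mod_cast NeZero.pos n
  have hπ := Real.pi_pos
  have hn1 : (0 : ℝ) < 1 / n := by positivity
  refine ⟨_, hp.f_pos hn1, ?_⟩
  filter_upwards [eventually_speed_eq hn hp, eventually_linkGap_mem hn hp] with δ h1 h2 τ z hz i
  obtain ⟨k, rfl⟩ : ∃ k, i = τ (k + 1) := ⟨τ.symm i - 1, by simp⟩
  have h3 := h2 τ z hz k
  have h4 := h2 τ z hz (k + 1)
  have h5 : 0 < linkGap p τ k z := lt_trans (by positivity) h3.1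
  have h6 : 0 < linkGap p τ (k + 1) z := lt_trans (by positivity) h4.1
  have h7 : 0 < linkGap p τ (k + 1) z / linkGap p τ k z := by positivity
  rw [h1 τ z hz]
  refine ⟨hp.strictMonoOn_ofReal.monotoneOn hn1 h7 ?_, hp.f_le_one h7⟩
  rw [le_div_iff₀ h5, one_div_mul_eq_div]
  exact (div_le_div_of_nonneg_right h3.2 hn0.le).trans h4.1.le

/-- The radial speed of agent `i`. -/
def radialSpeed (p : Params m) (z : State n m) (i : Fin n) : ℝ :=
  p.k * (estDist p z i - (estRadius p z i + p.d))

namespace Estimates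

variable {K ε : ℝ}

theorem velocity_eq (h : Estimates p K ε z) (i : Fin n) : velocity p z i =
    radialSpeed p z i • estDir p z i + (speed p z i * p.α) • cw (estDir p z i) := by
  rw [velocity, step, if_pos (h.step_arg i), mul_one, Complex.real_smul, Complex.real_smul,
    radialSpeed, speed]

theorem abs_radialSpeed_le (hp : p.IsRegular) (hK : 1 ≤ K) (h : Estimates p K ε z) (i : Fin n) :
    |radialSpeed p z i| ≤ 2 * p.k * (K * deviation p z) := by
  have h1 := h.abs_dist_orbit i
  have h2 := (h.abs_radius i).trans
    (mul_le_mul_of_nonneg_left (estError_le_deviation (p := p) (z := z)) (by linarith))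
  have e : estDist p z i - (estRadius p z i + p.d) =
      (estDist p z i - orbitRadius p) - (estRadius p z i - minRadius p.X) := by
    rw [orbitRadius]; ring
  rw [radialSpeed, abs_mul, abs_of_pos hp.k_pos, e]
  have h3 := (abs_sub (estDist p z i - orbitRadius p) (estRadius p z i - minRadius p.X)).trans
    (add_le_add h1 h2)
  nlinarith [hp.k_pos]

theorem norm_velocity_le [NeZero m] (hp : p.IsRegular) (hK : 1 ≤ K) (h : Estimates p K ε z)
    (i : Fin n) (hs : 0 ≤ speed p z i) (hs' : speed p z i ≤ 1) :
    ‖velocity p z i‖ ≤ 2 * p.k * ε + p.α := by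
  have h1 := h.abs_radialSpeed_le hp hK i
  have h2 : 2 * p.k * (K * deviation p z) ≤ 2 * p.k * ε :=
    mul_le_mul_of_nonneg_left h.small (by linarith [hp.k_pos])
  rw [h.velocity_eq]
  refine (norm_add_le _ _).trans ?_
  rw [norm_smul, norm_smul, norm_cw, h.norm_estDir hp, mul_one, mul_one, Real.norm_eq_abs,
    Real.norm_of_nonneg (mul_nonneg hs hp.α_pos.le)]
  nlinarith [hp.α_pos]

/-- With `R` the distance of the agent from the true centre, `ρ R` times the inner product equals
`⟨x_j - c, c - y_i⟩ + R²`. As the target lies in the minimum disc, this is at least `R (R - r_t) ≥ R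
r_s`, while `ρ ≤ 3r`. -/
theorem le_inner_bearing [NeZero m] (hp : p.IsRegular) (h : Estimates p K ε z)
    (i : Fin n) (j : Fin m) :
    p.rs / (3 * orbitRadius p) ≤ inner ℝ (bearing p z i j) (unitVec (z.1 i) (center p)) := by
  have hr := hp.orbitRadius_pos
  have hrs : 0 < p.rs := hp.h_pos.trans hp.h_lt
  have h0 := rs_le_rho (h.rs_le i) j
  have h1 := dist_le_enclosingRadius p.X (center p) j
  have h2 : enclosingRadius p.X (center p) = minRadius p.X := rfl
  rw [dist_eq_norm, h2] at h1
  have h3 := h.rs_le i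
  have h4 := h.norm_le i
  have h5 := h.le_norm i
  have hd : 0 < p.d := hrs.trans hp.rs_lt
  set R := ‖z.1 i - center p‖ with hR
  have e1 := norm_mul_unitVec (z.1 i) (p.X j)
  have e2 := norm_mul_unitVec (z.1 i) (center p)
  rw [norm_sub_rev, ← hR, ← Complex.real_smul] at e2
  have hρ : ‖p.X j - z.1 i‖ = rho p z i j := rfl
  rw [hρ, ← Complex.real_smul] at e1
  change rho p z i j • bearing p z i j = _ at e1
  have hρle : rho p z i j ≤ 3 * orbitRadius p := by
    have h6 := norm_sub_le_norm_sub_add_norm_sub (p.X j) (center p) (z.1 i)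
    rw [hρ, norm_sub_rev (center p), ← hR] at h6
    have h7 : orbitRadius p = minRadius p.X + p.d := rfl
    linarith
  have e3 : rho p z i j * (R * inner ℝ (bearing p z i j) (unitVec (z.1 i) (center p))) =
      inner ℝ (p.X j - center p) (center p - z.1 i) + R ^ 2 := by
    rw [← real_inner_smul_right, ← real_inner_smul_left, e1, e2, hR, norm_sub_rev,
      ← real_inner_self_eq_norm_sq, ← inner_add_left, sub_add_sub_cancel]
  have h8 := abs_le.mp (abs_real_inner_le_norm (p.X j - center p) (center p - z.1 i))
  rw [norm_sub_rev (center p), ← hR] at h8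
  have hRpos : 0 < R := by linarith
  have h9 : R * p.rs ≤ rho p z i j * (R * inner ℝ (bearing p z i j) (unitVec (z.1 i) (center p))) := by
    rw [e3]
    nlinarith [h8.1]
  have h10 : p.rs ≤ rho p z i j * inner ℝ (bearing p z i j) (unitVec (z.1 i) (center p)) := by
    rw [mul_left_comm] at h9
    exact le_of_mul_le_mul_left h9 hRpos
  have h11 : 0 ≤ inner ℝ (bearing p z i j) (unitVec (z.1 i) (center p)) :=
    (pos_of_mul_pos_right (hrs.trans_le h10) (hrs.le.trans h0)).le
  rw [div_le_iff₀ (by positivity)]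
  nlinarith

end Estimates

/-- In the tube, every agent crosses its line of sight to every target, always in the same
direction. -/
theorem exists_le_inner_velocity [NeZero m] {n : ℕ} [NeZero n] (hn : 3 ≤ n) (hp : p.IsRegular) :
    ∃ w₀ > 0, ∀ᶠ δ in 𝓝[>] (0 : ℝ), ∀ (τ : Equiv.Perm (Fin n)), ∀ z ∈ tube p τ δ, ∀ i j,
      w₀ ≤ inner ℝ (cw (bearing p z i j)) (velocity p z i) := by
  obtain ⟨K, hK1, hK⟩ := exists_estimates hp
  obtain ⟨s₀, hs₀, hs⟩ := exists_le_speed hn hp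
  have hr := hp.orbitRadius_pos
  have hrs : 0 < p.rs := hp.h_pos.trans hp.h_lt
  have hα := hp.α_pos
  have hk := hp.k_pos
  set r := orbitRadius p with hrdef
  set b := p.rs / (3 * r) with hb
  have hb0 : 0 < b := by positivity
  refine ⟨s₀ * p.α * (b / 4), by positivity, ?_⟩
  -- The first bound lets the estimated direction replace the true one at a cost of `b / 2`; the
  -- second makes the radial contribution at most half of the tangential one.
  filter_upwards [hs, hK n (min (r / 8 * b) (s₀ * p.α * (b / 4) / (2 * p.k))) (by positivity)]
    with δ h1 h2 τ z hz i j
  have hE := h2 τ z hz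
  obtain ⟨hs1, hs2⟩ := h1 τ z hz i
  have c1 : ‖bearing p z i j‖ ≤ 1 := norm_unitVec_le _ _
  have c2 := hE.le_inner_bearing hp i j
  have c3 := hE.norm_estDir_sub_le hp i
  have c4 : 4 / r * (K * estError p z) ≤ b / 2 := by
    have : K * estError p z ≤ r / 8 * b := le_trans
      (mul_le_mul_of_nonneg_left estError_le_deviation (by linarith))
      (hE.small.trans (min_le_left _ _))
    calc 4 / r * (K * estError p z) ≤ 4 / r * (r / 8 * b) := by gcongr
      _ = b / 2 := by field_simp; norm_num
  have c5 : |radialSpeed p z i| ≤ s₀ * p.α * (b / 4) := by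
    refine (hE.abs_radialSpeed_le hp hK1 i).trans ?_
    have : K * deviation p z ≤ s₀ * p.α * (b / 4) / (2 * p.k) := hE.small.trans (min_le_right _ _)
    calc 2 * p.k * (K * deviation p z) ≤ 2 * p.k * (s₀ * p.α * (b / 4) / (2 * p.k)) := by gcongr
      _ = _ := by field_simp
  have c6 : b / 2 ≤ inner ℝ (bearing p z i j) (estDir p z i) := by
    have d1 : |inner ℝ (bearing p z i j) (estDir p z i - unitVec (z.1 i) (center p))| ≤ b / 2 := by
      refine (abs_real_inner_le_norm _ _).trans ?_
      calc _ ≤ 1 * (b / 2) := mul_le_mul c1 (c3.trans c4) (norm_nonneg _) zero_le_one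
        _ = _ := one_mul _
    rw [inner_sub_right] at d1
    linarith [(abs_le.mp d1).1]
  have c7 : |inner ℝ (cw (bearing p z i j)) (estDir p z i)| ≤ 1 := by
    refine (abs_real_inner_le_norm _ _).trans ?_
    rw [norm_cw, hE.norm_estDir hp, mul_one]
    exact c1
  have c8 : |radialSpeed p z i * inner ℝ (cw (bearing p z i j)) (estDir p z i)| ≤
      s₀ * p.α * (b / 4) := by
    rw [abs_mul]
    calc _ ≤ (s₀ * p.α * (b / 4)) * 1 := mul_le_mul c5 c7 (abs_nonneg _) (by positivity)
      _ = _ := mul_one _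
  rw [hE.velocity_eq, inner_add_right, real_inner_smul_right, real_inner_smul_right, inner_cw_cw]
  have c9 : s₀ * p.α * (b / 2) ≤
      speed p z i * p.α * inner ℝ (bearing p z i j) (estDir p z i) := by
    gcongr
    exact mul_nonneg (hs₀.le.trans hs1) hα.le
  linarith [(abs_le.mp c8).1]

/-- The first term is the exact derivative of the distance. Hence `ρ̂ - ρ` satisfies a linear
equation whose decay rate is the transversal speed divided by the distance. -/
theorem compensator_eq {i : Fin n} {j : Fin m} (hρ : rho p z i j ≠ 0) (hh : p.h ≤ z.2 i j)
    (hw : 0 < inner ℝ (cw (bearing p z i j)) (velocity p z i)) :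
    compensator p z i j = -(inner ℝ (bearing p z i j) (velocity p z i)) -
      inner ℝ (cw (bearing p z i j)) (velocity p z i) / rho p z i j *
        (z.2 i j - rho p z i j) := by
  have h1 : inner ℝ (cw (bearing p z i j)) (cw (bearing p z i j)) = (1 : ℝ) := by
    rw [inner_cw_cw, real_inner_self_eq_norm_sq, bearing, norm_unitVec, one_pow]
    intro h
    exact hρ (by rw [rho, h, sub_self, norm_zero])
  rw [compensator, step, if_pos (sub_nonneg.mpr hh), Real.sign_of_pos hw, bearingDeriv,
    ← Complex.ofReal_neg, ← Complex.real_smul, real_inner_smul_right, h1]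
  field_simp
  ring

end Speed

/-! ### Derivatives of the Lyapunov functions -/

section Derivatives

open Filter Topology
open scoped Fin.CommRing

variable {n m : ℕ} {p : Params m} {τ : Equiv.Perm (Fin n)} {z : State n m}

theorem hasDerivAt_norm_add_smul {w v : ℂ} (hw : w ≠ 0) :
    HasDerivAt (fun t : ℝ => ‖w + t • v‖) (inner ℝ w v / ‖w‖) 0 := by
  have h1 : HasDerivAt (fun t : ℝ => w + t • v) v 0 := by
    simpa using ((hasDerivAt_id (0 : ℝ)).smul_const v).const_add w
  have h2 := h1.norm_sq
  have h3 := h2.sqrt (by simpa using hw)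
  simp only [Real.sqrt_sq (norm_nonneg _), zero_smul, add_zero] at h3
  convert h3 using 1
  field_simp

theorem hasDerivAt_arg_div {w w' v v' : ℂ} (hw : w ≠ 0) (hslit : w' / w ∈ Complex.slitPlane) :
    HasDerivAt (fun t : ℝ => ((w' + t • v') / (w + t • v)).arg) ((v' / w').im - (v / w).im) 0 := by
  have h1 : ∀ a b : ℂ, HasDerivAt (fun t : ℝ => a + t • b) b 0 := fun a b => by
    simpa using ((hasDerivAt_id (0 : ℝ)).smul_const b).const_add a
  have h2 := (h1 w' v').div (h1 w v) (by simpa using hw)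
  have h3 := h2.clog_real (by simpa using hslit)
  have h4 := Complex.imCLM.hasFDerivAt.comp_hasDerivAt (0 : ℝ) h3
  simp only [Function.comp_def, Complex.imCLM_apply, Complex.log_im, zero_smul, add_zero] at h4
  have hw' : w' ≠ 0 := by
    rintro rfl
    rw [zero_div] at hslit
    exact Complex.zero_notMem_slitPlane hslit
  refine h4.congr_deriv ?_
  rw [← Complex.sub_im]
  congr 1
  simp only [Pi.div_apply, zero_smul, add_zero]
  field_simp

/-- Once smoothness is known, derivatives of the Lyapunov functions may be computed along straight
lines, where only calculus in one variable is needed. -/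
theorem fderiv_apply_eq {E : Type*} [NormedAddCommGroup E] [NormedSpace ℝ E] {W : E → ℝ} {z v : E}
    (hW : ContDiffAt ℝ 1 W z) {c : ℝ} (h : HasDerivAt (fun t : ℝ => W (z + t • v)) c 0) :
    fderiv ℝ W z v = c :=
  ((hW.differentiableAt one_ne_zero).hasFDerivAt.hasLineDerivAt v).unique h

/-- The squared error of a distance estimate. -/
def sqError (p : Params m) (i : Fin n) (j : Fin m) (z : State n m) : ℝ :=
  (z.2 i j - rho p z i j) ^ 2

/-- The squared deviation of an agent from the desired orbit. -/
def sqRadial (p : Params m) (i : Fin n) (z : State n m) : ℝ :=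
  (‖z.1 i - center p‖ - orbitRadius p) ^ 2

/-- The squared deviation of the gaps from their equilibrium value. -/
def sqGaps [NeZero n] (p : Params m) (τ : Equiv.Perm (Fin n)) (z : State n m) : ℝ :=
  ∑ k, (trueGap p τ k z - 2 * Real.pi / n) ^ 2

theorem contDiffAt_rho {i : Fin n} {j : Fin m} (h : rho p z i j ≠ 0) :
    ContDiffAt ℝ 1 (fun z : State n m => rho p z i j) z := by
  have h1 : ContDiffAt ℝ 1 (fun z : State n m => p.X j - z.1 i) z := by fun_prop
  exact h1.norm ℝ (norm_ne_zero_iff.mp h)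

theorem contDiffAt_sqError {i : Fin n} {j : Fin m} (h : rho p z i j ≠ 0) :
    ContDiffAt ℝ 1 (sqError p i j) z := by
  have h1 : ContDiffAt ℝ 1 (fun z : State n m => z.2 i j) z := by fun_prop
  exact (h1.sub (contDiffAt_rho h)).pow 2

theorem contDiffAt_norm_sub_center {i : Fin n} (h : z.1 i ≠ center p) :
    ContDiffAt ℝ 1 (fun z : State n m => ‖z.1 i - center p‖) z := by
  have h1 : ContDiffAt ℝ 1 (fun z : State n m => z.1 i - center p) z := by fun_prop
  exact h1.norm ℝ (sub_ne_zero.mpr h)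

theorem contDiffAt_sqRadial {i : Fin n} (h : z.1 i ≠ center p) :
    ContDiffAt ℝ 1 (sqRadial p i) z :=
  ((contDiffAt_norm_sub_center h).sub contDiffAt_const).pow 2

theorem contDiffAt_trueGap [NeZero n] {k : Fin n} (h : z.1 (τ k) ≠ center p)
    (hslit : (z.1 (τ (k + 1)) - center p) / (z.1 (τ k) - center p) ∈ Complex.slitPlane) :
    ContDiffAt ℝ 1 (trueGap p τ k) z := by
  have h1 : ∀ i, ContDiffAt ℝ 1 (fun z : State n m => z.1 i - center p) z := fun i => by fun_prop
  have h2 : ContDiffAt ℝ 1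
      (fun z : State n m => (z.1 (τ (k + 1)) - center p) / (z.1 (τ k) - center p)) z := by
    simp only [div_eq_mul_inv]
    exact (h1 _).mul ((h1 _).inv (sub_ne_zero.mpr h))
  have h3 := ((Complex.contDiffAt_log hslit (n := 1)).restrict_scalars ℝ).comp z h2
  have h4 := Complex.imCLM.contDiff.contDiffAt.comp z h3
  change ContDiffAt ℝ 1 (fun z : State n m =>
    ((z.1 (τ (k + 1)) - center p) / (z.1 (τ k) - center p)).arg) z
  simpa only [Function.comp_def, Complex.imCLM_apply, Complex.log_im] using h4

theorem fderiv_sqError {i : Fin n} {j : Fin m} (h : rho p z i j ≠ 0) (v : State n m) :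
    fderiv ℝ (sqError p i j) z v =
      2 * (z.2 i j - rho p z i j) * (v.2 i j + inner ℝ (bearing p z i j) (v.1 i)) := by
  refine fderiv_apply_eq (contDiffAt_sqError h) ?_
  have h1 : HasDerivAt (fun t : ℝ => z.2 i j + t • v.2 i j) (v.2 i j) 0 := by
    simpa using ((hasDerivAt_id (0 : ℝ)).smul_const (v.2 i j)).const_add (z.2 i j)
  have h2 := hasDerivAt_norm_add_smul (v := -v.1 i) (norm_ne_zero_iff.mp h)
  have e : inner ℝ (p.X j - z.1 i) (-v.1 i) / ‖p.X j - z.1 i‖ =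
      -inner ℝ (bearing p z i j) (v.1 i) := by
    have hρ : ‖p.X j - z.1 i‖ ≠ 0 := h
    rw [inner_neg_right, ← norm_mul_unitVec (z.1 i) (p.X j), ← Complex.real_smul,
      real_inner_smul_left]
    have h3 : ‖‖p.X j - z.1 i‖ • unitVec (z.1 i) (p.X j)‖ = ‖p.X j - z.1 i‖ := by
      rw [Complex.real_smul, norm_mul_unitVec]
    rw [h3, bearing]
    field_simp
  rw [e] at h2
  have h3 := (h1.sub h2).pow 2
  have h4 : (fun t : ℝ => sqError p i j (z + t • v)) =
      ((fun t : ℝ => z.2 i j + t • v.2 i j) - fun t : ℝ => ‖p.X j - z.1 i + t • -v.1 i‖) ^ 2 := by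
    funext t
    have h5 : p.X j - (z + t • v).1 i = p.X j - z.1 i + t • -v.1 i := by
      rw [smul_neg, ← sub_eq_add_neg, sub_sub]
      rfl
    simp only [sqError, rho, h5]
    rfl
  rw [h4]
  refine h3.congr_deriv ?_
  rw [sub_neg_eq_add]
  simp only [Pi.sub_apply, zero_smul, add_zero, rho]
  norm_num

theorem fderiv_sqRadial {i : Fin n} (h : z.1 i ≠ center p) (v : State n m) :
    fderiv ℝ (sqRadial p i) z v = 2 * (‖z.1 i - center p‖ - orbitRadius p) *
      (inner ℝ (z.1 i - center p) (v.1 i) / ‖z.1 i - center p‖) := by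
  refine fderiv_apply_eq (contDiffAt_sqRadial h) ?_
  have h2 := hasDerivAt_norm_add_smul (v := v.1 i) (sub_ne_zero.mpr h)
  have h3 := (h2.sub_const (orbitRadius p)).pow 2
  have h4 : (fun t : ℝ => sqRadial p i (z + t • v)) =
      (fun t : ℝ => ‖z.1 i - center p + t • v.1 i‖ - orbitRadius p) ^ 2 := by
    funext t
    simp [sqRadial, add_sub_right_comm]
  rw [h4]
  refine h3.congr_deriv ?_
  simp

/-- The angular speed of agent `i` around the true centre, for the vector field `v`. -/
def angularSpeed (p : Params m) (z v : State n m) (i : Fin n) : ℝ :=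
  (v.1 i / (z.1 i - center p)).im

theorem fderiv_sqGaps [NeZero n] (h : ∀ i, z.1 i ≠ center p)
    (hslit : ∀ k, (z.1 (τ (k + 1)) - center p) / (z.1 (τ k) - center p) ∈ Complex.slitPlane)
    (v : State n m) :
    fderiv ℝ (sqGaps p τ) z v = ∑ k, 2 * (trueGap p τ k z - 2 * Real.pi / n) *
      (angularSpeed p z v (τ (k + 1)) - angularSpeed p z v (τ k)) := by
  have hc : ContDiffAt ℝ 1 (sqGaps p τ) z :=
    ContDiffAt.sum fun k _ => ((contDiffAt_trueGap (h _) (hslit k)).sub contDiffAt_const).pow 2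
  refine fderiv_apply_eq hc ?_
  have h1 : ∀ k ∈ Finset.univ, HasDerivAt
      (fun t : ℝ => (trueGap p τ k (z + t • v) - 2 * Real.pi / n) ^ 2)
      (2 * (trueGap p τ k z - 2 * Real.pi / n) *
      (angularSpeed p z v (τ (k + 1)) - angularSpeed p z v (τ k))) 0 := by
    intro k _
    have h2 := hasDerivAt_arg_div (v := v.1 (τ k)) (v' := v.1 (τ (k + 1)))
      (sub_ne_zero.mpr (h (τ k))) (hslit k)
    have h3 := (h2.sub_const (2 * Real.pi / n)).pow 2
    have h4 : (fun t : ℝ => (trueGap p τ k (z + t • v) - 2 * Real.pi / n) ^ 2) =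
        (fun t : ℝ => ((z.1 (τ (k + 1)) - center p + t • v.1 (τ (k + 1))) /
          (z.1 (τ k) - center p + t • v.1 (τ k))).arg - 2 * Real.pi / n) ^ 2 := by
      funext t
      simp [trueGap, add_sub_right_comm]
    rw [h4]
    refine h3.congr_deriv ?_
    simp [trueGap, angularSpeed]
  exact HasDerivAt.fun_sum h1

end Derivatives

/-! ### Decay of the estimation errors and of the radial errors -/

section LyapunovEstimates

open Filter Topology
open scoped Fin.CommRing

variable {n m : ℕ} {p : Params m} {τ : Equiv.Perm (Fin n)} {z : State n m}

theorem exists_fderiv_sqError_le [NeZero m] {n : ℕ} [NeZero n] (hn : 3 ≤ n) (hp : p.IsRegular) :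
    ∃ a > 0, ∀ᶠ δ in 𝓝[>] (0 : ℝ), ∀ (τ : Equiv.Perm (Fin n)), ∀ z ∈ tube p τ δ, ∀ i j,
      fderiv ℝ (sqError p i j) z (vectorField p z) ≤ -a * sqError p i j z := by
  obtain ⟨K, hK1, hK⟩ := exists_estimates hp
  obtain ⟨w₀, hw₀, hw⟩ := exists_le_inner_velocity hn hp
  have hr := hp.orbitRadius_pos
  have hrs : 0 < p.rs := hp.h_pos.trans hp.h_lt
  -- Twice the smallest transversal speed divided by the largest possible distance to a target.
  refine ⟨2 * (w₀ / (3 * orbitRadius p)), by positivity, ?_⟩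
  filter_upwards [hw, hK n 1 one_pos] with δ h1 h2 τ z hz i j
  have hE := h2 τ z hz
  have hw := h1 τ z hz i j
  have hρ0 := rs_le_rho (hE.rs_le i) j
  have hρ : 0 < rho p z i j := hrs.trans_le hρ0
  have hρle : rho p z i j ≤ 3 * orbitRadius p := by
    have h3 := norm_sub_le_norm_sub_add_norm_sub (p.X j) (center p) (z.1 i)
    have h4 := dist_le_enclosingRadius p.X (center p) j
    have h5 : enclosingRadius p.X (center p) = minRadius p.X := rfl
    have h6 := hE.norm_le i
    have h7 : orbitRadius p = minRadius p.X + p.d := rfl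
    have h8 := hp.rs_lt
    rw [dist_eq_norm] at h4
    rw [norm_sub_rev (center p)] at h3
    rw [rho]
    linarith
  rw [fderiv_sqError hρ.ne']
  change 2 * _ * (compensator p z i j + inner ℝ (bearing p z i j) (velocity p z i)) ≤ _
  rw [compensator_eq hρ.ne' (hE.h_le i j) (hw₀.trans_le hw), sqError]
  have h9 : w₀ / (3 * orbitRadius p) ≤
      inner ℝ (cw (bearing p z i j)) (velocity p z i) / rho p z i j :=
    div_le_div₀ (hw₀.le.trans hw) hw hρ hρle
  nlinarith [mul_le_mul_of_nonneg_right h9 (sq_nonneg (z.2 i j - rho p z i j))]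

theorem exists_norm_vectorField_le [NeZero m] {n : ℕ} [NeZero n] (hn : 3 ≤ n) (hp : p.IsRegular) :
    ∃ C : ℝ, 0 ≤ C ∧ ∀ᶠ δ in 𝓝[>] (0 : ℝ), ∀ (τ : Equiv.Perm (Fin n)), ∀ z ∈ tube p τ δ,
      ‖vectorField p z‖ ≤ C := by
  obtain ⟨K, hK1, hK⟩ := exists_estimates hp
  obtain ⟨w₀, hw₀, hw⟩ := exists_le_inner_velocity hn hp
  obtain ⟨s₀, hs₀, hs⟩ := exists_le_speed hn hp
  have hr := hp.orbitRadius_pos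
  have hrs : 0 < p.rs := hp.h_pos.trans hp.h_lt
  have hα := hp.α_pos
  have hk := hp.k_pos
  refine ⟨2 * (2 * p.k * p.rs + p.α), by positivity, ?_⟩
  filter_upwards [hw, hs, hK n p.rs hrs] with δ h1 h2 h3 τ z hz
  have hE := h3 τ z hz
  have hv : ∀ i, ‖velocity p z i‖ ≤ 2 * p.k * p.rs + p.α := fun i =>
    hE.norm_velocity_le hp hK1 i (hs₀.le.trans (h2 τ z hz i).1) (h2 τ z hz i).2
  refine norm_prod_le_iff.mpr ⟨?_, ?_⟩
  · refine (pi_norm_le_iff_of_nonneg (by positivity)).mpr fun i => (hv i).trans ?_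
    have : 0 ≤ 2 * p.k * p.rs + p.α := by positivity
    linarith
  · refine (pi_norm_le_iff_of_nonneg (by positivity)).mpr fun i =>
      (pi_norm_le_iff_of_nonneg (by positivity)).mpr fun j => ?_
    have hρ0 := rs_le_rho (hE.rs_le i) j
    have hρ : 0 < rho p z i j := hrs.trans_le hρ0
    change ‖compensator p z i j‖ ≤ _
    rw [compensator_eq hρ.ne' (hE.h_le i j) (hw₀.trans_le (h1 τ z hz i j))]
    have c1 : ‖bearing p z i j‖ ≤ 1 := norm_unitVec_le _ _
    have c2 : |inner ℝ (bearing p z i j) (velocity p z i)| ≤ ‖velocity p z i‖ :=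
      (abs_real_inner_le_norm _ _).trans (mul_le_of_le_one_left (norm_nonneg _) c1)
    have c3 : |inner ℝ (cw (bearing p z i j)) (velocity p z i)| ≤ ‖velocity p z i‖ :=
      (abs_real_inner_le_norm _ _).trans (mul_le_of_le_one_left (norm_nonneg _) (by rwa [norm_cw]))
    have c4 : |z.2 i j - rho p z i j| ≤ rho p z i j := (hE.abs_sub_rho i j).trans hρ0
    have c5 : ‖inner ℝ (cw (bearing p z i j)) (velocity p z i) / rho p z i j *
        (z.2 i j - rho p z i j)‖ ≤ ‖velocity p z i‖ := by
      rw [div_mul_eq_mul_div, norm_div, norm_mul, Real.norm_of_nonneg hρ.le, div_le_iff₀ hρ]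
      exact mul_le_mul c3 c4 (abs_nonneg _) (norm_nonneg _)
    have c6 : ‖-inner ℝ (bearing p z i j) (velocity p z i)‖ ≤ ‖velocity p z i‖ := by
      rw [norm_neg]; exact c2
    refine (norm_sub_le_of_le c6 c5).trans ?_
    linarith [hv i]

/-- The scalar core of the radial estimate: `x` is the radial error, `y` the error of the measured
distance and radius, `q` the effect of the misplaced centre, `η` the estimation error. Since `ρ / R
≥ 3/4`, the decay rate is at least `3k/2`; Young's inequality spends `k/2` of it on the cross terms.
-/
theorem radial_decay {k K r R ρ x y q η v₀ : ℝ} (hk : 0 < k) (hr : 0 < r)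
    (hR : r / 2 ≤ R) (hρ : 3 / 4 * R ≤ ρ) (hρ' : ρ ≤ 2 * r)
    (hy : |y| ≤ 2 * (K * η)) (hq : |q| ≤ K * η * v₀) :
    2 * x * ((-(ρ * (k * (x + y))) + q) / R) ≤
      -k * x ^ 2 + (16 * k * K + 4 / r * K * v₀) ^ 2 / (2 * k) * η ^ 2 := by
  have hRpos : 0 < R := by linarith
  obtain ⟨c, hc⟩ : ∃ c, c = ρ / R := ⟨_, rfl⟩
  have hc1 : 3 / 4 ≤ c := by rwa [hc, le_div_iff₀ hRpos]
  have hc2 : c ≤ 4 := by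
    rw [hc, div_le_iff₀ hRpos]
    linarith
  have hc0 : 0 ≤ c := by linarith
  have e3 : 2 * x * ((-(ρ * (k * (x + y))) + q) / R) =
      -(2 * k * c * x ^ 2) - 2 * k * c * (x * y) + 2 / R * (x * q) := by
    rw [hc]; field_simp; ring
  rw [e3]
  have h11 : 2 / R ≤ 4 / r := by
    rw [div_le_div_iff₀ hRpos hr]; linarith
  have h12 : -(2 * k * c * (x * y)) ≤ 16 * k * K * (|x| * η) := by
    have : |2 * k * c * (x * y)| ≤ 2 * k * 4 * (|x| * (2 * (K * η))) := by
      rw [abs_mul, abs_mul x, abs_of_nonneg (by positivity : 0 ≤ 2 * k * c)]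
      gcongr
    linarith [neg_abs_le (2 * k * c * (x * y))]
  have h13 : 2 / R * (x * q) ≤ 4 / r * K * v₀ * (|x| * η) := by
    have : |2 / R * (x * q)| ≤ 4 / r * (|x| * (K * η * v₀)) := by
      rw [abs_mul, abs_mul x, abs_of_nonneg (by positivity : 0 ≤ 2 / R)]
      gcongr
    linarith [le_abs_self (2 / R * (x * q))]
  obtain ⟨C₁, hC₁⟩ : ∃ C₁, C₁ = 16 * k * K + 4 / r * K * v₀ := ⟨_, rfl⟩
  have h14 : C₁ * (|x| * η) ≤ k / 2 * x ^ 2 + C₁ ^ 2 / (2 * k) * η ^ 2 := by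
    have h15 : 0 ≤ (k * |x| - C₁ * η) ^ 2 / (2 * k) := by positivity
    have h16 : (k * |x| - C₁ * η) ^ 2 / (2 * k) =
        k / 2 * |x| ^ 2 - C₁ * (|x| * η) + C₁ ^ 2 / (2 * k) * η ^ 2 := by
      field_simp; ring
    rw [sq_abs] at h16
    linarith
  have h17 : k * (3 / 4) * x ^ 2 ≤ k * c * x ^ 2 := by gcongr
  rw [← hC₁]
  have h18 : C₁ * (|x| * η) = 16 * k * K * (|x| * η) + 4 / r * K * v₀ * (|x| * η) := by
    rw [hC₁]; ring
  linarith

/-- The tangential part of the velocity is orthogonal to the estimated direction, so it affects the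
true radius only through the displacement of the estimated centre. -/
theorem exists_fderiv_sqRadial_le [NeZero m] {n : ℕ} [NeZero n] (hn : 3 ≤ n) (hp : p.IsRegular) :
    ∃ C > 0, ∀ᶠ δ in 𝓝[>] (0 : ℝ), ∀ (τ : Equiv.Perm (Fin n)), ∀ z ∈ tube p τ δ, ∀ i,
      fderiv ℝ (sqRadial p i) z (vectorField p z) ≤
        -p.k * sqRadial p i z + C * estError p z ^ 2 := by
  obtain ⟨K, hK1, hK⟩ := exists_estimates hp
  obtain ⟨s₀, hs₀, hs⟩ := exists_le_speed hn hp
  have hr := hp.orbitRadius_pos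
  have hα := hp.α_pos
  have hk := hp.k_pos
  set r := orbitRadius p with hrdef
  set v₀ := 2 * p.k * (r / 8) + p.α with hv₀
  have hv₀' : 0 < v₀ := by positivity
  refine ⟨(16 * p.k * K + 4 / r * K * v₀) ^ 2 / (2 * p.k), by positivity, ?_⟩
  filter_upwards [hs, hK n (r / 8) (by positivity)] with δ h2 h3 τ z hz i
  have hE := h3 τ z hz
  have hv : ‖velocity p z i‖ ≤ v₀ :=
    hE.norm_velocity_le hp hK1 i (hs₀.le.trans (h2 τ z hz i).1) (h2 τ z hz i).2
  rw [fderiv_sqRadial (hE.ne_center hp i)]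
  change 2 * _ * (inner ℝ (z.1 i - center p) (velocity p z i) / _) ≤ _
  rw [sqRadial]
  have hR1 := hE.le_norm i
  have hcenter := hE.norm_center i
  have hrad := hE.abs_radius i
  have hdist := hE.abs_dist i
  have hη : K * estError p z ≤ r / 8 :=
    le_trans (mul_le_mul_of_nonneg_left estError_le_deviation (by linarith)) hE.small
  have hη0 : 0 ≤ estError p z := estError_nonneg
  have e1 : inner ℝ (z.1 i - center p) (velocity p z i) =
      -(estDist p z i * radialSpeed p z i) +
        inner ℝ (estCenter p z i - center p) (velocity p z i) := by
    have h4 := norm_mul_unitVec (z.1 i) (estCenter p z i)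
    rw [← Complex.real_smul] at h4
    change estDist p z i • estDir p z i = _ at h4
    have h5 : z.1 i - center p = -(estDist p z i • estDir p z i) + (estCenter p z i - center p) := by
      rw [h4]; ring
    have h6 : inner ℝ (estDir p z i) (velocity p z i) = radialSpeed p z i := by
      rw [hE.velocity_eq, inner_add_right, real_inner_smul_right, real_inner_smul_right,
        inner_cw_self, real_inner_self_eq_norm_sq, hE.norm_estDir hp]
      ring
    rw [h5, inner_add_left, inner_neg_left, real_inner_smul_left, h6]
  have e2 : radialSpeed p z i = p.k * ((‖z.1 i - center p‖ - r) +
      ((estDist p z i - ‖z.1 i - center p‖) - (estRadius p z i - minRadius p.X))) := by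
    rw [radialSpeed, hrdef, orbitRadius]; ring
  have h7 : |inner ℝ (estCenter p z i - center p) (velocity p z i)| ≤ K * estError p z * v₀ :=
    (abs_real_inner_le_norm _ _).trans (mul_le_mul hcenter hv (norm_nonneg _) (by positivity))
  have h8 := abs_sub (estDist p z i - ‖z.1 i - center p‖) (estRadius p z i - minRadius p.X)
  rw [e1, e2]
  refine radial_decay hk hr hR1 ?_ (hE.dist_le i) ?_ h7
  · linarith [(abs_le.mp hdist).1]
  · linarith

/-! ### The angular dynamics -/

/-- For `w = -(r • u)` the imaginary part is exactly `b / r`: motion clockwise relative to the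
inward direction is counterclockwise around the centre. The rest bounds the effect of replacing `w`.
-/
theorem abs_im_div_sub_le {u q w : ℂ} {a b ρ r : ℝ} (hu : ‖u‖ = 1) (hr : 0 < r)
    (hw : r / 2 ≤ ‖w‖) (hwq : w = -(ρ • u) + q) :
    |((a • u + b • cw u) / w).im - b / r| ≤ 2 / r ^ 2 * ((|a| + |b|) * (|ρ - r| + ‖q‖)) := by
  have hu0 : u ≠ 0 := norm_ne_zero_iff.mp (by rw [hu]; exact one_ne_zero)
  have hr0 : (r : ℂ) ≠ 0 := by exact_mod_cast hr.ne'
  have hw0 : w ≠ 0 := norm_pos_iff.mp (by linarith)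
  set v := a • u + b • cw u with hv
  have e1 : b / r = (v / (-(r * u))).im := by
    have : v / (-(r * u)) = (((-a : ℝ) : ℂ) + (b : ℝ) * Complex.I) / (r : ℝ) := by
      rw [hv, cw, Complex.real_smul, Complex.real_smul]
      push_cast
      field_simp
      ring
    rw [this, Complex.div_ofReal_im]
    simp
  have e2 : v / w - v / (-(r * u)) = v * (((ρ - r : ℝ) : ℂ) * u - q) / (w * (-(r * u))) := by
    rw [div_sub_div _ _ hw0 (neg_ne_zero.mpr (mul_ne_zero hr0 hu0)), hwq, Complex.real_smul]
    congr 1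
    push_cast
    ring
  rw [e1, ← Complex.sub_im, e2]
  refine (Complex.abs_im_le_norm _).trans ?_
  rw [norm_div, norm_mul, norm_mul, norm_neg, norm_mul, hu, Complex.norm_real,
    Real.norm_of_nonneg hr.le, mul_one]
  have h1 : ‖v‖ ≤ |a| + |b| := by
    refine norm_add_le_of_le ?_ ?_
    · rw [norm_smul, hu, mul_one, Real.norm_eq_abs]
    · rw [norm_smul, norm_cw, hu, mul_one, Real.norm_eq_abs]
  have h2 : ‖((ρ - r : ℝ) : ℂ) * u - q‖ ≤ |ρ - r| + ‖q‖ := by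
    refine norm_sub_le_of_le ?_ le_rfl
    rw [norm_mul, hu, mul_one, Complex.norm_real, Real.norm_eq_abs]
  have hwpos : 0 < ‖w‖ * r := mul_pos (by linarith) hr
  rw [div_le_iff₀ hwpos]
  have h3 : ‖v‖ * ‖((ρ - r : ℝ) : ℂ) * u - q‖ ≤ (|a| + |b|) * (|ρ - r| + ‖q‖) :=
    mul_le_mul h1 h2 (norm_nonneg _) (by positivity)
  refine h3.trans ?_
  have h4 : 1 ≤ 2 / r ^ 2 * (‖w‖ * r) := by
    rw [div_mul_eq_mul_div, le_div_iff₀ (by positivity)]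
    nlinarith
  have h5 : 0 ≤ (|a| + |b|) * (|ρ - r| + ‖q‖) := by positivity
  nlinarith

theorem exists_abs_angularSpeed_sub_le [NeZero m] {n : ℕ} [NeZero n] (hn : 3 ≤ n)
    (hp : p.IsRegular) : ∃ C : ℝ, 0 ≤ C ∧ ∀ᶠ δ in 𝓝[>] (0 : ℝ), ∀ (τ : Equiv.Perm (Fin n)),
      ∀ z ∈ tube p τ δ, ∀ i,
        |angularSpeed p z (vectorField p z) i - speed p z i * p.α / orbitRadius p| ≤
          C * deviation p z := by
  obtain ⟨K, hK1, hK⟩ := exists_estimates hp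
  obtain ⟨s₀, hs₀, hs⟩ := exists_le_speed hn hp
  have hr := hp.orbitRadius_pos
  have hα := hp.α_pos
  have hk := hp.k_pos
  set r := orbitRadius p with hrdef
  refine ⟨2 / r ^ 2 * ((2 * p.k + p.α) * (2 * K)), by positivity, ?_⟩
  filter_upwards [hs, hK n 1 one_pos] with δ h2 h3 τ z hz i
  have hE := h3 τ z hz
  obtain ⟨hs1, hs2⟩ := h2 τ z hz i
  have hs0 := hs₀.le.trans hs1
  have hwq : z.1 i - center p = -(estDist p z i • estDir p z i) + (estCenter p z i - center p) := by
    have h4 := norm_mul_unitVec (z.1 i) (estCenter p z i)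
    rw [← Complex.real_smul] at h4
    change estDist p z i • estDir p z i = _ at h4
    rw [h4]; ring
  have h4 := abs_im_div_sub_le (a := radialSpeed p z i) (b := speed p z i * p.α)
    (hE.norm_estDir hp i) hr (hE.le_norm i) hwq
  rw [← hE.velocity_eq] at h4
  change |angularSpeed p z (vectorField p z) i - _| ≤ _ at h4
  refine h4.trans ?_
  have h5 : |radialSpeed p z i| ≤ 2 * p.k := by
    refine (hE.abs_radialSpeed_le hp hK1 i).trans ?_
    have := hE.small
    nlinarith
  have h6 : |speed p z i * p.α| ≤ p.α := by
    rw [abs_of_nonneg (mul_nonneg hs0 hα.le)]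
    nlinarith
  have h7 : ‖estCenter p z i - center p‖ ≤ K * deviation p z := (hE.norm_center i).trans
    (mul_le_mul_of_nonneg_left estError_le_deviation (by linarith))
  have h8 : |estDist p z i - r| ≤ K * deviation p z := hE.abs_dist_orbit i
  have h9 : 0 ≤ deviation p z := deviation_nonneg
  calc 2 / r ^ 2 * ((|radialSpeed p z i| + |speed p z i * p.α|) *
        (|estDist p z i - r| + ‖estCenter p z i - center p‖))
      ≤ 2 / r ^ 2 * ((2 * p.k + p.α) * (K * deviation p z + K * deviation p z)) := by gcongr
    _ = _ := by ring

end LyapunovEstimates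

/-! ### Dissipation of the gap function -/

section Gaps

open Filter Topology
open scoped Fin.CommRing

variable {n m : ℕ} {p : Params m} {τ : Equiv.Perm (Fin n)} {z : State n m}

theorem abs_trueGap_half_sub_lt {n : ℕ} [NeZero n] (hn : 3 ≤ n) {τ : Equiv.Perm (Fin n)}
    {z : State n m} {δ : ℝ} (hδ : δ ≤ Real.pi / 6) (hz : z ∈ tube p τ δ) (k : Fin n) :
    trueGap p τ k z / 2 ∈ Set.Ioo (-(Real.pi / 12)) (5 * Real.pi / 12) := by
  have hn' : (3 : ℝ) ≤ n := by exact_mod_cast hn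
  have hπ := Real.pi_pos
  have h1 := abs_lt.mp (hz.2.2 k)
  have h2 : 2 * Real.pi / n ≤ 2 * Real.pi / 3 := by gcongr
  have h3 : 0 < 2 * Real.pi / n := by positivity
  constructor <;> linarith [h1.1, h1.2]

theorem trueGap_nonneg_of_le {n : ℕ} [NeZero n] {τ : Equiv.Perm (Fin n)}
    {z : State n m} {δ : ℝ} (hδ : δ ≤ 2 * Real.pi / n) (hz : z ∈ tube p τ δ) (k : Fin n) :
    0 ≤ trueGap p τ k z := by
  have h1 := abs_lt.mp (hz.2.2 k)
  linarith [h1.1]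

/-- The distance between adjacent agents is close to the length of the chord of the orbit. -/
theorem Estimates.abs_dist_sub_chord_le [NeZero m] {n : ℕ} [NeZero n] (hp : p.IsRegular) {K ε : ℝ}
    {τ : Equiv.Perm (Fin n)} {z : State n m}
    (h : Estimates p K ε z) {k : Fin n} (h0 : 0 ≤ trueGap p τ k z) :
    |‖z.1 (τ (k + 1)) - z.1 (τ k)‖ - 2 * orbitRadius p * Real.sin (trueGap p τ k z / 2)| ≤
      2 * deviation p z := by
  have hr := hp.orbitRadius_pos
  have hexp := h.exp_trueGap (τ := τ) hp k
  have hu1 := h.norm_unitVec_center hp (τ k)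
  have hu1' := h.norm_unitVec_center hp (τ (k + 1))
  have b1 := norm_mul_unitVec (z.1 (τ k)) (center p)
  have b2 := norm_mul_unitVec (z.1 (τ (k + 1))) (center p)
  rw [norm_sub_rev] at b1 b2
  have c1 := abs_radius_sub_le_deviation (p := p) (z := z) (τ k)
  have c2 := abs_radius_sub_le_deviation (p := p) (z := z) (τ (k + 1))
  have hg : trueGap p τ k z ≤ Real.pi := Complex.arg_le_pi _
  set u := unitVec (z.1 (τ k)) (center p) with hu
  set u' := unitVec (z.1 (τ (k + 1))) (center p) with hu'
  set r := orbitRadius p with hrdef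
  have hu0 : u ≠ 0 := norm_ne_zero_iff.mp (by rw [hu1]; exact one_ne_zero)
  rw [eq_div_iff hu0] at hexp
  have hchord : ‖(r : ℂ) * (u' - u)‖ = 2 * r * Real.sin (trueGap p τ k z / 2) := by
    rw [← hexp, show Complex.exp (trueGap p τ k z * Complex.I) * u - u =
      (Complex.exp (Complex.I * trueGap p τ k z) - 1) * u by rw [mul_comm Complex.I]; ring,
      norm_mul, norm_mul, hu1, Complex.norm_exp_I_mul_ofReal_sub_one, Complex.norm_real,
      Real.norm_of_nonneg hr.le, Real.norm_of_nonneg]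
    · ring
    · have := Real.sin_nonneg_of_nonneg_of_le_pi (x := trueGap p τ k z / 2) (by linarith)
        (by linarith)
      linarith
  rw [← hchord, ← norm_neg ((r : ℂ) * (u' - u))]
  refine (abs_norm_sub_norm_le _ _).trans ?_
  -- Moving both agents radially onto the orbit changes their difference only by their radial
  -- errors.
  have e : z.1 (τ (k + 1)) - z.1 (τ k) - -((r : ℂ) * (u' - u)) =
      ((‖z.1 (τ k) - center p‖ - r : ℝ) : ℂ) * u -
        ((‖z.1 (τ (k + 1)) - center p‖ - r : ℝ) : ℂ) * u' := by
    push_cast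
    linear_combination b2 - b1
  rw [e, two_mul]
  refine norm_sub_le_of_le ?_ ?_
  · rwa [norm_mul, hu1, mul_one, Complex.norm_real]
  · rwa [norm_mul, hu1', mul_one, Complex.norm_real]

/-- The sine has a Lipschitz inverse on this interval: `sin x - sin y = 2 sin((x - y)/2) cos((x +
y)/2)`, with Jordan's inequality for the first factor and a positive lower bound for the cosine. It
turns comparisons of chords into comparisons of gaps. -/
theorem sub_le_of_sin_sub_le {x y c : ℝ} (hxy : y ≤ x)
    (hy : -(Real.pi / 12) ≤ y) (hx : x ≤ 5 * Real.pi / 12) (h : Real.sin x - Real.sin y ≤ c) :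
    x - y ≤ Real.pi / (2 * Real.cos (5 * Real.pi / 12)) * c := by
  have hπ := Real.pi_pos
  have hc0 : 0 < Real.cos (5 * Real.pi / 12) :=
    Real.cos_pos_of_mem_Ioo ⟨by linarith, by linarith⟩
  have h1 : Real.cos (5 * Real.pi / 12) ≤ Real.cos ((x + y) / 2) := by
    rw [← Real.cos_abs ((x + y) / 2)]
    refine Real.cos_le_cos_of_nonneg_of_le_pi (abs_nonneg _) (by linarith) ?_
    rw [abs_le]
    constructor <;> linarith
  have h2 := Real.mul_le_sin (x := (x - y) / 2) (by linarith) (by linarith)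
  rw [Real.sin_sub_sin] at h
  have h3 : 2 / Real.pi * ((x - y) / 2) * Real.cos (5 * Real.pi / 12) ≤
      Real.sin ((x - y) / 2) * Real.cos ((x + y) / 2) := by
    have : 0 ≤ 2 / Real.pi * ((x - y) / 2) :=
      mul_nonneg (by positivity) (by linarith)
    exact mul_le_mul h2 h1 hc0.le (this.trans h2)
  rw [div_mul_eq_mul_div, le_div_iff₀ (by positivity)]
  have h4 : 2 / Real.pi * ((x - y) / 2) * Real.cos (5 * Real.pi / 12) * Real.pi =
      (x - y) * Real.cos (5 * Real.pi / 12) := by field_simp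
  nlinarith

/-- Measured gaps are ordered like the true ones, up to the deviation. -/
theorem exists_trueGap_le_of_linkGap_lt [NeZero m] {n : ℕ} [NeZero n] (hn : 3 ≤ n)
    (hp : p.IsRegular) : ∃ C : ℝ, 0 ≤ C ∧ ∀ᶠ δ in 𝓝[>] (0 : ℝ), ∀ (τ : Equiv.Perm (Fin n)),
      ∀ z ∈ tube p τ δ, ∀ a b, linkGap p τ a z < linkGap p τ b z →
        trueGap p τ a z ≤ trueGap p τ b z + C * deviation p z := by
  obtain ⟨K, hK1, hK⟩ := exists_estimates hp
  obtain ⟨C, hC, hG⟩ := exists_abs_estGap_sub_le hn hp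
  have hr := hp.orbitRadius_pos
  have hπ := Real.pi_pos
  have hn0 : (0 : ℝ) < n := by exact_mod_cast NeZero.pos n
  set c₀ := Real.pi / (2 * Real.cos (5 * Real.pi / 12)) with hc₀
  have hc₀' : 0 ≤ c₀ := by
    have : 0 < Real.cos (5 * Real.pi / 12) := Real.cos_pos_of_mem_Ioo ⟨by linarith, by linarith⟩
    positivity
  refine ⟨2 * C + 2 * (c₀ * (2 / orbitRadius p)), by positivity, ?_⟩
  filter_upwards [hG, hK n 1 one_pos, eventually_estGap_mem hn hp,
    nhdsWithin_le_nhds (gt_mem_nhds (show 0 < Real.pi / 6 by positivity)),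
    nhdsWithin_le_nhds (gt_mem_nhds (show 0 < 2 * Real.pi / n by positivity))]
    with δ h1 h2 h3 hδ hδ' τ z hz a b hab
  have hE := h2 τ z hz
  have hdev : 0 ≤ deviation p z := deviation_nonneg
  have hηdev : C * estError p z ≤ C * deviation p z :=
    mul_le_mul_of_nonneg_left estError_le_deviation hC
  have hc₁ : 0 ≤ c₀ * (2 / orbitRadius p) * deviation p z := by positivity
  have hC₁ : 0 ≤ C * deviation p z := by positivity
  rw [linkGap, linkGap] at hab
  split_ifs at hab with ha hb hb
  · have h4 := abs_le.mp (h1 τ z hz a)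
    have h5 := abs_le.mp (h1 τ z hz b)
    linarith [h4.1, h5.2]
  -- Only gap `a` is detected, so its chord is at most `M` and that of `b` exceeds `M`: the true
  -- gaps are compared through the distances.
  · by_cases hba : trueGap p τ a z ≤ trueGap p τ b z
    · linarith
    · push Not at hba
      have h4 := abs_le.mp (hE.abs_dist_sub_chord_le hp (trueGap_nonneg_of_le hδ'.le hz a))
      have h5 := abs_le.mp (hE.abs_dist_sub_chord_le hp (trueGap_nonneg_of_le hδ'.le hz b))
      have h6 := abs_trueGap_half_sub_lt hn hδ.le hz a
      have h7 := abs_trueGap_half_sub_lt hn hδ.le hz b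
      have h8 : Real.sin (trueGap p τ a z / 2) - Real.sin (trueGap p τ b z / 2) ≤
          2 / orbitRadius p * deviation p z := by
        rw [div_mul_eq_mul_div, le_div_iff₀ hr]
        push Not at hb
        nlinarith [h4.1, h5.2]
      have h9 := sub_le_of_sin_sub_le (by linarith) h7.1.le h6.2.le h8
      rw [← hc₀] at h9
      linarith
  -- An undetected gap counts as `π`, the largest possible value.
  · exact absurd hab (not_lt.mpr (h3 τ z hz b).2.le)
  · exact absurd hab (lt_irrefl _)

/-- The contribution of agent `τ (k + 1)` to the decay of `sqGaps`. -/
def dissipation [NeZero n] (p : Params m) (τ : Equiv.Perm (Fin n)) (k : Fin n) (z : State n m) :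
    ℝ :=
  (trueGap p τ (k + 1) z - trueGap p τ k z) *
    (speed p z (τ (k + 1)) - p.f (ENNReal.ofReal 1))

/-- By monotonicity of `f`, the speed minus `f 1` has the sign of the difference of the measured
gaps, and true gaps are ordered like measured ones up to the deviation. For equal measured gaps the
second factor vanishes; this covers two undetected gaps, whose true order is unknown. -/
theorem exists_le_dissipation [NeZero m] {n : ℕ} [NeZero n] (hn : 3 ≤ n)
    (hp : p.IsRegular) : ∃ C : ℝ, 0 ≤ C ∧ ∀ᶠ δ in 𝓝[>] (0 : ℝ), ∀ (τ : Equiv.Perm (Fin n)),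
      ∀ z ∈ tube p τ δ, ∀ k, -(C * deviation p z) ≤ dissipation p τ k z := by
  obtain ⟨C, hC, hO⟩ := exists_trueGap_le_of_linkGap_lt hn hp
  have hπ := Real.pi_pos
  have hn0 : (0 : ℝ) < n := by exact_mod_cast NeZero.pos n
  refine ⟨C, hC, ?_⟩
  filter_upwards [hO, eventually_linkGap_mem hn hp, eventually_speed_eq hn hp]
    with δ h1 h2 h3 τ z hz k
  have hL : 0 < linkGap p τ k z := lt_trans (by positivity) (h2 τ z hz k).1
  have hL' : 0 < linkGap p τ (k + 1) z := lt_trans (by positivity) (h2 τ z hz (k + 1)).1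
  have hq : 0 < linkGap p τ (k + 1) z / linkGap p τ k z := by positivity
  have hdev : 0 ≤ deviation p z := deviation_nonneg
  have hCdev : 0 ≤ C * deviation p z := by positivity
  rw [dissipation, h3 τ z hz k]
  have f1 := hp.f_pos one_pos
  have f2 := hp.f_le_one one_pos
  have f3 := hp.f_pos hq
  have f4 := hp.f_le_one hq
  rcases lt_trichotomy (linkGap p τ k z) (linkGap p τ (k + 1) z) with h | h | h
  · have h4 := h1 τ z hz k (k + 1) h
    have h5 : p.f (ENNReal.ofReal 1) ≤
        p.f (ENNReal.ofReal (linkGap p τ (k + 1) z / linkGap p τ k z)) :=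
      hp.strictMonoOn_ofReal.monotoneOn (Set.mem_Ioi.mpr one_pos) hq ((one_le_div hL).mpr h.le)
    nlinarith
  · rw [← h, div_self hL.ne', sub_self, mul_zero]
    linarith
  · have h4 := h1 τ z hz (k + 1) k h
    have h5 : p.f (ENNReal.ofReal (linkGap p τ (k + 1) z / linkGap p τ k z)) ≤
        p.f (ENNReal.ofReal 1) :=
      hp.strictMonoOn_ofReal.monotoneOn hq (Set.mem_Ioi.mpr one_pos) ((div_le_one hL).mpr h.le)
    nlinarith

/-- Summation by parts around the cycle. The constant `c` is free because the differences of `x` sum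
to zero. -/
theorem sum_mul_shift_sub {n : ℕ} [NeZero n] (x s : Fin n → ℝ) (c : ℝ) :
    ∑ k, x k * (s (k + 1) - s k) = -∑ k, (x (k + 1) - x k) * (s (k + 1) - c) := by
  have h1 : ∑ k, x (k + 1) * s (k + 1) = ∑ k, x k * s k :=
    Equiv.sum_comp (Equiv.addRight (1 : Fin n)) fun k => x k * s k
  have h2 : ∑ k, x (k + 1) = ∑ k, x k := Equiv.sum_comp (Equiv.addRight (1 : Fin n)) x
  simp only [mul_sub, sub_mul, Finset.sum_sub_distrib, ← Finset.sum_mul] at *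
  rw [h1, h2]
  ring

theorem div_mem_slitPlane_of_tube {n : ℕ} [NeZero n] (hn : 3 ≤ n) {τ : Equiv.Perm (Fin n)}
    {z : State n m} {δ : ℝ} (hδ : δ ≤ Real.pi / 6)
    (hz : z ∈ tube p τ δ) (hc : ∀ i, z.1 i ≠ center p) (k : Fin n) :
    (z.1 (τ (k + 1)) - center p) / (z.1 (τ k) - center p) ∈ Complex.slitPlane := by
  rw [Complex.mem_slitPlane_iff_arg]
  have h1 := (abs_trueGap_half_sub_lt hn hδ hz k).2
  refine ⟨fun h => ?_, div_ne_zero (sub_ne_zero.mpr (hc _)) (sub_ne_zero.mpr (hc _))⟩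
  rw [trueGap, h] at h1
  linarith [Real.pi_pos]

/-- Angular speeds are proportional to the scaling factors up to the deviation, so the derivative is
minus the sum of the dissipations. One term `j` is kept; the others are bounded below by
`-O(deviation)`. -/
theorem exists_fderiv_sqGaps_le [NeZero m] {n : ℕ} [NeZero n] (hn : 3 ≤ n) (hp : p.IsRegular) :
    ∃ C : ℝ, 0 ≤ C ∧ ∀ᶠ δ in 𝓝[>] (0 : ℝ), ∀ (τ : Equiv.Perm (Fin n)), ∀ z ∈ tube p τ δ, ∀ j,
      fderiv ℝ (sqGaps p τ) z (vectorField p z) ≤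
        -(2 * p.α / orbitRadius p * dissipation p τ j z) + C * deviation p z := by
  obtain ⟨K, hK1, hK⟩ := exists_estimates hp
  obtain ⟨C₁, hC₁, h₁⟩ := exists_abs_angularSpeed_sub_le hn hp
  obtain ⟨C₂, hC₂, h₂⟩ := exists_le_dissipation hn hp
  have hr := hp.orbitRadius_pos
  have hα := hp.α_pos
  have hπ := Real.pi_pos
  refine ⟨n * (4 * C₁) + 2 * p.α / orbitRadius p * (n * C₂), by positivity, ?_⟩
  filter_upwards [h₁, h₂, hK n 1 one_pos, nhdsWithin_le_nhds (gt_mem_nhds one_pos),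
    nhdsWithin_le_nhds (gt_mem_nhds (show 0 < Real.pi / 6 by positivity))]
    with δ h1 h2 h3 hδ hδ' τ z hz j
  have hE := h3 τ z hz
  have hc := hE.ne_center hp
  rw [fderiv_sqGaps hc (div_mem_slitPlane_of_tube hn hδ'.le hz hc)]
  set v := vectorField p z
  set r := orbitRadius p
  set D := deviation p z with hD
  have hD0 : 0 ≤ D := deviation_nonneg
  set x : Fin n → ℝ := fun k => trueGap p τ k z - 2 * Real.pi / n with hx
  set ω : Fin n → ℝ := fun k => angularSpeed p z v (τ k) with hω
  set s : Fin n → ℝ := fun k => speed p z (τ k) with hs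
  have e1 : ∀ k, 2 * x k * (ω (k + 1) - ω k) ≤
      2 * p.α / r * (x k * (s (k + 1) - s k)) + 4 * C₁ * D := by
    intro k
    have a1 := abs_le.mp (h1 τ z hz (τ k))
    have a2 := abs_le.mp (h1 τ z hz (τ (k + 1)))
    have a3 : |x k| ≤ 1 := (hz.2.2 k).le.trans hδ.le
    have a4 : |(ω (k + 1) - ω k) - p.α / r * (s (k + 1) - s k)| ≤ 2 * (C₁ * D) := by
      have e : (ω (k + 1) - ω k) - p.α / r * (s (k + 1) - s k) =
          (ω (k + 1) - s (k + 1) * p.α / r) - (ω k - s k * p.α / r) := by ring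
      rw [e, abs_le]
      constructor <;> linarith [a1.1, a1.2, a2.1, a2.2]
    have a5 : x k * ((ω (k + 1) - ω k) - p.α / r * (s (k + 1) - s k)) ≤ 1 * (2 * (C₁ * D)) := by
      refine (le_abs_self _).trans ?_
      rw [abs_mul]
      exact mul_le_mul a3 a4 (abs_nonneg _) zero_le_one
    have e : 2 * x k * (ω (k + 1) - ω k) - 2 * p.α / r * (x k * (s (k + 1) - s k)) =
        2 * (x k * ((ω (k + 1) - ω k) - p.α / r * (s (k + 1) - s k))) := by ring
    linarith
  have e2 := Finset.sum_le_sum fun k (_ : k ∈ Finset.univ) => e1 k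
  rw [Finset.sum_add_distrib, ← Finset.mul_sum, sum_mul_shift_sub x s (p.f (ENNReal.ofReal 1)),
    Finset.sum_const, Finset.card_univ, Fintype.card_fin, nsmul_eq_mul] at e2
  have e3 : ∀ k, (x (k + 1) - x k) * (s (k + 1) - p.f (ENNReal.ofReal 1)) =
      dissipation p τ k z := fun k => by
    rw [dissipation, hx, hs]; ring
  simp only [e3] at e2
  refine e2.trans ?_
  have e4 : dissipation p τ j z - n * (C₂ * D) ≤ ∑ k, dissipation p τ k z := by
    rw [← Finset.add_sum_erase _ _ (Finset.mem_univ j)]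
    have e5 : -(n * (C₂ * D)) ≤ ∑ k ∈ Finset.univ.erase j, dissipation p τ k z := by
      have e6 := Finset.card_nsmul_le_sum (Finset.univ.erase j) (fun k => dissipation p τ k z)
        (-(C₂ * D)) fun k _ => h2 τ z hz k
      refine le_trans ?_ e6
      rw [Finset.card_erase_of_mem (Finset.mem_univ j), Finset.card_univ, Fintype.card_fin,
        nsmul_eq_mul, mul_neg, neg_le_neg_iff]
      have : ((n - 1 : ℕ) : ℝ) ≤ n := by exact_mod_cast Nat.sub_le n 1
      gcongr
    linarith
  have e7 : 0 ≤ 2 * p.α / r := by positivity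
  have e8 := mul_le_mul_of_nonneg_left e4 e7
  linarith

/-- Starting from the small value and going once around the cycle, `x` would stay below its mean `g`
if it never rose by `μ / n` from a value at most `g - μ / n`. -/
theorem exists_jump_of_sum_eq {n : ℕ} [NeZero n] {x : Fin n → ℝ} {g μ : ℝ} (hμ : 0 < μ)
    (hsum : ∑ k, x k = n * g) {a : Fin n} (ha : x a ≤ g - μ) :
    ∃ j, x j ≤ g - μ / n ∧ μ / n ≤ x (j + 1) - x j := by
  have hn0 : (0 : ℝ) < n := by exact_mod_cast NeZero.pos n
  by_contra! hcon
  have hlt : ∀ l : ℕ, (l : ℝ) + 1 ≤ n → g - μ + l * (μ / n) ≤ g - μ / n := fun l hl => by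
    have h1 : (l + 1) * (μ / n) ≤ n * (μ / n) := by gcongr
    have h2 : n * (μ / n) = μ := by field_simp
    linarith
  have key : ∀ l : ℕ, l < n → x (a + l) ≤ g - μ + l * (μ / n) := by
    intro l
    induction l with
    | zero => intro _; simpa using ha
    | succ l ih =>
      intro hl
      have h1 := ih (by omega)
      have h2 : (l : ℝ) + 1 ≤ n := by exact_mod_cast hl.le
      have h3 := hcon (a + l) (h1.trans (hlt l h2))
      rw [Nat.cast_succ, ← add_assoc]
      push_cast
      linarith
  have hall : ∀ k, x k < g := by
    intro k
    have h1 := key (k - a).val (k - a).isLt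
    rw [Fin.cast_val_eq_self, add_sub_cancel] at h1
    have h2 : (((k - a).val : ℕ) : ℝ) + 1 ≤ n := by exact_mod_cast (k - a).isLt
    have h3 := hlt _ h2
    have h4 : 0 < μ / n := by positivity
    linarith
  have h5 : ∑ k, x k < ∑ _k : Fin n, g :=
    Finset.sum_lt_sum_of_nonempty ⟨a, Finset.mem_univ a⟩ fun k _ => hall k
  rw [Finset.sum_const, Finset.card_univ, Fintype.card_fin, nsmul_eq_mul, hsum] at h5
  exact lt_irrefl _ h5

/-- The quotients telescope to 1 around the cycle, so the sum is a multiple of `2π`, and closeness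
to the equal angles singles out `2π` itself. -/
theorem sum_eq_two_pi {n : ℕ} [NeZero n] {x : Fin n → ℝ} {u : Fin n → ℂ} (hu : ∀ k, u k ≠ 0)
    (hx : ∀ k, Complex.exp (x k * Complex.I) = u (k + 1) / u k)
    (hclose : ∀ k, |x k - 2 * Real.pi / n| < 2 * Real.pi / n) : ∑ k, x k = 2 * Real.pi := by
  have hn0 : (0 : ℝ) < n := by exact_mod_cast NeZero.pos n
  have hπ := Real.pi_pos
  have h1 : Complex.exp ((∑ k, x k : ℝ) * Complex.I) = 1 := by
    push_cast
    rw [Finset.sum_mul, Complex.exp_sum]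
    simp only [hx]
    have h2 : ∏ k, u (k + 1) = ∏ k, u k := Equiv.prod_comp (Equiv.addRight (1 : Fin n)) u
    rw [Finset.prod_div_distrib, h2]
    exact div_self (Finset.prod_ne_zero_iff.mpr fun k _ => hu k)
  obtain ⟨N, hN⟩ := Complex.exp_eq_one_iff.mp h1
  have h2 : ∑ k, x k = N * (2 * Real.pi) := by
    have h3 : ((∑ k, x k : ℝ) : ℂ) = ((N * (2 * Real.pi) : ℝ) : ℂ) := by
      have h4 : ((∑ k, x k : ℝ) : ℂ) * Complex.I = ((N * (2 * Real.pi) : ℝ) : ℂ) * Complex.I := by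
        rw [hN]; push_cast; ring
      exact mul_right_cancel₀ Complex.I_ne_zero h4
    exact_mod_cast h3
  have h5 : |∑ k, x k - 2 * Real.pi| < 2 * Real.pi := by
    have e : ∑ k, x k - 2 * Real.pi = ∑ k, (x k - 2 * Real.pi / n) := by
      rw [Finset.sum_sub_distrib, Finset.sum_const, Finset.card_univ, Fintype.card_fin,
        nsmul_eq_mul]
      field_simp
    rw [e]
    refine (Finset.abs_sum_le_sum_abs _ _).trans_lt ?_
    have h6 : ∑ k, |x k - 2 * Real.pi / n| < ∑ _k : Fin n, 2 * Real.pi / n :=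
      Finset.sum_lt_sum_of_nonempty Finset.univ_nonempty fun k _ => hclose k
    refine h6.trans_eq ?_
    rw [Finset.sum_const, Finset.card_univ, Fintype.card_fin, nsmul_eq_mul]
    field_simp
  rw [h2, abs_lt] at h5
  have h6 : (0 : ℝ) < N := by
    by_contra hN0
    push Not at hN0
    nlinarith [h5.1]
  have h7 : (N : ℝ) < 2 := by nlinarith [h5.2]
  have h8 : 0 < N := by exact_mod_cast h6
  have h9 : N < 2 := by exact_mod_cast h7
  rw [h2, show N = 1 by omega]
  simp

theorem eventually_sum_trueGap_eq [NeZero m] {n : ℕ} [NeZero n] (hp : p.IsRegular) :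
    ∀ᶠ δ in 𝓝[>] (0 : ℝ), ∀ (τ : Equiv.Perm (Fin n)), ∀ z ∈ tube p τ δ,
      ∑ k, trueGap p τ k z = 2 * Real.pi := by
  obtain ⟨K, hK1, hK⟩ := exists_estimates hp
  have hn0 : (0 : ℝ) < n := by exact_mod_cast NeZero.pos n
  have hπ := Real.pi_pos
  filter_upwards [hK n 1 one_pos,
    nhdsWithin_le_nhds (gt_mem_nhds (show 0 < 2 * Real.pi / n by positivity))] with δ h1 hδ τ z hz
  have hE := h1 τ z hz
  refine sum_eq_two_pi (u := fun k => unitVec (z.1 (τ k)) (center p)) (fun k => ?_)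
    (fun k => hE.exp_trueGap hp k) fun k => (hz.2.2 k).trans hδ
  rw [← norm_pos_iff, hE.norm_unitVec_center hp]
  exact one_pos

/-- As long as a gap is too small, `sqGaps` decreases at a definite rate, provided that the
deviation is small. -/
theorem exists_fderiv_sqGaps_le_neg [NeZero m] {n : ℕ} [NeZero n] (hn : 3 ≤ n) (hp : p.IsRegular)
    (hM : 2 * orbitRadius p * Real.sin (Real.pi / n) ≤ p.M) :
    ∀ᶠ δ in 𝓝[>] (0 : ℝ), ∀ μ > 0, ∃ w > 0, ∃ d₀ > 0, ∀ (τ : Equiv.Perm (Fin n)),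
      ∀ z ∈ tube p τ δ, deviation p z ≤ d₀ → (∃ k, trueGap p τ k z ≤ 2 * Real.pi / n - μ) →
        fderiv ℝ (sqGaps p τ) z (vectorField p z) ≤ -w := by
  obtain ⟨K, hK1, hK⟩ := exists_estimates hp
  obtain ⟨C₁, hC₁, h₁⟩ := exists_fderiv_sqGaps_le hn hp
  obtain ⟨C₂, hC₂, h₂⟩ := exists_abs_estGap_sub_le hn hp
  have hr := hp.orbitRadius_pos
  have hα := hp.α_pos
  have hπ := Real.pi_pos
  have hπ3 := Real.pi_gt_three
  have hn0 : (0 : ℝ) < n := by exact_mod_cast NeZero.pos n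
  have hn' : (3 : ℝ) ≤ n := by exact_mod_cast hn
  filter_upwards [h₁, h₂, hK n 1 one_pos, eventually_sum_trueGap_eq (n := n) hp,
    eventually_estGap_mem hn hp, eventually_linkGap_mem hn hp, eventually_speed_eq hn hp,
    nhdsWithin_le_nhds (gt_mem_nhds (show 0 < 2 * Real.pi / n by positivity)),
    nhdsWithin_le_nhds (gt_mem_nhds (show 0 < Real.pi / 6 by positivity))]
    with δ h1 h2 h3 h4 h5 h6 h7 hδ hδ' μ' hμ'
  obtain ⟨μ, hμ, hμμ', hμ1⟩ : ∃ μ > 0, μ ≤ μ' ∧ μ ≤ 1 :=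
    ⟨min μ' 1, lt_min hμ' one_pos, min_le_left _ _, min_le_right _ _⟩
  set ν := μ / n with hν
  have hν0 : 0 < ν := by positivity
  have hν1 : ν ≤ 1 / n := by rw [hν]; gcongr
  set γ := 2 * Real.pi / n with hγ
  have hγ2 : γ / 2 = Real.pi / n := by rw [hγ]; ring
  have hγν : ν < γ := by
    refine hν1.trans_lt ?_
    rw [hγ]
    gcongr
    linarith
  have hγπ : γ / 2 ≤ Real.pi / 2 := by
    rw [hγ2]
    gcongr
    linarith
  have hsin : 0 < Real.sin (γ / 2) - Real.sin ((γ - ν) / 2) :=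
    sub_pos.mpr (Real.sin_lt_sin_of_lt_of_le_pi_div_two (by linarith) hγπ (by linarith))
  have hq : 0 < 1 + ν / (2 * Real.pi) := by positivity
  set w₁ := p.f (ENNReal.ofReal (1 + ν / (2 * Real.pi))) - p.f (ENNReal.ofReal 1) with hw₁
  have hw₁0 : 0 < w₁ := sub_pos.mpr (hp.strictMonoOn_ofReal (Set.mem_Ioi.mpr one_pos) hq (by
    have : 0 < ν / (2 * Real.pi) := by positivity
    linarith))
  set w := p.α / orbitRadius p * (ν * w₁) with hw
  have hw0 : 0 < w := by positivity
  -- The three bounds on the deviation: the error term costs at most half of the decay `2 * w`;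
  -- estimated gaps keep half of the jump `ν`; and the short chord stays below that of the regular
  -- polygon.
  refine ⟨w, hw0, min (w / (C₁ + 1)) (min (ν / (4 * (C₂ + 1)))
    (orbitRadius p * (Real.sin (γ / 2) - Real.sin ((γ - ν) / 2)))), by positivity,
    fun τ z hz hd hk => ?_⟩
  obtain ⟨a, ha⟩ := hk
  have hE := h3 τ z hz
  set D := deviation p z with hD
  have hD0 : 0 ≤ D := deviation_nonneg
  have d1 : D * (C₁ + 1) ≤ w := (le_div_iff₀ (by positivity)).mp (hd.trans (min_le_left _ _))
  have d2 : D * (4 * (C₂ + 1)) ≤ ν := (le_div_iff₀ (by positivity)).mp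
    (hd.trans ((min_le_right _ _).trans (min_le_left _ _)))
  have d3 : D ≤ orbitRadius p * (Real.sin (γ / 2) - Real.sin ((γ - ν) / 2)) :=
    hd.trans ((min_le_right _ _).trans (min_le_right _ _))
  obtain ⟨j, hj1, hj2⟩ := exists_jump_of_sum_eq (x := fun k => trueGap p τ k z) (g := γ) hμ
    (by rw [h4 τ z hz, hγ]; field_simp) (a := a) (by linarith)
  rw [← hν] at hj1 hj2
  -- Here the detection range enters: a gap shorter than `2π/n` by `ν` has a chord below `2r
  -- sin(π/n) ≤ M` with room for the deviation.
  have hconn : ‖z.1 (τ (j + 1)) - z.1 (τ j)‖ ≤ p.M := by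
    have c1 := abs_le.mp (hE.abs_dist_sub_chord_le hp (trueGap_nonneg_of_le hδ.le hz j))
    have c2 : Real.sin (trueGap p τ j z / 2) ≤ Real.sin ((γ - ν) / 2) :=
      Real.sin_le_sin_of_le_of_le_pi_div_two
        (by linarith [trueGap_nonneg_of_le hδ.le hz j]) (by linarith) (by linarith)
    rw [← hγ2] at hM
    nlinarith [c1.2]
  have hL : linkGap p τ j z = estGap p τ j z := if_pos hconn
  have hLpos : 0 < estGap p τ j z := lt_trans (by positivity) (h5 τ z hz j).1
  -- The next gap need not be detected; replacing it by `π` only increases the ratio.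
  have hL' : estGap p τ (j + 1) z ≤ linkGap p τ (j + 1) z := by
    rw [linkGap]
    split_ifs
    · exact le_rfl
    · exact (h5 τ z hz _).2.le
  have hηdev : C₂ * estError p z ≤ C₂ * D := mul_le_mul_of_nonneg_left estError_le_deviation hC₂
  have hratio : 1 + ν / (2 * Real.pi) ≤ linkGap p τ (j + 1) z / linkGap p τ j z := by
    rw [hL, le_div_iff₀ hLpos]
    have c1 := abs_le.mp (h2 τ z hz j)
    have c2 := abs_le.mp (h2 τ z hz (j + 1))
    have c3 : estGap p τ j z + ν / 2 ≤ estGap p τ (j + 1) z := by linarith [c1.2, c2.1]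
    have c4 : ν / (2 * Real.pi) * estGap p τ j z ≤ ν / (2 * Real.pi) * Real.pi := by
      have := (h5 τ z hz j).2.le
      gcongr
    have c5 : ν / (2 * Real.pi) * Real.pi = ν / 2 := by field_simp
    linarith
  have hs : w₁ ≤ speed p z (τ (j + 1)) - p.f (ENNReal.ofReal 1) := by
    rw [h7 τ z hz, hw₁]
    have := hp.strictMonoOn_ofReal.monotoneOn hq (hq.trans_le hratio) hratio
    linarith
  have hdis : ν * w₁ ≤ dissipation p τ j z := by
    rw [dissipation]
    exact mul_le_mul hj2 hs hw₁0.le (hν0.le.trans hj2)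
  refine (h1 τ z hz j).trans ?_
  have hfin : 2 * w ≤ 2 * p.α / orbitRadius p * dissipation p τ j z := by
    have : 2 * w = 2 * p.α / orbitRadius p * (ν * w₁) := by rw [hw]; ring
    rw [this]
    gcongr
  linarith

end Gaps

/-! ### The gaps between consecutive agents -/

section NearEquilibrium

open Filter Topology
open scoped Fin.CommRing

variable {n m : ℕ} {p : Params m} {τ : Equiv.Perm (Fin n)} {z : State n m}

theorem exp_phi {i : Fin n} (h : ‖estDir p z i‖ = 1) :
    Complex.exp (phi p z i * Complex.I) = -estDir p z i := by
  have h1 : phi p z i = theta p z i + Real.pi -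
      (toIcoDiv Real.two_pi_pos 0 (theta p z i + Real.pi) : ℝ) * (2 * Real.pi) := by
    rw [phi, toIcoMod, zsmul_eq_mul]
  have h2 : Complex.exp (theta p z i * Complex.I) = estDir p z i := by
    have h3 := Complex.norm_mul_exp_arg_mul_I (estDir p z i)
    rwa [h, Complex.ofReal_one, one_mul] at h3
  rw [h1]
  push_cast
  rw [sub_mul, add_mul, Complex.exp_sub, Complex.exp_add, h2, Complex.exp_pi_mul_I,
    mul_assoc, Complex.exp_int_mul_two_pi_mul_I]
  ring

theorem exp_estGap [NeZero n] (h : ∀ i, ‖estDir p z i‖ = 1) (k : Fin n) :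
    Complex.exp (estGap p τ k z * Complex.I) = estDir p z (τ (k + 1)) / estDir p z (τ k) := by
  have h1 := Complex.norm_mul_exp_arg_mul_I (estDir p z (τ (k + 1)) / estDir p z (τ k))
  rwa [norm_div, h, h, div_one, Complex.ofReal_one, one_mul] at h1

theorem eq_of_exp_eq {x y a : ℝ} (h : Complex.exp (x * Complex.I) = Complex.exp (y * Complex.I))
    (hx : x ∈ Set.Ico a (a + 2 * Real.pi)) (hy : y ∈ Set.Ico a (a + 2 * Real.pi)) : x = y := by
  obtain ⟨N, hN⟩ := Complex.exp_eq_exp_iff_exists_int.mp h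
  have h1 : x = y + N • (2 * Real.pi) := by
    have h2 : (x : ℂ) * Complex.I = ((y + N * (2 * Real.pi) : ℝ) : ℂ) * Complex.I := by
      rw [hN]; push_cast; ring
    rw [zsmul_eq_mul]
    exact_mod_cast mul_right_cancel₀ Complex.I_ne_zero h2
  rw [← (toIcoMod_eq_self Real.two_pi_pos).mpr hx, ← (toIcoMod_eq_self Real.two_pi_pos).mpr hy, h1,
    toIcoMod_add_zsmul]

/-- The gaps between consecutive agents are the angles between the estimated directions. -/
theorem exists_gap_eq_estGap [NeZero n] (h : ∀ i, ‖estDir p z i‖ = 1)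
    (hpos : ∀ k, 0 < estGap p τ k z) (hsum : ∑ k, estGap p τ k z = 2 * Real.pi) (i : Fin n) :
    ∃ k, gap p z i = estGap p τ k z := by
  -- Numbering from the agent with the smallest `phi` turns the cyclic order into the sorted order
  -- of the angles in `[0, 2π)`.
  obtain ⟨κ, hκ⟩ := Finite.exists_min fun k => phi p z (τ k)
  set τ' : Equiv.Perm (Fin n) := (Equiv.addRight κ).trans τ with hτ'
  have hτ'k : ∀ k, τ' k = τ (k + κ) := fun k => rfl
  set S : ℕ → ℝ := fun l => ∑ i ∈ Finset.range l, estGap p τ ((i : Fin n) + κ) z with hS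
  have hSsucc : ∀ l, S (l + 1) = S l + estGap p τ ((l : Fin n) + κ) z := fun l =>
    Finset.sum_range_succ _ l
  have hSmono : StrictMono S := strictMono_nat_of_lt_succ fun l => by
    rw [hSsucc]; linarith [hpos ((l : Fin n) + κ)]
  have hS0 : S 0 = 0 := Finset.sum_range_zero _
  have hSn : S n = 2 * Real.pi := by
    rw [← hsum, hS]
    simp only
    rw [Finset.sum_range]
    simp only [Fin.cast_val_eq_self]
    exact Equiv.sum_comp (Equiv.addRight κ) fun k => estGap p τ k z
  have hexp : ∀ l : ℕ, Complex.exp (phi p z (τ' (l : Fin n)) * Complex.I) =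
      Complex.exp ((phi p z (τ' 0) + S l : ℝ) * Complex.I) := by
    intro l
    induction l with
    | zero => simp [hS0]
    | succ l ih =>
      have e : ((phi p z (τ' 0) + S (l + 1) : ℝ) : ℂ) * Complex.I =
          ((phi p z (τ' 0) + S l : ℝ) : ℂ) * Complex.I +
            (estGap p τ ((l : Fin n) + κ) z : ℂ) * Complex.I := by
        rw [hSsucc]; push_cast; ring
      rw [e, Complex.exp_add, ← ih, exp_estGap h, exp_phi (h _), exp_phi (h _), hτ'k, hτ'k,
        Nat.cast_succ, add_right_comm]
      have h0 : estDir p z (τ ((l : Fin n) + κ)) ≠ 0 :=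
        norm_ne_zero_iff.mp (by rw [h]; exact one_ne_zero)
      field_simp
  have hφ : ∀ i, phi p z i ∈ Set.Ico 0 (0 + 2 * Real.pi) := fun i => toIcoMod_mem_Ico _ _ _
  have hval : ∀ k : Fin n, phi p z (τ' k) = phi p z (τ' 0) + S k := by
    intro k
    have h1 := hexp k
    rw [Fin.cast_val_eq_self] at h1
    have h2 : S k < 2 * Real.pi := hSn ▸ hSmono k.isLt
    have h3 : 0 ≤ S k := hS0 ▸ hSmono.monotone (Nat.zero_le _)
    have h4 : phi p z (τ' 0) ≤ phi p z (τ' k) := by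
      rw [hτ'k, zero_add]; exact hκ _
    refine eq_of_exp_eq h1 (a := phi p z (τ' 0)) ⟨h4, ?_⟩ ⟨by linarith, by linarith⟩
    linarith [(hφ (τ' k)).2, (hφ (τ' 0)).1]
  have hmono : Monotone (phi p z ∘ τ') := fun k l hkl => by
    rw [Function.comp_apply, Function.comp_apply, hval k, hval l]
    linarith [hSmono.monotone (show k.val ≤ l.val from hkl)]
  have hsort : ∀ k, sortedPhi p z k = phi p z (τ' k) := fun k =>
    congr_fun (Tuple.comp_sort_eq_comp_iff_monotone.mpr hmono).symm k
  refine ⟨i + κ, ?_⟩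
  have hlast := hSsucc i.val
  rw [Fin.cast_val_eq_self] at hlast
  rw [gap]
  split_ifs with hi
  · rw [hsort, hsort, hval ⟨i + 1, hi⟩, hval i]
    linarith
  · have h5 : i.val + 1 = n := by have := i.isLt; omega
    rw [h5, hSn] at hlast
    rw [hsort, hsort, hval ⟨0, i.pos⟩, hval i, hS0]
    linarith

/-- The extra `2π` in the last gap is invisible to the exponential, so the formula is uniform around
the cycle. -/
theorem exp_gap [NeZero n] (h : ∀ i, ‖estDir p z i‖ = 1) (k : Fin n) :
    Complex.exp (gap p z k * Complex.I) =
      estDir p z (Tuple.sort (phi p z) (k + 1)) / estDir p z (Tuple.sort (phi p z) k) := by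
  have h0 : ∀ i, estDir p z i ≠ 0 := fun i => norm_ne_zero_iff.mp (by rw [h]; exact one_ne_zero)
  rw [gap]
  split_ifs with hk
  · have e : (⟨k.val + 1, hk⟩ : Fin n) = k + 1 := by
      apply Fin.ext
      rw [Fin.val_add_one_of_lt']
      exact hk
    rw [e]
    simp only [sortedPhi, Function.comp_apply]
    push_cast
    rw [sub_mul, Complex.exp_sub, exp_phi (h _), exp_phi (h _), neg_div_neg_eq]
  · have e : (⟨0, k.pos⟩ : Fin n) = k + 1 := by
      have h5 : k.val + 1 = n := by have := k.isLt; omega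
      apply Fin.ext
      rw [Fin.val_add, Fin.coe_ofNat_eq_mod, Nat.add_mod_mod, h5, Nat.mod_self]
    rw [e]
    simp only [sortedPhi, Function.comp_apply]
    push_cast
    rw [sub_mul, Complex.exp_sub, add_mul, Complex.exp_add, exp_phi (h _), exp_phi (h _),
      Complex.exp_two_pi_mul_I, mul_one, neg_div_neg_eq]

theorem eventually_nearEquilibrium [NeZero m] {n : ℕ} [NeZero n] (hn : 3 ≤ n) (hp : p.IsRegular)
    {ε : ℝ} (hε : 0 < ε) : ∀ᶠ δ in 𝓝[>] (0 : ℝ), ∀ (τ : Equiv.Perm (Fin n)), ∀ z ∈ tube p τ δ,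
      NearEquilibrium p ε z := by
  obtain ⟨K, hK1, hK⟩ := exists_estimates hp
  have hπ := Real.pi_pos
  have hn0 : (0 : ℝ) < n := by exact_mod_cast NeZero.pos n
  filter_upwards [hK n (ε / 2) (half_pos hε), eventually_abs_estGap_sub_lt hn hp hε,
    eventually_estGap_mem hn hp,
    eventually_abs_estGap_sub_lt hn hp (show 0 < 2 * Real.pi / n by positivity),
    nhdsWithin_le_nhds (gt_mem_nhds hε)] with δ h1 h2 h3 h4 hδ τ z hz i
  have hE := h1 τ z hz
  have hdir := hE.norm_estDir hp
  have hsum : ∑ k, estGap p τ k z = 2 * Real.pi :=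
    sum_eq_two_pi (u := fun k => estDir p z (τ k))
      (fun k => norm_ne_zero_iff.mp (by rw [hdir]; exact one_ne_zero)) (exp_estGap hdir)
      (h4 τ z hz)
  have hpos : ∀ k, 0 < estGap p τ k z := fun k => lt_trans (by positivity) (h3 τ z hz k).1
  obtain ⟨k, hk⟩ := exists_gap_eq_estGap hdir hpos hsum i
  have hη : K * estError p z ≤ ε / 2 :=
    le_trans (mul_le_mul_of_nonneg_left estError_le_deviation (by linarith)) hE.small
  refine ⟨((hE.abs_dist_orbit i).trans hE.small).trans_lt (half_lt_self hε),
    ((hE.norm_center i).trans hη).trans_lt (half_lt_self hε), ?_, fun j => (hz.1 i j).trans hδ⟩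
  rw [hk]
  exact h2 τ z hz k

/-- The permutation that sorts the angles serves as `τ`. The estimated centre is close to the true
one by assumption, so sorted gaps, known through their exponentials, carry over to true gaps by the
local Lipschitz bound for `arg`. -/
theorem exists_mem_tube_of_nearEquilibrium [NeZero m] {n : ℕ} [NeZero n] (hn : 3 ≤ n)
    (hp : p.IsRegular) {δ : ℝ} (hδ : 0 < δ) : ∃ δ' > 0, ∀ z : State n m, NearEquilibrium p δ' z →
      ∃ τ : Equiv.Perm (Fin n), z ∈ tube p τ δ := by
  have hr := hp.orbitRadius_pos
  have hslit : rot n ∈ Complex.slitPlane := by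
    rw [Complex.mem_slitPlane_iff_arg, arg_rot hn]
    exact ⟨(two_pi_div_lt_pi hn).ne, norm_ne_zero_iff.mp (by rw [norm_rot]; exact one_ne_zero)⟩
  obtain ⟨C, hC, ε, hε, hL⟩ := exists_abs_arg_sub_le hslit
  set r := orbitRadius p with hrdef
  have hev : ∀ᶠ δ' in 𝓝[>] (0 : ℝ), δ' < δ ∧ 2 * δ' < δ ∧ 2 * δ' < r / 2 ∧
      (8 / r + 1) * δ' < ε ∧ C * ((8 / r + 1) * δ') < δ := by
    have hc : ∀ f : ℝ → ℝ, Continuous f → f 0 = 0 → ∀ c > 0, ∀ᶠ δ' in 𝓝[>] (0 : ℝ), f δ' < c :=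
      fun f hf h0 c hc => nhdsWithin_le_nhds
        (hf.continuousAt.eventually (gt_mem_nhds (by rwa [h0])))
    filter_upwards [hc (fun x => x) (by fun_prop) rfl δ hδ,
      hc (fun x => 2 * x) (by fun_prop) (by simp) δ hδ,
      hc (fun x => 2 * x) (by fun_prop) (by simp) (r / 2) (by positivity),
      hc (fun x => (8 / r + 1) * x) (by fun_prop) (by simp) ε hε,
      hc (fun x => C * ((8 / r + 1) * x)) (by fun_prop) (by simp) δ hδ] with x a b c d e
    exact ⟨a, b, c, d, e⟩
  obtain ⟨δ', ⟨h1, h2, h3, h4, h5⟩, hδ'⟩ := (hev.and self_mem_nhdsWithin).exists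
  have hδ'0 : (0 : ℝ) < δ' := hδ'
  refine ⟨δ', hδ', fun z hz => ⟨Tuple.sort (phi p z), fun i j => ((hz i).2.2.2 j).trans h1,
    fun i => ?_, fun k => ?_⟩⟩
  · have a1 := abs_lt.mp (hz i).1
    have a2 := (hz i).2.1
    have a3 := abs_le.mp (abs_estDist_sub_le (p := p) (z := z) i)
    rw [abs_lt]
    constructor <;> linarith [a1.1, a1.2, a3.1, a3.2]
  · have hdist : ∀ i, r / 2 ≤ estDist p z i := fun i => by
      linarith [(abs_lt.mp (hz i).1).1]
    have hne : ∀ i, z.1 i ≠ estCenter p z i := fun i => by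
      have := hdist i
      rw [ne_comm, ← sub_ne_zero, ← norm_pos_iff]
      rw [estDist] at this
      linarith
    have hnec : ∀ i, z.1 i ≠ center p := fun i => by
      have a1 := hdist i
      have a2 := (hz i).2.1
      have a3 := abs_le.mp (abs_estDist_sub_le (p := p) (z := z) i)
      rw [← sub_ne_zero, ← norm_pos_iff]
      linarith [a3.2]
    have hdir : ∀ i, ‖estDir p z i‖ = 1 := fun i => norm_unitVec (hne i)
    have hclose : ∀ i, ‖estDir p z i - unitVec (z.1 i) (center p)‖ ≤ 4 / r * δ' := fun i => by
      refine (norm_unitVec_sub_le (hne i)).trans ?_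
      have a1 := hdist i
      rw [estDist] at a1
      rw [div_le_iff₀ (by linarith)]
      calc 2 * ‖estCenter p z i - center p‖ ≤ 2 * δ' := by have := (hz i).2.1.le; gcongr
        _ = 4 / r * δ' * (r / 2) := by field_simp; ring
        _ ≤ _ := by gcongr
    have hexp := exp_trueGap_of_ne (τ := Tuple.sort (phi p z)) (k := k) (hnec _) (hnec _)
    have hrot : ‖Complex.exp (trueGap p (Tuple.sort (phi p z)) k z * Complex.I) - rot n‖ ≤
        (8 / r + 1) * δ' := by
      have a1 : ‖unitVec (z.1 (Tuple.sort (phi p z) (k + 1))) (center p) /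
          unitVec (z.1 (Tuple.sort (phi p z) k)) (center p) -
          Complex.exp (gap p z k * Complex.I)‖ ≤ 4 / r * δ' + 4 / r * δ' := by
        rw [exp_gap hdir]
        refine (norm_div_sub_div_le (norm_unitVec (hnec _)) (hdir _) (hdir _)).trans ?_
        rw [norm_sub_rev, norm_sub_rev (unitVec (z.1 (Tuple.sort (phi p z) k)) (center p))]
        exact add_le_add (hclose _) (hclose _)
      have a2 : ‖Complex.exp (gap p z k * Complex.I) - rot n‖ ≤ δ' :=
        (norm_exp_sub_exp_le _ _).trans (hz k).2.2.1.le
      rw [hexp]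
      refine (norm_sub_le_norm_sub_add_norm_sub _ (Complex.exp (gap p z k * Complex.I)) _).trans ?_
      refine (add_le_add a1 a2).trans_eq ?_
      ring
    have hfin := hL _ (rot n) (hrot.trans_lt h4) (by simpa using hε)
    rw [arg_exp_trueGap, arg_rot hn] at hfin
    exact (hfin.trans (mul_le_mul_of_nonneg_left hrot hC)).trans_lt h5

end NearEquilibrium

/-! ### Trajectories in the tube -/

section Trajectories

open Filter Topology
open scoped Fin.CommRing

variable {n m : ℕ} {p : Params m} {τ : Equiv.Perm (Fin n)} {z : State n m}

theorem continuous_rho (p : Params m) (i : Fin n) (j : Fin m) :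
    Continuous fun z : State n m => rho p z i j := by
  unfold rho
  fun_prop

theorem continuous_estError (p : Params m) :
    Continuous fun z : State n m => estError p z := by
  have := continuous_rho (n := n) p
  unfold estError
  fun_prop

theorem continuous_deviation (p : Params m) :
    Continuous fun z : State n m => deviation p z := by
  have := continuous_estError (n := n) p
  unfold deviation
  fun_prop

/-- The properties of a tube from which the behaviour of its trajectories follows. -/
structure GoodTube [NeZero n] (p : Params m) (a C₁ C₂ δ : ℝ) : Prop where
  pos : 0 < δ
  lt_radius : δ < orbitRadius p
  le_pi_div_six : δ ≤ Real.pi / 6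
  ne_center : ∀ (τ : Equiv.Perm (Fin n)), ∀ z ∈ tube p τ δ, ∀ i, z.1 i ≠ center p
  rho_ne : ∀ (τ : Equiv.Perm (Fin n)), ∀ z ∈ tube p τ δ, ∀ i j, rho p z i j ≠ 0
  slit : ∀ (τ : Equiv.Perm (Fin n)), ∀ z ∈ tube p τ δ, ∀ k,
    (z.1 (τ (k + 1)) - center p) / (z.1 (τ k) - center p) ∈ Complex.slitPlane
  bounded : ∃ C : NNReal, ∀ (τ : Equiv.Perm (Fin n)), ∀ z ∈ tube p τ δ, ‖vectorField p z‖ ≤ C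
  sum_gap : ∀ (τ : Equiv.Perm (Fin n)), ∀ z ∈ tube p τ δ, ∑ k, trueGap p τ k z = 2 * Real.pi
  sqError_le : ∀ (τ : Equiv.Perm (Fin n)), ∀ z ∈ tube p τ δ, ∀ i j,
      fderiv ℝ (sqError p i j) z (vectorField p z) ≤ -a * sqError p i j z
  sqRadial_le : ∀ (τ : Equiv.Perm (Fin n)), ∀ z ∈ tube p τ δ, ∀ i,
      fderiv ℝ (sqRadial p i) z (vectorField p z) ≤
        -p.k * sqRadial p i z + C₁ * estError p z ^ 2
  sqGaps_le : ∀ (τ : Equiv.Perm (Fin n)), ∀ z ∈ tube p τ δ,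
      fderiv ℝ (sqGaps p τ) z (vectorField p z) ≤ C₂ * deviation p z
  sqGaps_le_neg : ∀ μ > 0, ∃ w > 0, ∃ d₀ > 0, ∀ (τ : Equiv.Perm (Fin n)),
      ∀ z ∈ tube p τ δ, deviation p z ≤ d₀ → (∃ k, trueGap p τ k z ≤ 2 * Real.pi / n - μ) →
        fderiv ℝ (sqGaps p τ) z (vectorField p z) ≤ -w

theorem eventually_goodTube [NeZero m] {n : ℕ} [NeZero n] (hn : 3 ≤ n) (hp : p.IsRegular)
    (hM : 2 * orbitRadius p * Real.sin (Real.pi / n) ≤ p.M) :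
    ∃ a > 0, ∃ C₁ > 0, ∃ C₂ : ℝ, 0 ≤ C₂ ∧
      ∀ᶠ δ in 𝓝[>] (0 : ℝ), GoodTube (n := n) p a C₁ C₂ δ := by
  obtain ⟨K, hK1, hK⟩ := exists_estimates hp
  obtain ⟨a, ha, h₁⟩ := exists_fderiv_sqError_le hn hp
  obtain ⟨C₁, hC₁, h₂⟩ := exists_fderiv_sqRadial_le hn hp
  obtain ⟨C, hC, h₃⟩ := exists_fderiv_sqGaps_le hn hp
  obtain ⟨C', hC', h₄⟩ := exists_le_dissipation hn hp
  obtain ⟨B, hB, h₅⟩ := exists_norm_vectorField_le hn hp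
  have hr := hp.orbitRadius_pos
  have hα := hp.α_pos
  have hπ := Real.pi_pos
  refine ⟨a, ha, C₁, hC₁, 2 * p.α / orbitRadius p * C' + C, by positivity, ?_⟩
  filter_upwards [h₁, h₂, h₃, h₄, h₅, hK n 1 one_pos, eventually_sum_trueGap_eq (n := n) hp,
    exists_fderiv_sqGaps_le_neg hn hp hM, self_mem_nhdsWithin, nhdsWithin_le_nhds (gt_mem_nhds hr),
    nhdsWithin_le_nhds (gt_mem_nhds (show 0 < Real.pi / 6 by positivity))]
    with δ e1 e2 e3 e4 e5 hE e7 e8 hδ hδr hδπ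
  refine ⟨hδ, hδr, hδπ.le, fun τ z hz i => (hE τ z hz).ne_center hp i, fun τ z hz i j => ?_,
    fun τ z hz k => div_mem_slitPlane_of_tube hn hδπ.le hz ((hE τ z hz).ne_center hp) k,
    ⟨⟨B, hB⟩, e5⟩, e7, e1, e2, fun τ z hz => ?_, e8⟩
  · exact ((hp.h_pos.trans hp.h_lt).trans_le (rs_le_rho ((hE τ z hz).rs_le i) j)).ne'
  · refine (e3 τ z hz 0).trans ?_
    have := e4 τ z hz 0
    have h9 : 0 ≤ 2 * p.α / orbitRadius p := by positivity
    have := mul_le_mul_of_nonneg_left this h9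
    linarith

namespace GoodTube

variable [NeZero n] {a C₁ C₂ δ : ℝ}

theorem isOpen_tube (h : GoodTube (n := n) p a C₁ C₂ δ) (τ : Equiv.Perm (Fin n)) :
    IsOpen (tube p τ δ) := by
  refine isOpen_iff_mem_nhds.mpr fun z hz => ?_
  have h1 : ∀ᶠ z' in 𝓝 z, ∀ i j, |z'.2 i j - rho p z' i j| < δ := by
    refine eventually_all.mpr fun i => eventually_all.mpr fun j => ?_
    have hc : Continuous fun z' : State n m => |z'.2 i j - rho p z' i j| := by
      have := continuous_rho p i j
      fun_prop
    exact hc.continuousAt.eventually (gt_mem_nhds (hz.1 i j))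
  have h2 : ∀ᶠ z' in 𝓝 z, ∀ i, |‖z'.1 i - center p‖ - orbitRadius p| < δ := by
    refine eventually_all.mpr fun i => ?_
    have hc : Continuous fun z' : State n m => |‖z'.1 i - center p‖ - orbitRadius p| := by fun_prop
    exact hc.continuousAt.eventually (gt_mem_nhds (hz.2.1 i))
  have h3 : ∀ᶠ z' in 𝓝 z, ∀ k, |trueGap p τ k z' - 2 * Real.pi / n| < δ := by
    refine eventually_all.mpr fun k => ?_
    have hc := (contDiffAt_trueGap (h.ne_center τ z hz _) (h.slit τ z hz k)).continuousAt
    exact (hc.sub continuousAt_const).abs.eventually (gt_mem_nhds (hz.2.2 k))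
  filter_upwards [h1, h2, h3] with z' a b c
  exact ⟨a, b, c⟩

theorem contDiffAt_sqGaps (h : GoodTube (n := n) p a C₁ C₂ δ) (hz : z ∈ tube p τ δ) :
    ContDiffAt ℝ 1 (sqGaps p τ) z :=
  ContDiffAt.sum fun k _ =>
    ((contDiffAt_trueGap (h.ne_center τ z hz _) (h.slit τ z hz k)).sub contDiffAt_const).pow 2

/-- The comparison principle for continuously differentiable functions, inside a tube. -/
theorem le_barrier (h : GoodTube (n := n) p a C₁ C₂ δ) {F : State n m → State n m}
    (hF : Set.EqOn F (vectorField p) (tube p τ δ)) {x : ℝ → State n m} {T : ℝ}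
    (hx : IsSolutionOn F x T) {s t₁ : ℝ} (hs : 0 ≤ s) (ht₁ : t₁ ≤ T)
    (hxt : ∀ t ∈ Set.Icc s t₁, x t ∈ tube p τ δ) {W : State n m → ℝ}
    (hW : ∀ z ∈ tube p τ δ, ContDiffAt ℝ 1 W z) {B B' : ℝ → ℝ}
    (hB : ∀ t, HasDerivAt B (B' t) t) (h0 : W (x s) ≤ B s)
    (hq : ∀ t ∈ Set.Icc s t₁, W (x t) = B t → ∃ q < B' t, ∀ᶠ z in 𝓝 (x t), z ∈ tube p τ δ →
      fderiv ℝ W z (vectorField p z) ≤ q) :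
    ∀ t ∈ Set.Icc s t₁, W (x t) ≤ B t := by
  obtain ⟨C, hC⟩ := h.bounded
  have hopen := h.isOpen_tube τ
  refine hx.le_barrier hs ht₁ (W' := fderiv ℝ W)
    (fun t ht => ((hW _ (hxt t ht)).differentiableAt one_ne_zero).hasFDerivAt)
    (fun t ht => (hW _ (hxt t ht)).continuousAt_fderiv one_ne_zero) (fun t ht => ⟨C, ?_⟩) hB h0
    fun t ht hWB => ?_
  · filter_upwards [hopen.mem_nhds (hxt t ht)] with z hz
    rw [hF hz]
    exact hC τ z hz
  · obtain ⟨q, hq1, hq2⟩ := hq t ht hWB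
    refine ⟨q, hq1, ?_⟩
    filter_upwards [hopen.mem_nhds (hxt t ht), hq2] with z hz hz'
    rw [hF hz]
    exact hz' hz

end GoodTube

theorem hasDerivAt_mul_exp (c b t : ℝ) :
    HasDerivAt (fun t => c * Real.exp (-b * t)) (-b * (c * Real.exp (-b * t))) t := by
  have h1 : HasDerivAt (fun t : ℝ => -b * t) (-b) t := by
    simpa using (hasDerivAt_id t).const_mul (-b)
  refine (h1.exp.const_mul c).congr_deriv ?_
  ring

namespace GoodTube

variable [NeZero n] {a C₁ C₂ δ : ℝ}

/-- The field `F` is only required to agree with the closed loop in the tube, so that the estimates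
also apply to the cut-off field used for existence. -/
theorem abs_error_le (h : GoodTube (n := n) p a C₁ C₂ δ) {F : State n m → State n m}
    (hF : Set.EqOn F (vectorField p) (tube p τ δ)) {x : ℝ → State n m} {T : ℝ}
    (hx : IsSolutionOn F x T) (hxt : ∀ t ∈ Set.Icc 0 T, x t ∈ tube p τ δ) {b δ' : ℝ}
    (hb : 2 * b < a) (hδ' : 0 < δ') (h0 : ∀ i j, |(x 0).2 i j - rho p (x 0) i j| ≤ δ') :
    ∀ t ∈ Set.Icc 0 T, ∀ i j, |(x t).2 i j - rho p (x t) i j| ≤ δ' * Real.exp (-b * t) := by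
  intro t ht i j
  have key := h.le_barrier hF hx le_rfl le_rfl hxt
    (fun z hz => contDiffAt_sqError (h.rho_ne τ z hz i j))
    (fun t => hasDerivAt_mul_exp (δ' ^ 2) (2 * b) t) (by
      rw [mul_zero, Real.exp_zero, mul_one]
      exact sq_le_sq' (by linarith [(abs_le.mp (h0 i j)).1]) (abs_le.mp (h0 i j)).2)
    (fun t ht hWB => by
      have hpos : 0 < δ' ^ 2 * Real.exp (-(2 * b) * t) := by positivity
      obtain ⟨q, hq1, hq2⟩ := exists_between
        (show -a * (δ' ^ 2 * Real.exp (-(2 * b) * t)) <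
          -(2 * b) * (δ' ^ 2 * Real.exp (-(2 * b) * t)) by nlinarith)
      rw [← hWB] at hq1
      refine ⟨q, hq2, ?_⟩
      have hc : ContinuousAt (fun z => -a * sqError p i j z) (x t) :=
        continuousAt_const.mul (contDiffAt_sqError (h.rho_ne τ _ (hxt t ht) i j)).continuousAt
      filter_upwards [hc.eventually (gt_mem_nhds hq1)] with z hz hz'
      exact (h.sqError_le τ z hz' i j).trans (le_of_lt hz)) t ht
  have e : δ' ^ 2 * Real.exp (-(2 * b) * t) = (δ' * Real.exp (-b * t)) ^ 2 := by
    rw [mul_pow, ← Real.exp_nat_mul]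
    congr 2
    push_cast; ring
  rw [e] at key
  exact abs_le_of_sq_le_sq key (by positivity)

theorem sqRadial_le_of_error (h : GoodTube (n := n) p a C₁ C₂ δ) {F : State n m → State n m}
    (hF : Set.EqOn F (vectorField p) (tube p τ δ)) {x : ℝ → State n m} {T : ℝ}
    (hx : IsSolutionOn F x T) (hxt : ∀ t ∈ Set.Icc 0 T, x t ∈ tube p τ δ) {b E A : ℝ}
    (hA : C₁ * E < (p.k - b) * A)
    (h0 : ∀ i, sqRadial p i (x 0) ≤ A)
    (hE : ∀ t ∈ Set.Icc 0 T, estError p (x t) ^ 2 ≤ E * Real.exp (-b * t)) (hC₁ : 0 ≤ C₁) :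
    ∀ t ∈ Set.Icc 0 T, ∀ i, sqRadial p i (x t) ≤ A * Real.exp (-b * t) := by
  intro t ht i
  refine h.le_barrier hF hx le_rfl le_rfl hxt
    (fun z hz => contDiffAt_sqRadial (h.ne_center τ z hz i))
    (fun t => hasDerivAt_mul_exp A b t) (by simpa using h0 i)
    (fun t ht hWB => ?_) t ht
  have hpos : 0 < Real.exp (-b * t) := Real.exp_pos _
  have h1 : -p.k * sqRadial p i (x t) + C₁ * estError p (x t) ^ 2 <
      -b * (A * Real.exp (-b * t)) := by
    have h2 := mul_le_mul_of_nonneg_left (hE t ht) hC₁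
    have h3 := mul_lt_mul_of_pos_right hA hpos
    rw [hWB]
    linarith
  obtain ⟨q, hq1, hq2⟩ := exists_between h1
  refine ⟨q, hq2, ?_⟩
  have hc : ContinuousAt (fun z => -p.k * sqRadial p i z + C₁ * estError p z ^ 2) (x t) :=
    (continuousAt_const.mul
      (contDiffAt_sqRadial (h.ne_center τ _ (hxt t ht) i)).continuousAt).add
      (continuousAt_const.mul ((continuous_estError p).continuousAt.pow 2))
  filter_upwards [hc.eventually (gt_mem_nhds hq1)] with z hz hz'
  exact (h.sqRadial_le τ z hz' i).trans (le_of_lt hz)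

/-- The barrier is the integral of an exponentially decaying bound on the derivative, so the total
growth of the gap function is bounded for all time. The `+ 1` makes the comparison strict. -/
theorem sqGaps_le_of_deviation (h : GoodTube (n := n) p a C₁ C₂ δ) {F : State n m → State n m}
    (hF : Set.EqOn F (vectorField p) (tube p τ δ)) {x : ℝ → State n m} {T : ℝ}
    (hx : IsSolutionOn F x T) (hxt : ∀ t ∈ Set.Icc 0 T, x t ∈ tube p τ δ) {b D : ℝ}
    (hb : 0 < b) (hD : 0 < D) (hC₂ : 0 ≤ C₂)
    (hdev : ∀ t ∈ Set.Icc 0 T, deviation p (x t) ≤ D * Real.exp (-b * t)) :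
    ∀ t ∈ Set.Icc 0 T, sqGaps p τ (x t) ≤ sqGaps p τ (x 0) + (C₂ + 1) * D / b := by
  intro t ht
  have hB : ∀ t, HasDerivAt
      (fun t => (sqGaps p τ (x 0) + (C₂ + 1) * D / b) + -((C₂ + 1) * D / b) * Real.exp (-b * t))
      ((C₂ + 1) * D * Real.exp (-b * t)) t := fun t => by
    refine ((hasDerivAt_mul_exp (-((C₂ + 1) * D / b)) b t).const_add _).congr_deriv ?_
    field_simp
  have key := h.le_barrier hF hx le_rfl le_rfl hxt (fun z hz => h.contDiffAt_sqGaps hz) hB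
    (by simp) (fun t ht _ => by
      have hpos : 0 < Real.exp (-b * t) := Real.exp_pos _
      have h1 : C₂ * deviation p (x t) < (C₂ + 1) * D * Real.exp (-b * t) := by
        have := mul_le_mul_of_nonneg_left (hdev t ht) hC₂
        have : 0 < D * Real.exp (-b * t) := by positivity
        linarith
      obtain ⟨q, hq1, hq2⟩ := exists_between h1
      refine ⟨q, hq2, ?_⟩
      have hc : Continuous fun z : State n m => C₂ * deviation p z :=
        continuous_const.mul (continuous_deviation p)
      filter_upwards [hc.continuousAt.eventually (gt_mem_nhds hq1)] with z hz hz'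
      exact (h.sqGaps_le τ z hz').trans (le_of_lt hz)) t ht
  refine key.trans ?_
  have : 0 ≤ (C₂ + 1) * D / b * Real.exp (-b * t) := by positivity
  linarith

end GoodTube

end Trajectories

/-! ### Invariance and attractivity -/

section Invariance

open Filter Topology
open scoped Fin.CommRing

/-- A trajectory stays in a set `V`, provided that it is in `V` as long as it does not leave a
neighbourhood of the closure of `V`. -/
theorem mem_of_forall_mem_neighborhood {E : Type} [TopologicalSpace E] {x : ℝ → E} {T : ℝ}
    (hT : 0 ≤ T) (hx : ContinuousOn x (Set.Icc 0 T)) {U V : Set E} (hU : IsOpen U)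
    (hVU : closure V ⊆ U) (h0 : x 0 ∈ V)
    (h : ∀ t ∈ Set.Icc 0 T, (∀ s ∈ Set.Icc 0 t, x s ∈ U) → ∀ s ∈ Set.Icc 0 t, x s ∈ V) :
    ∀ t ∈ Set.Icc 0 T, x t ∈ V := by
  have hcl : IsClosed ({t | x t ∈ closure V} ∩ Set.Icc 0 T) := by
    rw [Set.inter_comm]
    exact hx.preimage_isClosed_of_isClosed isClosed_Icc isClosed_closure
  have key : Set.Icc 0 T ⊆ {t | x t ∈ closure V} := by
    refine hcl.Icc_subset_of_forall_mem_nhdsGT_of_Icc_subset (subset_closure h0)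
      fun t ht hs => ?_
    have hcont : ContinuousWithinAt x (Set.Ioi t) t :=
      (hx t ⟨ht.1, ht.2.le⟩).mono_of_mem_nhdsWithin (Icc_mem_nhdsGT_of_mem ht)
    have h1 : ∀ᶠ u in 𝓝[>] t, x u ∈ U :=
      hcont.eventually (hU.mem_nhds (hVU (hs ⟨ht.1, le_rfl⟩)))
    obtain ⟨u, hu, hu'⟩ := (mem_nhdsGT_iff_exists_Ioo_subset (a := t)).mp h1
    filter_upwards [Ioo_mem_nhdsGT (lt_min hu ht.2)] with t' ht'
    have h2 := lt_min_iff.mp ht'.2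
    refine subset_closure (h t' ⟨ht.1.trans ht'.1.le, h2.2.le⟩ (fun s hs' => ?_) t'
      ⟨ht.1.trans ht'.1.le, le_rfl⟩)
    rcases le_or_gt s t with hst | hst
    · exact hVU (hs ⟨hs'.1, hst⟩)
    · exact hu' ⟨hst, hs'.2.trans_lt h2.1⟩
  exact h T ⟨hT, le_rfl⟩ fun s hs => hVU (key hs)

variable {n m : ℕ} {p : Params m} {τ : Equiv.Perm (Fin n)} {z : State n m}

theorem mem_tube_of_deviation_lt [NeZero n] {δ : ℝ} (h1 : δ ≤ 1) (hdev : deviation p z < δ)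
    (hV : sqGaps p τ z < δ ^ 2) : z ∈ tube p τ δ := by
  have h0 : 0 ≤ deviation p z := deviation_nonneg
  refine ⟨fun i j => ?_, fun i => (abs_radius_sub_le_deviation i).trans_lt hdev, fun k => ?_⟩
  · refine (abs_sub_rho_le i j).trans_lt ?_
    have h2 := estError_le_deviation (p := p) (z := z)
    have h3 := estError_nonneg (p := p) (z := z)
    nlinarith
  · refine abs_lt_of_sq_lt_sq (lt_of_le_of_lt ?_ hV) (h0.trans hdev.le)
    exact Finset.single_le_sum (f := fun k => (trueGap p τ k z - 2 * Real.pi / n) ^ 2)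
      (fun _ _ => sq_nonneg _) (Finset.mem_univ k)

theorem sqGaps_le_of_mem_tube [NeZero n] {δ : ℝ} (hz : z ∈ tube p τ δ) :
    sqGaps p τ z ≤ n * δ ^ 2 := by
  refine (Finset.sum_le_sum fun k _ => ?_).trans_eq (by simp :
    ∑ _k : Fin n, δ ^ 2 = n * δ ^ 2)
  exact sq_le_sq' (abs_lt.mp (hz.2.2 k)).1.le (abs_lt.mp (hz.2.2 k)).2.le

/-- The delicate point is the branch cut of `arg`, where `trueGap` is discontinuous: a limit of
states of the smaller tube must be kept away from it. -/
theorem closure_tube_subset [NeZero n] (hn : 3 ≤ n) {δ δ' : ℝ} (h : δ' < δ)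
    (hr : δ ≤ orbitRadius p) (hδ : δ ≤ Real.pi / 6) :
    closure (tube p τ δ') ⊆ tube p τ δ := by
  intro z hz
  have hne : (𝓝[tube p τ δ'] z).NeBot := mem_closure_iff_nhdsWithin_neBot.mp hz
  have hmem : ∀ᶠ z' in 𝓝[tube p τ δ'] z, z' ∈ tube p τ δ' := self_mem_nhdsWithin
  have lim {g : State n m → ℝ} (hg : ContinuousAt g z) {c : ℝ}
      (hc : ∀ z' ∈ tube p τ δ', g z' ≤ c) : g z ≤ c :=
    le_of_tendsto (hg.tendsto.mono_left nhdsWithin_le_nhds) (hmem.mono hc)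
  have h1 : ∀ i, |‖z.1 i - center p‖ - orbitRadius p| ≤ δ' := fun i =>
    lim (g := fun z => |‖z.1 i - center p‖ - orbitRadius p|) (by fun_prop)
      fun z' hz' => (hz'.2.1 i).le
  have hc : ∀ i, z.1 i - center p ≠ 0 := fun i h0 => by
    have h2 := (abs_le.mp (h1 i)).1
    rw [h0, norm_zero] at h2
    linarith
  have hπ := Real.pi_pos
  have hn0 : (3 : ℝ) ≤ n := by exact_mod_cast hn
  have hγ : 2 * Real.pi / n ≤ 2 * Real.pi / 3 := by gcongr
  refine ⟨fun i j => (lim (g := fun z => |z.2 i j - rho p z i j|) ?_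
    fun z' hz' => (hz'.1 i j).le).trans_lt h, fun i => (h1 i).trans_lt h, fun k => ?_⟩
  · have := continuous_rho (n := n) p i j
    fun_prop
  set w : State n m → ℂ := fun z => (z.1 (τ (k + 1)) - center p) / (z.1 (τ k) - center p) with hw
  have hwc : ContinuousAt w z := by
    refine ContinuousAt.div (by fun_prop) (by fun_prop) (hc _)
  have hw0 : w z ≠ 0 := div_ne_zero (hc _) (hc _)
  -- The bound `2π/3 + π/6 = 5π/6` on the angle is written as a continuous inequality, which
  -- survives limits and excludes the negative real axis.
  have hre : Real.cos (5 * Real.pi / 6) * ‖w z‖ - (w z).re ≤ 0 := by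
    refine lim (g := fun z => Real.cos (5 * Real.pi / 6) * ‖w z‖ - (w z).re)
      (by fun_prop) fun z' hz' => ?_
    have h2 : |(w z').arg| ≤ 5 * Real.pi / 6 := by
      have h3 := abs_lt.mp (hz'.2.2 k)
      have h4 : 0 < 2 * Real.pi / n := by positivity
      simp only [trueGap] at h3
      exact abs_le.mpr ⟨by linarith, by linarith⟩
    have h3 := Real.cos_le_cos_of_nonneg_of_le_pi (abs_nonneg _) (by linarith) h2
    rw [Real.cos_abs] at h3
    have h4 := Complex.norm_mul_cos_arg (w z')
    nlinarith [mul_le_mul_of_nonneg_left h3 (norm_nonneg (w z'))]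
  have hslit : w z ∈ Complex.slitPlane := by
    by_contra hns
    simp only [Complex.mem_slitPlane_iff, not_or, not_lt, not_not] at hns
    have h2 : ‖w z‖ = -(w z).re := by
      rw [← abs_of_nonpos hns.1]
      exact (Complex.abs_re_eq_norm.mpr hns.2).symm
    have h3 : 0 < ‖w z‖ := norm_pos_iff.mpr hw0
    have h4 : -1 < Real.cos (5 * Real.pi / 6) := by
      rw [← Real.cos_pi]
      exact Real.cos_lt_cos_of_nonneg_of_le_pi (by positivity) le_rfl (by linarith)
    nlinarith
  refine (lim (g := fun z => |trueGap p τ k z - 2 * Real.pi / n|) ?_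
    fun z' hz' => (hz'.2.2 k).le).trans_lt h
  have : ContinuousAt (fun z => trueGap p τ k z) z :=
    ContinuousAt.comp (g := Complex.arg) (Complex.continuousAt_arg hslit) hwc
  exact (this.sub continuousAt_const).abs

/-- Deviations of the gaps sum to zero; if all exceed `-μ`, each is at most `nμ`, which bounds the
sum of squares. -/
theorem exists_trueGap_le_of_lt_sqGaps [NeZero n] {μ : ℝ} (hμ : 0 ≤ μ)
    (hsum : ∑ k, trueGap p τ k z = 2 * Real.pi) (hV : n * (n * μ) ^ 2 < sqGaps p τ z) :
    ∃ k, trueGap p τ k z ≤ 2 * Real.pi / n - μ := by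
  by_contra! hcon
  have hn0 : (n : ℝ) ≠ 0 := Nat.cast_ne_zero.mpr (NeZero.ne n)
  have hn1 : (1 : ℝ) ≤ n := by exact_mod_cast NeZero.pos n
  refine hV.not_ge ?_
  have hsum' : ∑ k, (trueGap p τ k z - 2 * Real.pi / n + μ) = n * μ := by
    rw [Finset.sum_add_distrib, Finset.sum_sub_distrib, hsum]
    simp
    field_simp
    ring
  refine (Finset.sum_le_sum fun k _ => ?_).trans_eq (by simp :
    ∑ _k : Fin n, (n * μ) ^ 2 = n * (n * μ) ^ 2)
  have h1 := Finset.single_le_sum (f := fun k => trueGap p τ k z - 2 * Real.pi / n + μ)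
    (fun k _ => by linarith [hcon k]) (Finset.mem_univ k)
  simp only [hsum'] at h1
  exact sq_le_sq' (by nlinarith [hcon k]) (by linarith)

namespace GoodTube

variable [NeZero n] {a C₁ C₂ δ : ℝ}

/-- Inside a tube, the deviation decays exponentially, and the gaps change little. -/
theorem exists_decay (h : GoodTube (n := n) p a C₁ C₂ δ) (ha : 0 < a) (hk : 0 < p.k)
    (hC₁ : 0 < C₁) (hC₂ : 0 ≤ C₂) : ∃ b > 0, ∃ D > 0, ∀ δ' > 0, δ' ≤ 1 →
      ∀ (τ : Equiv.Perm (Fin n)) (F : State n m → State n m),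
        Set.EqOn F (vectorField p) (tube p τ δ) → ∀ (x : ℝ → State n m) (T : ℝ),
        IsSolutionOn F x T → (∀ t ∈ Set.Icc 0 T, x t ∈ tube p τ δ) → x 0 ∈ tube p τ δ' →
        ∀ t ∈ Set.Icc 0 T, deviation p (x t) ≤ D * √δ' * Real.exp (-b * t) ∧
          sqGaps p τ (x t) ≤ D * √δ' := by
  obtain ⟨b, hb, hba, hbk⟩ : ∃ b > 0, 2 * (2 * b) < a ∧ 2 * b ≤ p.k / 2 := by
    refine ⟨min a p.k / 8, by positivity, ?_, ?_⟩
    · linarith [min_le_left a p.k]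
    · linarith [min_le_right a p.k]
  set E : ℝ := n * m with hE
  have hE0 : 0 ≤ E := by positivity
  -- With this `A`, the barrier `A * δ' * exp (-(2 * b) * t)` strictly dominates the radial
  -- inequality driven by estimation errors of the same rate, since `k / 2 * A = k / 2 + C₁ * E`.
  set A : ℝ := 1 + 2 * C₁ * E / p.k with hA
  have hA1 : 1 ≤ A := le_add_of_nonneg_right (by positivity)
  have hAE : C₁ * E < (p.k - 2 * b) * A := by
    have h1 : p.k / 2 * A ≤ (p.k - 2 * b) * A := by
      gcongr
      linarith
    have h2 : p.k / 2 * A = p.k / 2 + C₁ * E := by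
      rw [hA]
      field_simp
    linarith
  have hn0 : (0 : ℝ) < n := by exact_mod_cast NeZero.pos n
  set D : ℝ := √E + n * √A with hD
  have hDpos : 0 < D := by positivity
  refine ⟨b, hb, D + n + (C₂ + 1) * D / b, by positivity, ?_⟩
  intro δ' hδ' hδ'1 τ F hF x T hx hxt h0
  rcases lt_or_ge T 0 with hT | hT
  · intro t ht
    exact absurd (ht.1.trans ht.2) hT.not_ge
  -- Rate `2 * b` for the errors becomes rate `b` for `estError`, which contains a square root; this
  -- is also the source of `√δ'`.
  have e1 := h.abs_error_le hF hx hxt (b := 2 * b) hba hδ' fun i j => (h0.1 i j).le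
  have hexp (t : ℝ) : Real.exp (-(2 * b) * t) = Real.exp (-b * t) ^ 2 := by
    rw [← Real.exp_nat_mul]
    congr 1
    push_cast; ring
  have e2 : ∀ t ∈ Set.Icc 0 T, estError p (x t) ≤ √E * √δ' * Real.exp (-b * t) := by
    intro t ht
    refine (estError_le (e1 t ht)).trans_eq ?_
    rw [hexp, ← Real.sqrt_mul hE0, show (n : ℝ) * (m * (δ' * Real.exp (-b * t) ^ 2)) =
      E * δ' * Real.exp (-b * t) ^ 2 by rw [hE]; ring, Real.sqrt_mul (by positivity),
      Real.sqrt_sq (Real.exp_pos _).le]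
  have e3 := h.sqRadial_le_of_error hF hx hxt (b := 2 * b) (E := E * δ') (A := A * δ')
    (by nlinarith) (fun i => by
      refine (sq_le_sq' (abs_lt.mp (h0.2.1 i)).1.le (abs_lt.mp (h0.2.1 i)).2.le).trans ?_
      nlinarith) (fun t ht => by
      have h1 := pow_le_pow_left₀ estError_nonneg (e2 t ht) 2
      rwa [mul_pow, mul_pow, Real.sq_sqrt hE0, Real.sq_sqrt hδ'.le, ← hexp] at h1) hC₁.le
  have e4 : ∀ t ∈ Set.Icc 0 T, deviation p (x t) ≤ D * √δ' * Real.exp (-b * t) := by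
    intro t ht
    have h1 : ∀ i, |‖(x t).1 i - center p‖ - orbitRadius p| ≤
        √A * √δ' * Real.exp (-b * t) := fun i => by
      refine abs_le_of_sq_le_sq ((e3 t ht i).trans_eq ?_) (by positivity)
      rw [hexp, mul_pow, mul_pow, Real.sq_sqrt (by positivity), Real.sq_sqrt hδ'.le]
    refine (add_le_add (e2 t ht) ((Finset.sum_le_sum fun i _ => h1 i).trans_eq (by simp :
      ∑ _i : Fin n, √A * √δ' * Real.exp (-b * t) =
        n * (√A * √δ' * Real.exp (-b * t))))).trans_eq ?_
    rw [hD]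
    ring
  have hsq : 0 < √δ' := Real.sqrt_pos.mpr hδ'
  have e5 := h.sqGaps_le_of_deviation hF hx hxt hb (by positivity : 0 < D * √δ') hC₂ e4
  refine fun t ht => ⟨(e4 t ht).trans ?_, (e5 t ht).trans ?_⟩
  · gcongr
    have : 0 ≤ (C₂ + 1) * D / b := by positivity
    linarith
  · have h1 := sqGaps_le_of_mem_tube h0
    have h2 : δ' ^ 2 ≤ √δ' := by
      have h3 : √δ' ≤ 1 := Real.sqrt_le_one.mpr hδ'1
      have h4 := Real.sq_sqrt hδ'.le
      nlinarith
    have h3 : (n : ℝ) * δ' ^ 2 ≤ n * √δ' := by gcongr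
    have h4 : (D + n + (C₂ + 1) * D / b) * √δ' =
        D * √δ' + n * √δ' + (C₂ + 1) * (D * √δ') / b := by ring
    have h5 : 0 ≤ D * √δ' := by positivity
    linarith

/-- Trajectories that start close to the equilibrium stay close to it, and their deviation decays
exponentially. -/
theorem exists_stays (h : GoodTube (n := n) p a C₁ C₂ δ) (hn : 3 ≤ n) (ha : 0 < a) (hk : 0 < p.k)
    (hC₁ : 0 < C₁) (hC₂ : 0 ≤ C₂) : ∃ b > 0, ∃ D : ℝ, ∀ δ₁ > 0, ∃ δ₂ > 0,
      ∀ (τ : Equiv.Perm (Fin n)) (F : State n m → State n m),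
        Set.EqOn F (vectorField p) (tube p τ δ) → ∀ (x : ℝ → State n m) (T : ℝ), 0 ≤ T →
        IsSolutionOn F x T → x 0 ∈ tube p τ δ₂ →
        ∀ t ∈ Set.Icc 0 T, x t ∈ tube p τ δ₁ ∧ deviation p (x t) ≤ D * Real.exp (-b * t) := by
  obtain ⟨b, hb, D, hD, hdec⟩ := h.exists_decay ha hk hC₁ hC₂
  refine ⟨b, hb, D, fun δ₁ hδ₁ => ?_⟩
  set η : ℝ := min (min δ₁ 1) (δ / 2) with hη
  have hδ := h.pos
  have hη0 : 0 < η := lt_min (lt_min hδ₁ one_pos) (half_pos hδ)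
  have hη1 : η ≤ 1 := (min_le_left _ _).trans (min_le_right _ _)
  have hηδ : η < δ := (min_le_right _ _).trans_lt (half_lt_self hδ)
  have hηδ₁ : η ≤ δ₁ := (min_le_left _ _).trans (min_le_left _ _)
  -- As `η ≤ 1`, the single bound `η ^ 2` controls both the deviation, which must be below `η`, and
  -- `sqGaps`, which must be below `η ^ 2`.
  obtain ⟨δ₂, hδ₂, hδ₂η, hsmall⟩ : ∃ δ₂ > 0, δ₂ ≤ η ∧ D * √δ₂ < η ^ 2 := by
    have hc : Continuous fun s : ℝ => D * √s := by fun_prop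
    have h1 : ∀ᶠ s in 𝓝[>] (0 : ℝ), D * √s < η ^ 2 :=
      nhdsWithin_le_nhds (hc.continuousAt.eventually (gt_mem_nhds (by simpa using pow_pos hη0 2)))
    obtain ⟨s, h2, h3⟩ := (h1.and (Ioo_mem_nhdsGT hη0)).exists
    exact ⟨s, h3.1, h3.2.le, h2⟩
  have hηη : η ^ 2 ≤ η := by nlinarith
  refine ⟨δ₂, hδ₂, fun τ F hF x T hT hx h0 => ?_⟩
  have hδ₂1 := hδ₂η.trans hη1
  have hV : ∀ t ∈ Set.Icc 0 T, x t ∈ tube p τ η := by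
    refine mem_of_forall_mem_neighborhood hT (hx.continuousOn hT) (h.isOpen_tube τ)
      (closure_tube_subset hn hηδ h.lt_radius.le h.le_pi_div_six) (tube_mono hδ₂η h0)
      fun t ht hs s hs' => ?_
    obtain ⟨h1, h2⟩ := hdec δ₂ hδ₂ hδ₂1 τ F hF x t (hx.mono ht.1 ht.2) hs h0 s hs'
    refine mem_tube_of_deviation_lt hη1 (h1.trans_lt ?_) (h2.trans_lt hsmall)
    have h3 : Real.exp (-b * s) ≤ 1 := Real.exp_le_one_iff.mpr (by nlinarith [hs'.1])
    have h4 : 0 ≤ D * √δ₂ := by positivity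
    nlinarith
  intro t ht
  refine ⟨tube_mono hηδ₁ (hV t ht), ?_⟩
  refine (hdec δ₂ hδ₂ hδ₂1 τ F hF x T hx (fun s hs => tube_mono hηδ.le (hV s hs)) h0 t ht).1.trans ?_
  gcongr
  exact mul_le_of_le_one_right hD.le (Real.sqrt_le_one.mpr hδ₂1)

/-- Along trajectories that stay in a tube and whose deviation vanishes in the limit, the gaps
become equal. -/
theorem eventually_sqGaps_le (h : GoodTube (n := n) p a C₁ C₂ δ) {x : ℝ → State n m}
    (hx : IsGlobalSolution (vectorField p) x) (hxt : ∀ t, 0 ≤ t → x t ∈ tube p τ δ)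
    (hdev : Tendsto (fun t => deviation p (x t)) atTop (𝓝 0)) {v : ℝ} (hv : 0 < v) :
    ∀ᶠ t in atTop, sqGaps p τ (x t) ≤ v := by
  have hn0 : (0 : ℝ) < n := by exact_mod_cast NeZero.pos n
  obtain ⟨μ, hμ, hμv⟩ : ∃ μ > 0, n * (n * μ) ^ 2 < v := by
    have hc : Continuous fun μ : ℝ => n * (n * μ) ^ 2 := by fun_prop
    have h1 : ∀ᶠ μ in 𝓝[>] (0 : ℝ), n * (n * μ) ^ 2 < v :=
      nhdsWithin_le_nhds (hc.continuousAt.eventually (gt_mem_nhds (by simpa using hv)))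
    obtain ⟨μ, h2, h3⟩ := (h1.and self_mem_nhdsWithin).exists
    exact ⟨μ, h3, h2⟩
  obtain ⟨w, hw, d₀, hd₀, hneg⟩ := h.sqGaps_le_neg μ hμ
  obtain ⟨T₀, hT₀⟩ := eventually_atTop.mp
    ((hdev.eventually (gt_mem_nhds hd₀)).and (eventually_ge_atTop 0))
  have hT₀0 : 0 ≤ T₀ := (hT₀ T₀ le_rfl).2
  have hdecr : ∀ t, T₀ ≤ t → v ≤ sqGaps p τ (x t) → ∀ᶠ z in 𝓝 (x t), z ∈ tube p τ δ →
      fderiv ℝ (sqGaps p τ) z (vectorField p z) ≤ -w := by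
    intro t ht hvt
    have h1 := (continuous_deviation p).continuousAt.eventually (gt_mem_nhds (hT₀ t ht).1)
    have h2 := (h.contDiffAt_sqGaps (hxt t (hT₀0.trans ht))).continuousAt.eventually
      (lt_mem_nhds (hμv.trans_le hvt))
    filter_upwards [h1, h2] with z hz1 hz2 hz
    exact hneg τ z hz hz1.le (exists_trueGap_le_of_lt_sqGaps hμ.le (h.sum_gap τ z hz) hz2)
  have hV : 0 ≤ sqGaps p τ (x T₀) := Finset.sum_nonneg fun _ _ => sq_nonneg _
  -- The time at which a line of slope `-w / 2` from `sqGaps p τ (x T₀) + v` reaches `v`. Half the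
  -- available rate keeps the comparison strict; from `T₁` on, the constant `v` is a barrier.
  set T₁ : ℝ := T₀ + 2 * sqGaps p τ (x T₀) / w with hT₁
  have hT₁T₀ : T₀ ≤ T₁ := le_add_of_nonneg_right (by positivity)
  have h1 := h.le_barrier (Set.eqOn_refl _ _) (hx T₁ (hT₀0.trans hT₁T₀)) hT₀0 le_rfl
    (fun t ht => hxt t (hT₀0.trans ht.1)) (W := sqGaps p τ) (fun z hz => h.contDiffAt_sqGaps hz)
    (B := fun t => sqGaps p τ (x T₀) + v - w / 2 * (t - T₀)) (B' := fun _ => -(w / 2))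
    (fun t => by
      have := (((hasDerivAt_id t).sub_const T₀).const_mul (w / 2)).const_sub
        (sqGaps p τ (x T₀) + v)
      simpa using this) (by simp [hv.le])
    (fun t ht heq => ⟨-w, by linarith, hdecr t ht.1 (by
      have h2 : w / 2 * (t - T₀) ≤ sqGaps p τ (x T₀) := by
        have h3 : t - T₀ ≤ 2 * sqGaps p τ (x T₀) / w := by linarith [ht.2]
        rw [le_div_iff₀ hw] at h3
        linarith
      linarith)⟩) T₁ ⟨hT₁T₀, le_rfl⟩
  have h2 : sqGaps p τ (x T₁) ≤ v := by
    refine h1.trans_eq ?_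
    rw [hT₁]
    field_simp
    ring
  filter_upwards [eventually_ge_atTop T₁] with t ht
  have hT₁0 := hT₀0.trans hT₁T₀
  exact h.le_barrier (Set.eqOn_refl _ _) (hx t (hT₁0.trans ht)) hT₁0 le_rfl
    (fun s hs => hxt s (hT₁0.trans hs.1)) (W := sqGaps p τ) (fun z hz => h.contDiffAt_sqGaps hz)
    (B := fun _ => v) (B' := fun _ => 0) (fun s => hasDerivAt_const s v) h2
    (fun s hs heq => ⟨-w, by linarith, hdecr s (hT₁T₀.trans hs.1) heq.ge⟩) t ⟨ht, le_rfl⟩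

theorem eventually_mem_tube (h : GoodTube (n := n) p a C₁ C₂ δ) {x : ℝ → State n m}
    (hx : IsGlobalSolution (vectorField p) x) (hxt : ∀ t, 0 ≤ t → x t ∈ tube p τ δ)
    (hdev : Tendsto (fun t => deviation p (x t)) atTop (𝓝 0)) {δ' : ℝ} (hδ' : 0 < δ') :
    ∀ᶠ t in atTop, x t ∈ tube p τ δ' := by
  have hη : 0 < min δ' 1 := lt_min hδ' one_pos
  filter_upwards [hdev.eventually (gt_mem_nhds hη),
    h.eventually_sqGaps_le hx hxt hdev (half_pos (pow_pos hη 2))] with t h1 h2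
  exact tube_mono (min_le_left _ _) (mem_tube_of_deviation_lt (min_le_right _ _) h1
    (h2.trans_lt (half_lt_self (pow_pos hη 2))))

/-- Existence of solutions that start close to the equilibrium. -/
theorem exists_isGlobalSolution (h : GoodTube (n := n) p a C₁ C₂ δ) (hn : 3 ≤ n) (ha : 0 < a)
    (hk : 0 < p.k) (hC₁ : 0 < C₁) (hC₂ : 0 ≤ C₂) : ∃ δ₂ > 0, ∀ (τ : Equiv.Perm (Fin n)),
      ∀ z ∈ tube p τ δ₂, ∃ x : ℝ → State n m, x 0 = z ∧ IsGlobalSolution (vectorField p) x := by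
  obtain ⟨b, hb, D, hstay⟩ := h.exists_stays hn ha hk hC₁ hC₂
  obtain ⟨δ₂, hδ₂, hstay⟩ := hstay δ h.pos
  obtain ⟨C, hC⟩ := h.bounded
  refine ⟨δ₂, hδ₂, fun τ z hz => ?_⟩
  classical
  -- Cutting off outside the tube makes the field globally bounded. Its solutions never leave the
  -- tube, so they solve the original system.
  have hF : Set.EqOn ((tube p τ δ).indicator (vectorField p)) (vectorField p) (tube p τ δ) :=
    fun z hz => Set.indicator_of_mem hz _
  obtain ⟨x, hx0, hx⟩ := Circumnav.exists_isGlobalSolution (C := C)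
    (F := (tube p τ δ).indicator (vectorField p)) (fun z => by
      by_cases hz : z ∈ tube p τ δ
      · rw [hF hz]
        exact hC τ z hz
      · rw [Set.indicator_of_notMem hz, norm_zero]
        exact C.2) z
  exact ⟨x, hx0, fun T hT => (hx T hT).congr (h.isOpen_tube τ) hF
    fun t ht => (hstay τ _ hF x T hT (hx T hT) (hx0 ▸ hz) t ht).1⟩

end GoodTube

end Invariance

/-- Asymptotic stability of the equidistant rotation on the desired orbit. -/
theorem Params.IsRegular.isAsymptoticallyStable {n m : ℕ} [NeZero n] [NeZero m] (hn : 3 ≤ n)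
    {p : Params m} (hp : p.IsRegular) (hM : 2 * orbitRadius p * Real.sin (Real.pi / n) ≤ p.M)
    (A : Set (State n m)) :
    IsAsymptoticallyStable (vectorField p) A (NearEquilibrium p) := by
  obtain ⟨a, ha, C₁, hC₁, C₂, hC₂, hgood⟩ := eventually_goodTube hn hp hM
  obtain ⟨δ, h⟩ := hgood.exists
  obtain ⟨b, hb, D, hstay⟩ := h.exists_stays hn ha hp.k_pos hC₁ hC₂
  refine ⟨?_, fun ε hε => ?_, ?_⟩
  · obtain ⟨δ₂, hδ₂, hex⟩ := h.exists_isGlobalSolution hn ha hp.k_pos hC₁ hC₂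
    obtain ⟨δ₃, hδ₃, hnear⟩ := exists_mem_tube_of_nearEquilibrium (n := n) hn hp hδ₂
    refine ⟨δ₃, hδ₃, fun z _ hz => ?_⟩
    obtain ⟨τ, hτ⟩ := hnear z hz
    exact hex τ z hτ
  · obtain ⟨δ₁, hδ₁, hδ₁0⟩ :=
      ((eventually_nearEquilibrium hn hp hε).and self_mem_nhdsWithin).exists
    obtain ⟨δ₂, hδ₂, hstay⟩ := hstay δ₁ hδ₁0
    obtain ⟨δ₃, hδ₃, hnear⟩ := exists_mem_tube_of_nearEquilibrium (n := n) hn hp hδ₂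
    refine ⟨δ₃, hδ₃, fun x T hT hx _ hz t ht => ?_⟩
    obtain ⟨τ, hτ⟩ := hnear _ hz
    exact hδ₁ τ _ (hstay τ _ (Set.eqOn_refl _ _) x T hT hx hτ t ht).1
  · obtain ⟨δ₂, hδ₂, hstay⟩ := hstay δ h.pos
    obtain ⟨δ₃, hδ₃, hnear⟩ := exists_mem_tube_of_nearEquilibrium (n := n) hn hp hδ₂
    refine ⟨δ₃, hδ₃, fun x hx _ hz ε hε => ?_⟩
    obtain ⟨τ, hτ⟩ := hnear _ hz
    obtain ⟨δ₁, hδ₁, hδ₁0⟩ :=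
      ((eventually_nearEquilibrium hn hp hε).and self_mem_nhdsWithin).exists
    have hs : ∀ t, 0 ≤ t → x t ∈ tube p τ δ ∧ deviation p (x t) ≤ D * Real.exp (-b * t) :=
      fun t ht => hstay τ _ (Set.eqOn_refl _ _) x t ht (hx t ht) hτ t ⟨ht, le_rfl⟩
    have hlim : Filter.Tendsto (fun t => D * Real.exp (-b * t)) Filter.atTop (nhds 0) := by
      have h1 : Filter.Tendsto (fun t => -b * t) Filter.atTop Filter.atBot :=
        Filter.tendsto_id.const_mul_atTop_of_neg (neg_lt_zero.mpr hb)
      simpa using (Real.tendsto_exp_atBot.comp h1).const_mul D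
    have hdev : Filter.Tendsto (fun t => deviation p (x t)) Filter.atTop (nhds 0) :=
      tendsto_of_tendsto_of_tendsto_of_le_of_le' tendsto_const_nhds hlim
        (Filter.Eventually.of_forall fun t => deviation_nonneg)
        ((Filter.eventually_ge_atTop 0).mono fun t ht => (hs t ht).2)
    exact (h.eventually_mem_tube hx (fun t ht => (hs t ht).1) hdev hδ₁0).mono
      fun t ht => hδ₁ τ _ ht

end Circumnav
end

theorem mainTheorem6 {n m : ℕ} (hn : 3 ≤ n) (hm : 1 ≤ m) (p : Circumnav.Params m)
    (hk : 0 < p.k) (hα : 0 < p.α)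
    (hh : 0 < p.h) (hrs : p.h < p.rs) (hd : p.rs < p.d)
    (hf_mono : StrictMonoOn p.f (Set.Ioi 0)) (hf_cont : ContinuousOn p.f (Set.Ioi 0))
    (hf_maps : Set.MapsTo p.f (Set.Ioi 0) (Set.Ioc 0 1))
    (hM : 2 * Circumnav.orbitRadius p * Real.sin (Real.pi / n) ≤ p.M) :
    Circumnav.IsAsymptoticallyStable
      (Circumnav.vectorField p : Circumnav.State n m → Circumnav.State n m)
      (Circumnav.admissible p n) (Circumnav.NearEquilibrium p) := by
  have : NeZero n := ⟨by omega⟩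
  have : NeZero m := ⟨by omega⟩
  exact Circumnav.Params.IsRegular.isAsymptoticallyStable hn
    ⟨hk, hα, hh, hrs, hd, hf_mono, hf_maps⟩ hM _
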